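/- **Setting.** Let $d\in\{2,3\}$, let $D_{\rm ref}\subset\mathbb R^d$ be a bounded Lipschitz domain, $U=[0,1]^{\mathbb N}$, and let $\mathscr F$ be the set of finitely supported multi-indices $\boldsymbol\nu\in\mathbb N_0^{\mathbb N}$. For vector fields $\boldsymbol\psi_i:\overline{D_{\rm ref}}\to\mathbb R^d$ ($i\ge 1$) with Jacobian matrices $\boldsymbol\psi_i'$ put $$\boldsymbol V(\boldsymbol x,\boldsymbol y)=\boldsymbol x+\tfrac1{\sqrt6}\sum_{i\ge1}\sin(2\pi y_i)\boldsymbol\psi_i(\boldsymbol x),\qquad J(\boldsymbol x,\boldsymbol y)=I+\tfrac1{\sqrt6}\sum_{i\ge1}\sin(2\pi y_i)\boldsymbol\psi_i'(\boldsymbol x),$$ $D(\boldsymbol y)=\boldsymbol V(D_{\rm ref},\boldsymbol y)$ and $\mathcal D=\bigcup_{\boldsymbol y\in U}D(\boldsymbol y)$. Let $\|\boldsymbol\psi\|_{W^{1,\infty}}$ be the maximum of the essential suprema over $D_{\rm ref}$ of the Euclidean norm of $\boldsymbol\psi$ and of the spectral norm of $\boldsymbol\psi'$. Assume: * (A1)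 for each $\boldsymbol y\in U$, $\boldsymbol V(\cdot,\boldsymbol y)$ is injective and twice continuously differentiable on $\overline{D_{\rm ref}}$; * (A2) for each $\boldsymbol y\in U$ the inverse $\boldsymbol V^{-1}(\cdot,\boldsymbol y)$ is twice continuously differentiable on $\overline{D(\boldsymbol y)}$, and $\|\boldsymbol V(\cdot,\boldsymbol y)\|_{\mathcal C^2(\overline{D_{\rm ref}})}\le C$ and $\|\boldsymbol V^{-1}(\cdot,\boldsymbol y)\|_{\mathcal C^2(\overline{D(\boldsymbol y)})}\le C$ for some $C>0$ independent of $\boldsymbol y\in U$; * (A3) $0<\sigma_{\min}\le1\le\sigma_{\max}<\infty$ are constants such that all singular values of $J(\boldsymbol x,\boldsymbol y)$ lie in $[\sigma_{\min},\sigma_{\max}]$ for all $\boldsymbol x\in D_{\rm ref}$, $\boldsymbol y\in U$; * (A4) $\|\boldsymbol\psi_i\|_{W^{1,\infty}}<\infty$ for all $i$ and $\sum_{i\ge1}\|\boldsymbol\psi_i\|_{W^{1,\infty}}<\infty$. Put $b_i=\frac1{\sqrt6}\|\boldsymbol\psi_i\|_{W^{1,\infty}}$, $\xi_{\boldsymbol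 b}=\sum_{i\ge1} b_i$, and $A=(J^\top J)^{-1}\det J$. Let $H_0^1(D_{\rm ref})$ be the closure of $C_c^\infty(D_{\rm ref})$ in the $H^1$ norm, write $\|v\|_{H_0^1(D_{\rm ref})}=\|\nabla v\|_{L^2(D_{\rm ref})}$, and let $C_P$ be the Poincaré constant, i.e. the smallest constant with $\|v\|_{L^2}\le C_P\|v\|_{H_0^1}$ for all $v\in H_0^1(D_{\rm ref})$. Let $f:\mathcal D\to\mathbb R$ be real-analytic and put $f_{\rm ref}(\boldsymbol x,\boldsymbol y)=f(\boldsymbol V(\boldsymbol x,\boldsymbol y))\det J(\boldsymbol x,\boldsymbol y)$. **Theorem.** (i) If $f$ is analytic on a neighbourhood of $\overline{\mathcal D}$, then there are constants $C_f>0$ and $\rho\ge1$ with $$\|\partial^{\boldsymbol\lambda}_{\boldsymbol x}f\|_{L^\infty(\mathcal D)}\le C_f\,\boldsymbol\lambda!\,\rho^{|\boldsymbol\lambda|}\qquad\text{for all }\boldsymbol\lambda\in\mathbb N_0^d.\tag{1}$$ (ii) Let $C_f>0$ and $\rho\ge1$ be any constants for which (1) holds. Then for every $\boldsymbol y\in U$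 there is exactly one $\widehat u(\cdot,\boldsymbol y)\in H_0^1(D_{\rm ref})$ with $$\int_{D_{\rm ref}}\big(A(\boldsymbol x,\boldsymbol y)\nabla\widehat u(\boldsymbol x,\boldsymbol y)\big)\cdot\nabla v(\boldsymbol x)\,{\rm d}\boldsymbol x=\int_{D_{\rm ref}}f_{\rm ref}(\boldsymbol x,\boldsymbol y)\,v(\boldsymbol x)\,{\rm d}\boldsymbol x\qquad\text{for all }v\in H_0^1(D_{\rm ref}).$$ As a map from $U$ to $H_0^1(D_{\rm ref})$, $\widehat u$ has mixed partial derivatives $\partial_{\boldsymbol y}^{\boldsymbol\nu}\widehat u$ of every order $\boldsymbol\nu\in\mathscr F$ on $U$, independent of the order of differentiation (one-sided derivatives at $y_j\in\{0,1\}$), and for all $\boldsymbol y\in U$ and $\boldsymbol\nu\in\mathscr F\setminus\{\boldsymbol0\}$ $$\|\partial_{\boldsymbol y}^{\boldsymbol\nu}\widehat u(\cdot,\boldsymbol y)\|_{H_0^1(D_{\rm ref})}\le 2C_{\rm init}\left(\frac{4\pi\,d!\,(2+\xi_{\boldsymbol b})^d(1+\xi_{\boldsymbol b})^3}{\sigma_{\min}^{d+4}}\right)^{|\boldsymbol\nu|}\sum_{\boldsymbol0\ne\boldsymbol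 m\le\boldsymbol\nu}\frac{(|\boldsymbol m|+d-1)!}{(d-1)!}\,\boldsymbol m!\,\boldsymbol\beta^{\boldsymbol m}\prod_{i\ge1}S(\nu_i,m_i),$$ where $$C_{\rm init}=\frac{(1+\xi_{\boldsymbol b})^2}{\sigma_{\min}^d}\,C_P\,|D_{\rm ref}|^{1/2}\,C_f\,d!\,(2+\xi_{\boldsymbol b})^d,\qquad \beta_j=(2+\sqrt2)\max(1+\sqrt3,\rho)\,b_j,$$ $|\boldsymbol m|=\sum_i m_i$, $\boldsymbol m!=\prod_i m_i!$, $\boldsymbol\beta^{\boldsymbol m}=\prod_i\beta_i^{m_i}$, the relation $\boldsymbol m\le\boldsymbol\nu$ is meant componentwise, and $S(n,m)$ are the Stirling numbers of the second kind. -/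

import Mathlib

open MeasureTheory Set Filter Topology
open scoped ENNReal NNReal ContDiff InnerProductSpace

noncomputable section

namespace DomainUQ

/-- Euclidean space of dimension `d`. -/
abbrev E (d : ℕ) := EuclideanSpace ℝ (Fin d)

/-- The parameter set `U = [0,1]^ℕ`. -/
def U : Set (ℕ → ℝ) := {y | ∀ i, y i ∈ Icc (0 : ℝ) 1}

/-- A bounded Lipschitz domain: a bounded, nonempty, connected open set which, near each of its
boundary points `p`, is the strict subgraph of a Lipschitz function in the direction of some unit
vector `n` (`x - ⟪n, x⟫ • n` is the component of `x` orthogonal to `n`). -/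
structure IsBoundedLipschitzDomain {d : ℕ} (D : Set (E d)) : Prop where
  isOpen : IsOpen D
  isConnected : IsConnected D
  isBounded : Bornology.IsBounded D
  lipschitz_boundary : ∀ p ∈ frontier D, ∃ (n : E d) (r : ℝ) (K : ℝ≥0) (φ : E d → ℝ),
    ‖n‖ = 1 ∧ 0 < r ∧ LipschitzWith K φ ∧
      ∀ x ∈ Metric.ball p r, x ∈ D ↔ ⟪n, x⟫_ℝ < φ (x - ⟪n, x⟫_ℝ • n)

section Derivatives

variable {d : ℕ} {F : Type*} [NormedAddCommGroup F] [NormedSpace ℝ F]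

/-- The partial derivative `∂_{i 0} ∂_{i 1} ⋯ ∂_{i (n-1)} v (x)` of order `n`, taken within `S`
(the ordinary one when `S` is open). -/
def partialWithin (S : Set (E d)) (v : E d → F) {n : ℕ} (i : Fin n → Fin d) (x : E d) : F :=
  iteratedFDerivWithin ℝ n v S x (fun k => EuclideanSpace.single (i k) (1 : ℝ))

/-- The `C^k(S)` norm: the largest of the suprema over `S` of all partial derivatives of
order at most `k`. -/
def ckNorm (k : ℕ) (S : Set (E d)) (v : E d → F) : ℝ≥0∞ :=
  ⨆ (n : Fin (k + 1)) (i : Fin n → Fin d) (x ∈ S), ‖partialWithin S v i x‖ₑ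

/-- `|∂^λ f| ≤ C λ! ρ^|λ|` on `S` for all multi-indices `λ`. The multi-index of the derivative
`∂_{i 0} ⋯ ∂_{i (n-1)}` has `j`-th entry `#{k | i k = j}` and order `n`. -/
def HasAnalyticBounds (S : Set (E d)) (f : E d → ℝ) (C ρ : ℝ) : Prop :=
  ∀ (n : ℕ) (i : Fin n → Fin d), ∀ x ∈ S, |partialWithin S f i x| ≤
    C * (∏ j : Fin d, ((Finset.univ.filter fun k => i k = j).card.factorial : ℝ)) * ρ ^ n

end Derivatives

section Sobolev

variable {X : Type*} [NormedAddCommGroup X] [InnerProductSpace ℝ X] [FiniteDimensional ℝ X]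
  [MeasurableSpace X] [BorelSpace X]

/-- The `W^{1,∞}(D)` norm of a vector field (spectral norm of the Jacobian), possibly infinite. -/
def w1InfNorm (D : Set X) (ψ : X → X) : ℝ≥0∞ :=
  max (eLpNorm ψ ∞ (volume.restrict D)) (eLpNorm (fderiv ℝ ψ) ∞ (volume.restrict D))

/-- The product `L²(D) × L²(D)^d`, with norm `(‖v‖² + ‖g‖²)^{1/2}`. -/
abbrev L2Pair (D : Set X) :=
  WithLp 2 (Lp ℝ 2 (volume.restrict D) × Lp X 2 (volume.restrict D))

/-- `H_0^1(D)`, the closure of `C_c^∞(D)` in the `H^1` norm. A function `v` is represented by the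
pair `(v, ∇v)`, whose norm in `L2Pair D` is the `H^1` norm of `v`. -/
def H01 (D : Set X) : Submodule ℝ (L2Pair D) :=
  (Submodule.span ℝ {w : L2Pair D | ∃ φ : X → ℝ,
    ContDiff ℝ ∞ φ ∧ HasCompactSupport φ ∧ tsupport φ ⊆ D ∧
      w.fst =ᵐ[volume.restrict D] φ ∧ w.snd =ᵐ[volume.restrict D] gradient φ}).topologicalClosure

variable {D : Set X}

/-- The underlying element of `L²(D)`. -/
def fn (v : H01 D) : Lp ℝ 2 (volume.restrict D) := v.val.fst

/-- The weak gradient. -/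
def grad (v : H01 D) : Lp X 2 (volume.restrict D) := v.val.snd

/-- The norm `‖v‖_{H_0^1(D)} = ‖∇v‖_{L²(D)}`. -/
def h01Norm (v : H01 D) : ℝ := ‖grad v‖

/-- The Poincaré constant of `D`: the smallest `C ≥ 0` with `‖v‖_{L²} ≤ C ‖∇v‖_{L²}` on
`H_0^1(D)`. -/
def poincareConst (D : Set X) : ℝ :=
  sInf {C : ℝ | 0 ≤ C ∧ ∀ v : H01 D, ‖fn v‖ ≤ C * h01Norm v}

end Sobolev

section Transport

variable {X : Type*} [NormedAddCommGroup X] [InnerProductSpace ℝ X] [FiniteDimensional ℝ X]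
  [MeasurableSpace X] [BorelSpace X]

/-- `V(x,y) = x + 6^{-1/2} ∑_i sin(2π y_i) ψ_i(x)`. -/
def V (ψ : ℕ → X → X) (x : X) (y : ℕ → ℝ) : X :=
  x + (1 / √6) • ∑' i, Real.sin (2 * Real.pi * y i) • ψ i x

/-- `J(x,y) = I + 6^{-1/2} ∑_i sin(2π y_i) ψ_i'(x)`. -/
def J (ψ : ℕ → X → X) (x : X) (y : ℕ → ℝ) : X →L[ℝ] X :=
  ContinuousLinearMap.id ℝ X +
    (1 / √6) • ∑' i, Real.sin (2 * Real.pi * y i) • fderiv ℝ (ψ i) x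

/-- `B = Jᵀ J`. -/
def B (ψ : ℕ → X → X) (x : X) (y : ℕ → ℝ) : X →L[ℝ] X :=
  (ContinuousLinearMap.adjoint (J ψ x y)).comp (J ψ x y)

/-- `A = B⁻¹ det J`. -/
def A (ψ : ℕ → X → X) (x : X) (y : ℕ → ℝ) : X →L[ℝ] X :=
  (J ψ x y).det • (B ψ x y).inverse

/-- `f_ref(x,y) = f(V(x,y)) det J(x,y)`. -/
def fRef (ψ : ℕ → X → X) (f : X → ℝ) (x : X) (y : ℕ → ℝ) : ℝ :=
  f (V ψ x y) * (J ψ x y).det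

/-- `D(y) = V(D_ref, y)`. -/
def domainAt (D : Set X) (ψ : ℕ → X → X) (y : ℕ → ℝ) : Set X :=
  (fun x => V ψ x y) '' D

/-- The hold-all domain `⋃_{y ∈ U} D(y)`. -/
def holdAll (D : Set X) (ψ : ℕ → X → X) : Set X :=
  ⋃ y ∈ U, domainAt D ψ y

/-- The inverse of `V(·, y)` on the closure of `D_ref`. -/
def Vinv (D : Set X) (ψ : ℕ → X → X) (y : ℕ → ℝ) : X → X :=
  Function.invFunOn (fun x => V ψ x y) (closure D)

/-- For each `y`, `V(·, y)` is an invertible `C²` vector field on the closure of `D_ref`. -/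
def AssumptionA1 (D : Set X) (ψ : ℕ → X → X) : Prop :=
  ∀ y ∈ U, InjOn (fun x => V ψ x y) (closure D) ∧
    ContDiffOn ℝ 2 (fun x => V ψ x y) (closure D)

/-- The `W^{1,∞}` norms of the fluctuations are finite and summable. -/
def AssumptionA4 (D : Set X) (ψ : ℕ → X → X) : Prop :=
  (∀ i, w1InfNorm D (ψ i) < ⊤) ∧ ∑' i, w1InfNorm D (ψ i) < ⊤

/-- `b_i = 6^{-1/2} ‖ψ_i‖_{W^{1,∞}(D_ref)}`. -/
def b (D : Set X) (ψ : ℕ → X → X) (i : ℕ) : ℝ :=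
  (1 / √6) * (w1InfNorm D (ψ i)).toReal

/-- `ξ_b = ∑_i b_i`. -/
def ξ (D : Set X) (ψ : ℕ → X → X) : ℝ := ∑' i, b D ψ i

/-- `u ∈ H_0^1(D_ref)` solves the transported weak problem for the parameter `y`. -/
def IsTransportedSolution (D : Set X) (ψ : ℕ → X → X) (f : X → ℝ) (y : ℕ → ℝ)
    (u : H01 D) : Prop :=
  ∀ v : H01 D, ∫ x in D, ⟪A ψ x y (grad u x), grad v x⟫_ℝ = ∫ x in D, fRef ψ f x y * fn v x

/-- `β_j = (2+√2) max(1+√3, ρ) b_j`. -/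
def β (D : Set X) (ψ : ℕ → X → X) (ρ : ℝ) (j : ℕ) : ℝ :=
  (2 + √2) * max (1 + √3) ρ * b D ψ j

end Transport

section Euclidean

variable {d : ℕ}

/-- Uniform `C²` bounds for `V(·, y)` and its inverse. -/
def AssumptionA2 (D : Set (E d)) (ψ : ℕ → E d → E d) : Prop :=
  ∃ C : ℝ, 0 < C ∧ ∀ y ∈ U,
    ckNorm 2 (closure D) (fun x => V ψ x y) ≤ ENNReal.ofReal C ∧
    ContDiffOn ℝ 2 (Vinv D ψ y) (closure (domainAt D ψ y)) ∧
    ckNorm 2 (closure (domainAt D ψ y)) (Vinv D ψ y) ≤ ENNReal.ofReal C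

/-- `σmin` and `σmax` bound the singular values of `J(x,y)`. (`singularValues i` for `i < d` are
all the singular values, in decreasing order.) -/
def AssumptionA3 (D : Set (E d)) (ψ : ℕ → E d → E d) (σmin σmax : ℝ) : Prop :=
  0 < σmin ∧ σmin ≤ 1 ∧ 1 ≤ σmax ∧ ∀ x ∈ D, ∀ y ∈ U, ∀ i < d,
    σmin ≤ (J ψ x y : E d →ₗ[ℝ] E d).singularValues i ∧
      (J ψ x y : E d →ₗ[ℝ] E d).singularValues i ≤ σmax

/-- `C_init = (1+ξ)² / σmin^d · C_P |D_ref|^{1/2} C_f d! (2+ξ)^d`. -/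
def Cinit (D : Set (E d)) (ψ : ℕ → E d → E d) (σmin Cf : ℝ) : ℝ :=
  (1 + ξ D ψ) ^ 2 / σmin ^ d * poincareConst D * √(volume.real D) *
    Cf * d.factorial * (2 + ξ D ψ) ^ d

end Euclidean

section ParametricDerivatives

/-- `W ν = ∂_y^ν w` on `U` for all finitely supported multi-indices `ν`: `W 0 = w`, and
`W (ν + e_j)` is the derivative of `W ν` with respect to `y_j ∈ [0,1]` (one-sided at the endpoints)
in the norm of `Y`, in whatever order the derivatives are taken. This determines `W ν` on `U`. -/
def IsParametricDerivative {Y : Type*} [NormedAddCommGroup Y] [NormedSpace ℝ Y]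
    (w : (ℕ → ℝ) → Y) (W : (ℕ →₀ ℕ) → (ℕ → ℝ) → Y) : Prop :=
  (∀ y ∈ U, W 0 y = w y) ∧
  ∀ (ν : ℕ →₀ ℕ) (j : ℕ), ∀ y ∈ U,
    HasDerivWithinAt (fun t => W ν (Function.update y j t)) (W (ν + Finsupp.single j 1) y)
      (Icc 0 1) (y j)

/-- `∑_{0 ≠ m ≤ ν} (|m|+d-1)!/(d-1)! · m! β^m ∏_i S(ν_i, m_i)`. As `S(0,0) = 1`, the last product
runs over the support of `ν`. -/
def spodSum (d : ℕ) (β : ℕ → ℝ) (ν : ℕ →₀ ℕ) : ℝ :=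
  ∑ m ∈ Finset.Ioc 0 ν,
    ((m.degree + d - 1).factorial : ℝ) / ((d - 1).factorial : ℝ) *
      (∏ i ∈ m.support, ((m i).factorial : ℝ)) *
      (∏ i ∈ m.support, β i ^ m i) *
      ∏ i ∈ ν.support, (Nat.stirlingSecond (ν i) (m i) : ℝ)

end ParametricDerivatives

end DomainUQ

end

/-!
The parameters enter only through `s_i = sin (2π y_i) ∈ [-1, 1]`, and in these variables `V` and `J`
are affine. The proof estimates the derivatives with respect to `s` first and composes with the sine
at the end.

A function `w` of `s` is controlled by a majorant (`HasMajorant`): `‖∂^M w‖ ≤ a_k k! b^M` for every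
multiset `M` of `k` coordinates, where the number `a_k` depends on `k` only. This says that
`∑ a_k (∑_i b_i z_i)^k` majorizes the Taylor series of `w` at every point, so products correspond to
convolutions of the sequences `a` (`HasMajorant.bilin`), and the solution of a linear equation
`T(s) u(s) = F(s)` with `‖T(s)⁻¹‖ ≤ κ` has every majorant `c` with
`κ (f_k + ∑_{l ≥ 1} a_l c_{k-l}) ≤ c_k` (`HasMajorant.solve`). The latter rule gives `J⁻¹` as well as
the solution of the variational problem.

The coefficients are treated as elements of Banach spaces of bounded continuous functions on the
reference domain: `J` has the majorant `1 + ξ, 1, 0, 0, …`, then `J⁻¹`, `det J` (Leibniz formula) and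
`A = det J · J⁻¹ J⁻ᵀ` have geometric majorants. A partial derivative of `f ∘ V` in `s` is a
directional derivative of `f` at `V`, so that the bounds for the derivatives of `f` give a geometric
majorant of `f_ref`. The hypothesis on `f` in the first part is turned into such bounds by Cauchy's
estimates and compactness. Along the segment from the identity to `J` the determinant has no zero,
hence `det J ≥ σ^d`.

The variational problem is posed on the space of gradients of functions in `H_0^1`. By Poincaré's
inequality, which follows from the Gagliardo–Nirenberg–Sobolev inequality, this space is closed in
`L²`, and it carries exactly the norm of the theorem. The problem becomes `T(s) ∇u = F(s)` with
`⟪T(s) g, g⟫ ≥ σ^d / (1 + ξ)² ‖g‖²`; Lax–Milgram and the rule above yield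
`‖∂^M u‖ ≤ 2 C_init R^k k! b^M` for a suitable rate `R` (`hasMajorant_toGrad_solution`).

Finally `∂_y^ν` is expanded by Faà di Bruno's formula. As each derivative of a product of `m` sines
and cosines of `2πy_i` costs a factor `2π m`, the coefficients obey the recursion of the Stirling
numbers up to powers of `2π` (`abs_iteratedDeriv_sineCoeff_le`), and the resulting sum is compared
with the claimed one term by term (`sine_sum_le_spodSum`).
-/

noncomputable section

namespace DomainUQ

/-! ### Partial derivatives on the cube and their majorants -/

section Majorants

variable {Y Z G : Type*} [NormedAddCommGroup Y] [NormedSpace ℝ Y] [NormedAddCommGroup Z]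
  [NormedSpace ℝ Z] [NormedAddCommGroup G] [NormedSpace ℝ G]

/-- The cube `[-1,1]^ℕ` in which the variables `s_i = sin(2π y_i)` live. -/
def cube : Set (ℕ → ℝ) := {s | ∀ i, s i ∈ Icc (-1 : ℝ) 1}

lemma update_mem_cube {s : ℕ → ℝ} (hs : s ∈ cube) (j : ℕ) {t : ℝ} (ht : t ∈ Icc (-1 : ℝ) 1) :
    Function.update s j t ∈ cube := by
  intro i
  rcases eq_or_ne i j with rfl | h
  · simpa using ht
  · simpa [h] using hs i

/-- `W M = ∂_s^M (W 0)` on the cube for all multisets `M` of coordinates: `W (j ::ₘ M)` is the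
derivative of `W M` with respect to `s_j ∈ [-1,1]`. Multi-indices are multisets here because
`Multiset.antidiagonal` then turns the Leibniz rule into a recursion without binomials. -/
def IsPartialFamily (W : Multiset ℕ → (ℕ → ℝ) → Y) : Prop :=
  ∀ (M : Multiset ℕ) (j : ℕ), ∀ s ∈ cube,
    HasDerivWithinAt (fun t => W M (Function.update s j t)) (W (j ::ₘ M) s)
      (Icc (-1) 1) (s j)

/-- `w` has partial derivatives of all orders on the cube, and the power series
`∑ a_k (∑_i b_i z_i)^k` is a majorant of its Taylor series at every point:
`‖∂^M w‖ ≤ a_k k! b^M`, with `k` the order of `M`. -/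
def HasMajorant (b : ℕ → ℝ) (w : (ℕ → ℝ) → Y) (a : ℕ → ℝ) : Prop :=
  ∃ W : Multiset ℕ → (ℕ → ℝ) → Y, (∀ s ∈ cube, W 0 s = w s) ∧ IsPartialFamily W ∧
    ∀ M, ∀ s ∈ cube,
      ‖W M s‖ ≤ a (Multiset.card M) * ((Multiset.card M).factorial : ℝ) * (M.map b).prod

lemma prod_map_nonneg {b : ℕ → ℝ} (hb : ∀ i, 0 ≤ b i) (M : Multiset ℕ) :
    0 ≤ (M.map b).prod := by
  induction M using Multiset.induction_on with
  | empty => simp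
  | cons j M ih => simpa using mul_nonneg (hb j) ih

lemma HasMajorant.mono {b : ℕ → ℝ} (hb : ∀ i, 0 ≤ b i) {w : (ℕ → ℝ) → Y} {a a' : ℕ → ℝ}
    (h : HasMajorant b w a) (haa : ∀ k, a k ≤ a' k) : HasMajorant b w a' := by
  obtain ⟨W, h0, hW, hbd⟩ := h
  refine ⟨W, h0, hW, fun M s hs => (hbd M s hs).trans ?_⟩
  have := prod_map_nonneg hb M
  gcongr
  exact haa _

lemma HasMajorant.nonneg_zero {b : ℕ → ℝ} {w : (ℕ → ℝ) → Y} {a : ℕ → ℝ}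
    (h : HasMajorant b w a) : 0 ≤ a 0 := by
  obtain ⟨W, -, -, hbd⟩ := h
  have := (norm_nonneg _).trans (hbd 0 0 (fun i => by simp))
  simpa using this

lemma HasMajorant.clm {b : ℕ → ℝ} {w : (ℕ → ℝ) → Y} {a : ℕ → ℝ}
    (h : HasMajorant b w a) (L : Y →L[ℝ] Z) {c : ℝ} (hc : 0 ≤ c) (hL : ∀ v, ‖L v‖ ≤ c * ‖v‖) :
    HasMajorant b (fun s => L (w s)) (fun k => c * a k) := by
  obtain ⟨W, h0, hW, hbd⟩ := h
  refine ⟨fun M s => L (W M s), fun s hs => by simp [h0 s hs], fun M j s hs => ?_,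
    fun M s hs => ?_⟩
  · exact L.hasFDerivAt.comp_hasDerivWithinAt _ (hW M j s hs)
  · calc ‖L (W M s)‖ ≤ c * ‖W M s‖ := hL _
      _ ≤ c * _ := mul_le_mul_of_nonneg_left (hbd M s hs) hc
      _ = _ := by ring

lemma HasMajorant.zero {b : ℕ → ℝ} : HasMajorant b (fun _ => (0 : Y)) (fun _ => 0) :=
  ⟨fun _ _ => 0, fun _ _ => rfl, fun _ _ _ _ => hasDerivWithinAt_const _ _ _, fun M s _ => by simp⟩

lemma HasMajorant.add {b : ℕ → ℝ} {w₁ w₂ : (ℕ → ℝ) → Y} {a₁ a₂ : ℕ → ℝ}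
    (h₁ : HasMajorant b w₁ a₁) (h₂ : HasMajorant b w₂ a₂) :
    HasMajorant b (fun s => w₁ s + w₂ s) (fun k => a₁ k + a₂ k) := by
  obtain ⟨W, h0, hW, hbd⟩ := h₁
  obtain ⟨W', h0', hW', hbd'⟩ := h₂
  refine ⟨fun M s => W M s + W' M s, fun s hs => by simp [h0 s hs, h0' s hs],
    fun M j s hs => (hW M j s hs).add (hW' M j s hs), fun M s hs => ?_⟩
  calc ‖W M s + W' M s‖ ≤ ‖W M s‖ + ‖W' M s‖ := norm_add_le _ _
    _ ≤ _ := add_le_add (hbd M s hs) (hbd' M s hs)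
    _ = _ := by ring

lemma HasMajorant.sum {b : ℕ → ℝ} {ι : Type*} (S : Finset ι) {w : ι → (ℕ → ℝ) → Y}
    {a : ι → ℕ → ℝ} (h : ∀ i ∈ S, HasMajorant b (w i) (a i)) :
    HasMajorant b (fun s => ∑ i ∈ S, w i s) (fun k => ∑ i ∈ S, a i k) := by
  classical
  induction S using Finset.induction_on with
  | empty => simpa using HasMajorant.zero
  | insert i S hi ih =>
    simp only [Finset.sum_insert hi]
    exact (h i (by simp)).add (ih fun k hk => h k (by simp [hk]))

lemma hasDerivWithinAt_multiset_sum {ι : Type*} (m : Multiset ι) {f : ι → ℝ → Y} {f' : ι → Y}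
    {S : Set ℝ} {x : ℝ} (h : ∀ p ∈ m, HasDerivWithinAt (f p) (f' p) S x) :
    HasDerivWithinAt (fun t => (m.map (fun p => f p t)).sum) (m.map f').sum S x := by
  induction m using Multiset.induction_on with
  | empty => simpa using hasDerivWithinAt_const x S (0 : Y)
  | cons p m ih =>
    simp only [Multiset.map_cons, Multiset.sum_cons]
    exact (h p (by simp)).add (ih fun q hq => h q (by simp [hq]))

/-- Summing a quantity that depends only on the sizes over all splittings of a multiset counts
each size with a binomial coefficient. -/
lemma sum_antidiagonal_card (M : Multiset ℕ) (g : ℕ → ℕ → ℝ) :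
    (M.antidiagonal.map fun p => g (Multiset.card p.1) (Multiset.card p.2)).sum =
      ∑ q ∈ Finset.HasAntidiagonal.antidiagonal (Multiset.card M),
        ((Multiset.card M).choose q.1 : ℝ) * g q.1 q.2 := by
  induction M using Multiset.induction_on generalizing g with
  | empty => simp
  | cons j M ih =>
    rw [Multiset.antidiagonal_cons, Multiset.map_add, Multiset.sum_add, Multiset.map_map,
      Multiset.map_map, Multiset.card_cons, Finset.sum_antidiagonal_choose_succ_mul]
    congr 1
    · simpa using ih (fun i k => g i (k + 1))
    · have := ih (fun i k => g (i + 1) k)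
      simp only [Function.comp_def, Prod.map_fst, Prod.map_snd, Multiset.card_cons, id_eq]
      rw [this]
      refine Finset.sum_congr rfl fun q hq => ?_
      have hq' := Finset.HasAntidiagonal.mem_antidiagonal.1 hq
      rw [Nat.choose_symm_of_eq_add hq'.symm]

lemma multiset_norm_sum_le {ι H : Type*} [NormedAddCommGroup H] (m : Multiset ι) (f : ι → H)
    (g : ι → ℝ) (h : ∀ p ∈ m, ‖f p‖ ≤ g p) : ‖(m.map f).sum‖ ≤ (m.map g).sum := by
  induction m using Multiset.induction_on with
  | empty => simp
  | cons p m ih =>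
    simp only [Multiset.map_cons, Multiset.sum_cons]
    exact (norm_add_le _ _).trans
      (add_le_add (h p (by simp)) (ih fun q hq => h q (by simp [hq])))

/-- The bound behind both the product rule and the solution of a linear equation: the Taylor
majorant of a product is the Cauchy product of the majorants. -/
lemma norm_sum_antidiagonal_le {H : Type*} [NormedAddCommGroup H] {b : ℕ → ℝ} {a₁ a₂ : ℕ → ℝ}
    (M : Multiset ℕ) (f : Multiset ℕ × Multiset ℕ → H)
    (h : ∀ p ∈ M.antidiagonal, ‖f p‖ ≤
      (a₁ (Multiset.card p.1) * ((Multiset.card p.1).factorial : ℝ) * (p.1.map b).prod) *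
      (a₂ (Multiset.card p.2) * ((Multiset.card p.2).factorial : ℝ) * (p.2.map b).prod)) :
    ‖(M.antidiagonal.map f).sum‖ ≤
      (∑ q ∈ Finset.HasAntidiagonal.antidiagonal (Multiset.card M), a₁ q.1 * a₂ q.2) *
        ((Multiset.card M).factorial : ℝ) * (M.map b).prod := by
  set g : ℕ → ℕ → ℝ := fun i k => a₁ i * (i.factorial : ℝ) * (a₂ k * (k.factorial : ℝ)) *
    (M.map b).prod with hg
  have hle : ∀ p ∈ M.antidiagonal, ‖f p‖ ≤ g (Multiset.card p.1) (Multiset.card p.2) := by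
    intro p hp
    refine (h p hp).trans (le_of_eq ?_)
    rw [hg, ← Multiset.mem_antidiagonal.1 hp, Multiset.map_add, Multiset.prod_add]
    ring
  refine (multiset_norm_sum_le _ f _ hle).trans (le_of_eq ?_)
  rw [sum_antidiagonal_card M g, Finset.sum_mul, Finset.sum_mul]
  refine Finset.sum_congr rfl fun q hq => ?_
  have hq' := Finset.HasAntidiagonal.mem_antidiagonal.1 hq
  have := Nat.add_choose_mul_factorial_mul_factorial q.1 q.2
  rw [hq', ← Nat.choose_symm_of_eq_add hq'.symm] at this
  rw [← this, hg]
  push_cast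
  ring

lemma HasMajorant.bilin {b : ℕ → ℝ} {w₁ : (ℕ → ℝ) → Y} {w₂ : (ℕ → ℝ) → Z}
    {a₁ a₂ : ℕ → ℝ} (h₁ : HasMajorant b w₁ a₁) (h₂ : HasMajorant b w₂ a₂)
    (B : Y →L[ℝ] Z →L[ℝ] G) (hB : ∀ y z, ‖B y z‖ ≤ ‖y‖ * ‖z‖) :
    HasMajorant b (fun s => B (w₁ s) (w₂ s))
      (fun k => ∑ q ∈ Finset.HasAntidiagonal.antidiagonal k, a₁ q.1 * a₂ q.2) := by
  obtain ⟨W, h0, hW, hbd⟩ := h₁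
  obtain ⟨W', h0', hW', hbd'⟩ := h₂
  refine ⟨fun M s => (M.antidiagonal.map fun p => B (W p.1 s) (W' p.2 s)).sum,
    fun s hs => by simp [h0 s hs, h0' s hs], fun M j s hs => ?_, fun M s hs => ?_⟩
  · have key : ∀ p ∈ M.antidiagonal, HasDerivWithinAt
        (fun t => B (W p.1 (Function.update s j t)) (W' p.2 (Function.update s j t)))
        (B (W (j ::ₘ p.1) s) (W' p.2 s) + B (W p.1 s) (W' (j ::ₘ p.2) s)) (Icc (-1) 1) (s j) := by
      intro p _
      have := (B.hasFDerivAt.comp_hasDerivWithinAt _ (hW p.1 j s hs)).clm_apply (hW' p.2 j s hs)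
      simpa using this
    have := hasDerivWithinAt_multiset_sum _ key
    refine this.congr_deriv ?_
    simp only
    rw [Multiset.antidiagonal_cons, Multiset.map_add, Multiset.sum_add, Multiset.map_map,
      Multiset.map_map, Multiset.sum_map_add, add_comm]
    rfl
  · refine norm_sum_antidiagonal_le (a₁ := a₁) (a₂ := a₂) M _ fun p _ => ?_
    exact (hB _ _).trans (mul_le_mul (hbd p.1 s hs) (hbd' p.2 s hs) (norm_nonneg _)
      ((norm_nonneg _).trans (hbd p.1 s hs)))

/-- The rates of geometric majorants add up in a product. -/
lemma HasMajorant.bilin_geometric {b : ℕ → ℝ} (hb : ∀ i, 0 ≤ b i) {w₁ : (ℕ → ℝ) → Y}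
    {w₂ : (ℕ → ℝ) → Z} {C₁ C₂ r₁ r₂ : ℝ} (hr₁ : 0 ≤ r₁) (hr₂ : 0 ≤ r₂)
    (h₁ : HasMajorant b w₁ (fun k => C₁ * r₁ ^ k)) (h₂ : HasMajorant b w₂ (fun k => C₂ * r₂ ^ k))
    (B : Y →L[ℝ] Z →L[ℝ] G) (hB : ∀ y z, ‖B y z‖ ≤ ‖y‖ * ‖z‖) :
    HasMajorant b (fun s => B (w₁ s) (w₂ s)) (fun k => C₁ * C₂ * (r₁ + r₂) ^ k) := by
  have hC₁ : 0 ≤ C₁ := by simpa using h₁.nonneg_zero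
  have hC₂ : 0 ≤ C₂ := by simpa using h₂.nonneg_zero
  refine (h₁.bilin h₂ B hB).mono hb fun k => ?_
  rw [(Commute.all r₁ r₂).add_pow', Finset.mul_sum]
  refine Finset.sum_le_sum fun q hq => ?_
  have hq' := Finset.HasAntidiagonal.mem_antidiagonal.1 hq
  have h1 : (1 : ℝ) ≤ (k.choose q.1 : ℝ) := by
    exact_mod_cast Nat.choose_pos (by omega)
  have h2 : 0 ≤ C₁ * C₂ * (r₁ ^ q.1 * r₂ ^ q.2) := by positivity
  calc C₁ * r₁ ^ q.1 * (C₂ * r₂ ^ q.2) = C₁ * C₂ * (r₁ ^ q.1 * r₂ ^ q.2) * 1 := by ring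
    _ ≤ C₁ * C₂ * (r₁ ^ q.1 * r₂ ^ q.2) * (k.choose q.1 : ℝ) := mul_le_mul_of_nonneg_left h1 h2
    _ = _ := by rw [nsmul_eq_mul]; ring

/-- An affine function of `s`. -/
lemma hasMajorant_affine [CompleteSpace Y] {b : ℕ → ℝ} (hb : Summable b) (c : Y) (P : ℕ → Y)
    (hP : ∀ i, ‖P i‖ ≤ b i) :
    HasMajorant b (fun s => c + ∑' i, s i • P i)
      (fun k => if k = 0 then ‖c‖ + ∑' i, b i else if k = 1 then 1 else 0) := by
  have hle : ∀ s ∈ cube, ∀ i, ‖s i • P i‖ ≤ b i := by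
    intro s hs i
    rw [norm_smul]
    have : ‖s i‖ ≤ 1 := abs_le.2 (hs i)
    calc ‖s i‖ * ‖P i‖ ≤ 1 * ‖P i‖ := by gcongr
      _ ≤ b i := by simpa using hP i
  have hsum : ∀ s ∈ cube, Summable fun i => s i • P i := fun s hs =>
    Summable.of_norm_bounded hb (hle s hs)
  refine ⟨fun M s => if Multiset.card M = 0 then c + ∑' i, s i • P i else
    if Multiset.card M = 1 then (M.map P).sum else 0, fun s hs => by simp, fun M j s hs => ?_,
    fun M s hs => ?_⟩
  · rcases Nat.eq_zero_or_pos (Multiset.card M) with h | h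
    · obtain rfl := Multiset.card_eq_zero.1 h
      have hEq : ∀ t ∈ Icc (-1 : ℝ) 1, (c + ∑' i, (Function.update s j t) i • P i) =
          (c + ∑' i, s i • P i) + (t - s j) • P j := by
        intro t ht
        rw [add_assoc, add_right_inj,
          (hsum _ (update_mem_cube hs j ht)).tsum_eq_add_tsum_ite j,
          (hsum s hs).tsum_eq_add_tsum_ite j]
        have : ∀ i, (if i = j then 0 else (Function.update s j t) i • P i) =
            if i = j then 0 else s i • P i := by
          intro i; by_cases hi : i = j <;> simp [hi]
        simp only [this, Function.update_self, sub_smul]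
        abel
      have hd : HasDerivWithinAt (fun t : ℝ => (c + ∑' i, s i • P i) + (t - s j) • P j) (P j)
          (Icc (-1) 1) (s j) := by
        have h1 : HasDerivWithinAt (fun t : ℝ => t - s j) 1 (Icc (-1) 1) (s j) :=
          (hasDerivWithinAt_id _ _).sub_const _
        simpa using (h1.smul_const (P j)).const_add (c + ∑' i, s i • P i)
      simpa using hd.congr hEq (hEq _ (hs j))
    · have h1 : Multiset.card M ≠ 0 := h.ne'
      simp only [Multiset.card_cons, h1, if_false, Nat.add_eq_zero_iff, one_ne_zero, and_false,
        Nat.add_eq_right]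
      exact hasDerivWithinAt_const _ _ _
  · by_cases h : Multiset.card M = 0
    · obtain rfl := Multiset.card_eq_zero.1 h
      simp only [Multiset.card_zero, if_true, Nat.factorial_zero, Nat.cast_one, mul_one,
        Multiset.map_zero, Multiset.prod_zero]
      exact (norm_add_le _ _).trans (by gcongr; exact tsum_of_norm_bounded hb.hasSum (hle s hs))
    · by_cases h1 : Multiset.card M = 1
      · obtain ⟨j, rfl⟩ := Multiset.card_eq_one.1 h1
        simpa using hP j
      · simp [h, h1]

/-! ### Linear equations depending on parameters -/

lemma sum_antidiagonal_fst_zero {H : Type*} [AddCommMonoid H] (M : Multiset ℕ)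
    (g : Multiset ℕ × Multiset ℕ → H) :
    (M.antidiagonal.map fun p => if p.1 = 0 then g p else 0).sum = g (0, M) := by
  induction M using Multiset.induction_on generalizing g with
  | empty => simp
  | cons j M ih =>
    rw [Multiset.antidiagonal_cons, Multiset.map_add, Multiset.sum_add, Multiset.map_map,
      Multiset.map_map]
    have h1 := ih (fun p => g (p.1, j ::ₘ p.2))
    have h2 : (M.antidiagonal.map ((fun p => if p.1 = 0 then g p else 0) ∘
        Prod.map (Multiset.cons j) id)).sum = 0 := by
      simp
    rw [h2, add_zero]
    simpa [Function.comp_def, Prod.map] using h1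

lemma sum_antidiagonal_split {H : Type*} [AddCommMonoid H] (M : Multiset ℕ)
    (g : Multiset ℕ × Multiset ℕ → H) :
    (M.antidiagonal.map g).sum =
      g (0, M) + (M.antidiagonal.map fun p => if p.1 = 0 then 0 else g p).sum := by
  rw [← sum_antidiagonal_fst_zero M g, ← Multiset.sum_map_add]
  congr 1
  refine Multiset.map_congr rfl fun p _ => ?_
  by_cases h : p.1 = 0 <;> simp [h]

open scoped Classical in
/-- The derivatives of the solution `u` of `T u = F`, obtained by differentiating the equation:
`T ∂^M u = ∂^M F - ∑ ∂^N T ∂^{M-N} u`, summed over the nonempty submultisets `N` of `M`. -/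
def solveFamily (T : Multiset ℕ → (ℕ → ℝ) → (Y →L[ℝ] Y)) (F : Multiset ℕ → (ℕ → ℝ) → Y)
    (M : Multiset ℕ) (s : ℕ → ℝ) : Y :=
  Multiset.strongInductionOn M fun M ih =>
    Ring.inverse (T 0 s) (F M s -
      (M.antidiagonal.map fun p => if h : p.2 < M then T p.1 s (ih p.2 h) else 0).sum)

lemma solveFamily_eq (T : Multiset ℕ → (ℕ → ℝ) → (Y →L[ℝ] Y)) (F : Multiset ℕ → (ℕ → ℝ) → Y)
    (M : Multiset ℕ) (s : ℕ → ℝ) :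
    solveFamily T F M s = Ring.inverse (T 0 s) (F M s -
      (M.antidiagonal.map fun p =>
        if p.1 = 0 then 0 else T p.1 s (solveFamily T F p.2 s)).sum) := by
  rw [solveFamily, Multiset.strongInductionOn_eq]
  congr 3
  refine Multiset.map_congr rfl fun p hp => ?_
  have hp' := Multiset.mem_antidiagonal.1 hp
  by_cases h : p.1 = 0
  · have : ¬ p.2 < M := by rw [← hp', h, zero_add]; exact lt_irrefl _
    simp [h, this]
  · have : p.2 < M := by
      rw [← hp']
      exact lt_add_of_pos_left _ (pos_iff_ne_zero.2 h)
    simp only [this, dif_pos, h, if_false]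
    rfl

lemma solveFamily_isPartialFamily [CompleteSpace Y] {T : Multiset ℕ → (ℕ → ℝ) → (Y →L[ℝ] Y)}
    {F : Multiset ℕ → (ℕ → ℝ) → Y} (hT : IsPartialFamily T) (hF : IsPartialFamily F)
    (hu : ∀ s ∈ cube, IsUnit (T 0 s)) : IsPartialFamily (solveFamily T F) := by
  intro M
  induction hn : Multiset.card M using Nat.strong_induction_on generalizing M with
  | _ n IH =>
  intro j s hs
  set R := Ring.inverse (T 0 s) with hR
  -- the derivative of the right-hand side `F M - ∑ T N u (M - N)`
  have key : ∀ p ∈ M.antidiagonal, HasDerivWithinAt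
      (fun t => if p.1 = 0 then 0 else
        T p.1 (Function.update s j t) (solveFamily T F p.2 (Function.update s j t)))
      (if p.1 = 0 then 0 else
        T (j ::ₘ p.1) s (solveFamily T F p.2 s) + T p.1 s (solveFamily T F (j ::ₘ p.2) s))
      (Icc (-1) 1) (s j) := by
    intro p hp
    by_cases h : p.1 = 0
    · simpa [h] using hasDerivWithinAt_const _ _ _
    · simp only [h, if_false]
      have hc : Multiset.card p.2 < n := by
        have := congrArg Multiset.card (Multiset.mem_antidiagonal.1 hp)
        have h' := Multiset.card_pos.2 h
        simp only [Multiset.card_add] at this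
        omega
      have := (hT p.1 j s hs).clm_apply (IH _ hc p.2 rfl j s hs)
      simpa using this
  have hG := (hF M j s hs).fun_sub (hasDerivWithinAt_multiset_sum _ key)
  have hinv : HasDerivWithinAt (fun t => Ring.inverse (T 0 (Function.update s j t)))
      (-(R * T {j} s * R)) (Icc (-1) 1) (s j) := by
    obtain ⟨x, hx⟩ := hu s hs
    have h1 := hasFDerivAt_ringInverse (𝕜 := ℝ) x
    have hRx : (↑x⁻¹ : Y →L[ℝ] Y) = R := by rw [hR, ← hx, Ring.inverse_unit]
    rw [hx, hRx] at h1
    have h2 : HasFDerivAt (Ring.inverse : (Y →L[ℝ] Y) → (Y →L[ℝ] Y))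
        (-(ContinuousLinearMap.mulLeftRight ℝ (Y →L[ℝ] Y)) R R)
        (T 0 (Function.update s j (s j))) := by
      rw [Function.update_eq_self]; exact h1
    refine (h2.comp_hasDerivWithinAt (s j) (hT 0 j s hs)).congr_deriv ?_
    simp
  have hW := hinv.clm_apply hG
  simp only [Function.update_eq_self] at hW
  refine (hW.congr (fun t _ => solveFamily_eq T F M _) ?_).congr_deriv ?_
  · simp only [Function.update_eq_self]; exact solveFamily_eq T F M s
  · have e1 : R (F M s - (M.antidiagonal.map fun p => if p.1 = 0 then 0 else
        T p.1 s (solveFamily T F p.2 s)).sum) = solveFamily T F M s :=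
      (solveFamily_eq T F M s).symm
    rw [neg_apply, mul_apply_eq_comp, mul_apply_eq_comp,
      e1, solveFamily_eq T F (j ::ₘ M) s, ← map_neg, ← map_add]
    congr 1
    rw [Multiset.antidiagonal_cons, Multiset.map_add, Multiset.sum_add, Multiset.map_map,
      Multiset.map_map]
    have e2 : (M.antidiagonal.map ((fun p : Multiset ℕ × Multiset ℕ => if p.1 = 0 then 0 else
          T p.1 s (solveFamily T F p.2 s)) ∘ Prod.map (Multiset.cons j) id)).sum =
        T {j} s (solveFamily T F M s) + (M.antidiagonal.map fun p => if p.1 = 0 then 0 else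
          T (j ::ₘ p.1) s (solveFamily T F p.2 s)).sum := by
      have := sum_antidiagonal_split M fun p => T (j ::ₘ p.1) s (solveFamily T F p.2 s)
      simpa [Function.comp_def] using this
    have e3 : (M.antidiagonal.map fun p : Multiset ℕ × Multiset ℕ => if p.1 = 0 then (0 : Y) else
          T (j ::ₘ p.1) s (solveFamily T F p.2 s) + T p.1 s (solveFamily T F (j ::ₘ p.2) s)).sum =
        (M.antidiagonal.map fun p => if p.1 = 0 then 0 else
          T (j ::ₘ p.1) s (solveFamily T F p.2 s)).sum +
        (M.antidiagonal.map fun p => if p.1 = 0 then 0 else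
          T p.1 s (solveFamily T F (j ::ₘ p.2) s)).sum := by
      rw [← Multiset.sum_map_add]
      congr 1
      refine Multiset.map_congr rfl fun p _ => ?_
      by_cases h : p.1 = 0 <;> simp [h]
    rw [e2, e3]
    simp only [Function.comp_def, Prod.map_fst, Prod.map_snd, id_eq]
    abel

/-- If `T u = F` on the cube with `T⁻¹` bounded by `κ`, then every sequence `c` that dominates
the recursion obtained by differentiating the equation is a majorant for `u`. -/
lemma HasMajorant.solve [CompleteSpace Y] {b : ℕ → ℝ} (hb : ∀ i, 0 ≤ b i)
    {T : (ℕ → ℝ) → (Y →L[ℝ] Y)} {F u : (ℕ → ℝ) → Y} {a f c : ℕ → ℝ} {κ : ℝ} (hκ : 0 ≤ κ)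
    (hT : HasMajorant b T a) (hF : HasMajorant b F f)
    (hinv : ∀ s ∈ cube, IsUnit (T s) ∧ ‖Ring.inverse (T s)‖ ≤ κ)
    (hTu : ∀ s ∈ cube, T s (u s) = F s)
    (hc : ∀ k, κ * (f k + ∑ q ∈ Finset.HasAntidiagonal.antidiagonal k,
      (if q.1 = 0 then 0 else a q.1) * c q.2) ≤ c k) :
    HasMajorant b u c := by
  obtain ⟨T', hT0, hT', hTb⟩ := hT
  obtain ⟨F', hF0, hF', hFb⟩ := hF
  have hu : ∀ s ∈ cube, IsUnit (T' 0 s) := fun s hs => by rw [hT0 s hs]; exact (hinv s hs).1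
  refine ⟨solveFamily T' F', fun s hs => ?_, solveFamily_isPartialFamily hT' hF' hu,
    fun M => ?_⟩
  · rw [solveFamily_eq]
    simp only [Multiset.antidiagonal_zero, Multiset.map_singleton, if_true, Multiset.sum_singleton,
      sub_zero, hT0 s hs, hF0 s hs, ← hTu s hs]
    rw [← mul_apply_eq_comp, Ring.inverse_mul_cancel _ (hinv s hs).1]
    rfl
  · induction hn : Multiset.card M using Nat.strong_induction_on generalizing M with
    | _ n IH =>
    intro s hs
    have hsum : ‖(M.antidiagonal.map fun p => if p.1 = 0 then 0 else
        T' p.1 s (solveFamily T' F' p.2 s)).sum‖ ≤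
        (∑ q ∈ Finset.HasAntidiagonal.antidiagonal (Multiset.card M),
          (if q.1 = 0 then 0 else a q.1) * c q.2) *
        ((Multiset.card M).factorial : ℝ) * (M.map b).prod := by
      refine norm_sum_antidiagonal_le (a₁ := fun k => if k = 0 then 0 else a k) (a₂ := c) M _
        fun p hp => ?_
      by_cases h : p.1 = 0
      · simp [h]
      · have hc' := Multiset.card_pos.2 h
        have hcard : Multiset.card p.2 < n := by
          have := congrArg Multiset.card (Multiset.mem_antidiagonal.1 hp)
          simp only [Multiset.card_add] at this
          omega
        simp only [h, if_false, hc'.ne']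
        refine (ContinuousLinearMap.le_opNorm _ _).trans ?_
        exact mul_le_mul (hTb p.1 s hs) (IH _ hcard p.2 rfl s hs) (norm_nonneg _)
          ((norm_nonneg _).trans (hTb p.1 s hs))
    rw [solveFamily_eq]
    refine (ContinuousLinearMap.le_opNorm _ _).trans ?_
    have h1 : ‖Ring.inverse (T' 0 s)‖ ≤ κ := by rw [hT0 s hs]; exact (hinv s hs).2
    have h2 := (norm_sub_le _ _).trans (add_le_add (hFb M s hs) hsum)
    refine (mul_le_mul h1 h2 (norm_nonneg _) hκ).trans ?_
    have h3 := mul_le_mul_of_nonneg_right (hc (Multiset.card M))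
      (mul_nonneg (Nat.cast_nonneg (Multiset.card M).factorial) (prod_map_nonneg hb M))
    rw [← hn]
    refine le_trans (le_of_eq ?_) (h3.trans (le_of_eq ?_)) <;> ring

/-! ### Differentiation in the supremum norm -/

/-- Taylor's formula of first order on an interval, with a bound for the second derivative. -/
lemma norm_taylor_le {g g' g'' : ℝ → Y} {C : ℝ}
    (h1 : ∀ t ∈ Icc (-1 : ℝ) 1, HasDerivWithinAt g (g' t) (Icc (-1) 1) t)
    (h2 : ∀ t ∈ Icc (-1 : ℝ) 1, HasDerivWithinAt g' (g'' t) (Icc (-1) 1) t)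
    (hC : ∀ t ∈ Icc (-1 : ℝ) 1, ‖g'' t‖ ≤ C) {t t₀ : ℝ} (ht : t ∈ Icc (-1 : ℝ) 1)
    (ht₀ : t₀ ∈ Icc (-1 : ℝ) 1) :
    ‖g t - g t₀ - (t - t₀) • g' t₀‖ ≤ C * |t - t₀| * |t - t₀| := by
  have hC0 : 0 ≤ C := (norm_nonneg _).trans (hC t ht)
  have hsub : uIcc t₀ t ⊆ Icc (-1) 1 := uIcc_subset_Icc ht₀ ht
  have hlip : ∀ τ ∈ uIcc t₀ t, ‖g' τ - g' t₀‖ ≤ C * |t - t₀| := by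
    intro τ hτ
    have := Convex.norm_image_sub_le_of_norm_hasDerivWithin_le h2 hC (convex_Icc _ _) ht₀
      (hsub hτ)
    refine this.trans ?_
    gcongr
    rw [Real.norm_eq_abs]
    exact abs_sub_left_of_mem_uIcc hτ
  have hd : ∀ τ ∈ uIcc t₀ t, HasDerivWithinAt (fun τ => g τ - τ • g' t₀) (g' τ - g' t₀)
      (uIcc t₀ t) τ := by
    intro τ hτ
    have := ((h1 τ (hsub hτ)).mono hsub).fun_sub
      ((hasDerivWithinAt_id τ (uIcc t₀ t)).smul_const (g' t₀))
    simpa using this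
  have := Convex.norm_image_sub_le_of_norm_hasDerivWithin_le hd hlip (convex_uIcc _ _)
    left_mem_uIcc right_mem_uIcc
  rw [Real.norm_eq_abs] at this
  convert this using 2
  rw [sub_smul]
  abel

/-- Pointwise partial derivatives with bounds that are uniform in `x` are partial derivatives in
the supremum norm. -/
lemma hasMajorant_of_pointwise {α : Type*} [TopologicalSpace α] {b : ℕ → ℝ} (hb : ∀ i, 0 ≤ b i)
    {a : ℕ → ℝ} (ha : ∀ k, 0 ≤ a k) (w : (ℕ → ℝ) → BoundedContinuousFunction α Y)
    (W : Multiset ℕ → (ℕ → ℝ) → α → Y) (h0 : ∀ s ∈ cube, ∀ x, W 0 s x = w s x)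
    (hc : ∀ M, ∀ s ∈ cube, Continuous (W M s))
    (hW : ∀ x, IsPartialFamily fun M s => W M s x)
    (hbd : ∀ M, ∀ s ∈ cube, ∀ x, ‖W M s x‖ ≤
      a (Multiset.card M) * ((Multiset.card M).factorial : ℝ) * (M.map b).prod) :
    HasMajorant b w a := by
  classical
  have hnn : ∀ M : Multiset ℕ,
      0 ≤ a (Multiset.card M) * ((Multiset.card M).factorial : ℝ) * (M.map b).prod := fun M =>
    mul_nonneg (mul_nonneg (ha _) (Nat.cast_nonneg _)) (prod_map_nonneg hb M)
  let W' : Multiset ℕ → (ℕ → ℝ) → BoundedContinuousFunction α Y := fun M s =>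
    if hs : s ∈ cube then
      BoundedContinuousFunction.ofNormedAddCommGroup (W M s) (hc M s hs) _ (hbd M s hs) else 0
  have hW' : ∀ M, ∀ s ∈ cube, ∀ x, W' M s x = W M s x := by
    intro M s hs x
    simp only [W', hs, dif_pos]
    rfl
  refine ⟨W', fun s hs => ?_, fun M j s hs => ?_, fun M s hs => ?_⟩
  · ext x
    rw [hW' 0 s hs, h0 s hs]
  · set C := a (Multiset.card (j ::ₘ j ::ₘ M)) *
      ((Multiset.card (j ::ₘ j ::ₘ M)).factorial : ℝ) * ((j ::ₘ j ::ₘ M).map b).prod with hC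
    have hC0 : 0 ≤ C := hnn _
    have key : ∀ t ∈ Icc (-1 : ℝ) 1, ‖W' M (Function.update s j t) - W' M s -
        (t - s j) • W' (j ::ₘ M) s‖ ≤ C * |t - s j| * |t - s j| := by
      intro t ht
      refine (BoundedContinuousFunction.norm_le (by positivity)).2 fun x => ?_
      simp only [BoundedContinuousFunction.coe_sub, BoundedContinuousFunction.coe_smul,
        Pi.sub_apply]
      rw [hW' _ _ (update_mem_cube hs j ht), hW' _ _ hs, hW' _ _ hs]
      have hder : ∀ N, ∀ t ∈ Icc (-1 : ℝ) 1, HasDerivWithinAt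
          (fun t => W N (Function.update s j t) x) (W (j ::ₘ N) (Function.update s j t) x)
          (Icc (-1) 1) t := by
        intro N t ht
        have := hW x N j (Function.update s j t) (update_mem_cube hs j ht)
        simpa using this
      have := norm_taylor_le (hder M) (hder (j ::ₘ M))
        (fun t ht => hbd _ _ (update_mem_cube hs j ht) x) ht (hs j)
      simpa only [Function.update_eq_self] using this
    rw [hasDerivWithinAt_iff_isLittleO, Asymptotics.isLittleO_iff]
    intro ε hε
    have hev : ∀ᶠ t in 𝓝[Icc (-1 : ℝ) 1] (s j), C * |t - s j| ≤ ε := by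
      have : Tendsto (fun t => C * |t - s j|) (𝓝[Icc (-1 : ℝ) 1] (s j)) (𝓝 0) := by
        have hcont : Continuous fun t => C * |t - s j| := by fun_prop
        have := hcont.tendsto (s j)
        simp only [sub_self, abs_zero, mul_zero] at this
        exact this.mono_left nhdsWithin_le_nhds
      exact (this.eventually (gt_mem_nhds hε)).mono fun t ht => le_of_lt ht
    filter_upwards [hev, self_mem_nhdsWithin] with t ht htm
    rw [Function.update_eq_self]
    refine (key t htm).trans ?_
    rw [Real.norm_eq_abs]
    gcongr
  · refine (BoundedContinuousFunction.norm_le (hnn M)).2 fun x => ?_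
    rw [hW' M s hs]
    exact hbd M s hs x

end Majorants

/-! ### The transport field on the reference domain -/

section Transport

variable {X : Type*} [NormedAddCommGroup X] [InnerProductSpace ℝ X] {D : Set X} {ψ : ℕ → X → X}

/-- A parameter in `U` with prescribed values `sin(2π y_i) = s_i`. -/
def toU (s : ℕ → ℝ) (i : ℕ) : ℝ := (Real.pi - Real.arcsin (s i)) / (2 * Real.pi)

lemma toU_mem (s : ℕ → ℝ) : toU s ∈ U := by
  intro i
  have h1 := Real.arcsin_le_pi_div_two (s i)
  have h2 := Real.neg_pi_div_two_le_arcsin (s i)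
  have hpi := Real.pi_pos
  refine ⟨?_, ?_⟩
  · unfold toU; apply div_nonneg <;> linarith
  · unfold toU; rw [div_le_one (by positivity)]; linarith

lemma sin_toU {s : ℕ → ℝ} (hs : s ∈ cube) (i : ℕ) : Real.sin (2 * Real.pi * toU s i) = s i := by
  have : 2 * Real.pi * toU s i = Real.pi - Real.arcsin (s i) := by
    unfold toU; field_simp
  rw [this, Real.sin_pi_sub, Real.sin_arcsin (hs i).1 (hs i).2]

/-- The point of the cube belonging to the parameter `y`. -/
def toCube (y : ℕ → ℝ) (i : ℕ) : ℝ := Real.sin (2 * Real.pi * y i)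

lemma toCube_mem (y : ℕ → ℝ) : toCube y ∈ cube := fun _ =>
  ⟨Real.neg_one_le_sin _, Real.sin_le_one _⟩

lemma toCube_toU {s : ℕ → ℝ} (hs : s ∈ cube) : toCube (toU s) = s := funext (sin_toU hs)

lemma V_congr {y y' : ℕ → ℝ} (h : toCube y = toCube y') (x : X) : V ψ x y = V ψ x y' := by
  have : ∀ i, Real.sin (2 * Real.pi * y i) = Real.sin (2 * Real.pi * y' i) := congrFun h
  simp only [V, this]

lemma J_congr {y y' : ℕ → ℝ} (h : toCube y = toCube y') (x : X) : J ψ x y = J ψ x y' := by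
  have : ∀ i, Real.sin (2 * Real.pi * y i) = Real.sin (2 * Real.pi * y' i) := congrFun h
  simp only [J, this]

/-- Each fluctuation is a combination of the identity and of the field `V(·, y)` for the parameter
`y = e_i / 4`, hence of class `C²`. -/
lemma psi_contDiffOn (hA1 : AssumptionA1 D ψ) (i : ℕ) : ContDiffOn ℝ 2 (ψ i) (closure D) := by
  classical
  set y : ℕ → ℝ := fun k => if k = i then 1 / 4 else 0 with hy
  have hyU : y ∈ U := by
    intro k
    by_cases h : k = i <;> simp [hy, h]; norm_num
  have hsin : ∀ x, ∑' k, Real.sin (2 * Real.pi * y k) • ψ k x = ψ i x := by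
    intro x
    rw [tsum_eq_single i]
    · have : 2 * Real.pi * y i = Real.pi / 2 := by simp [hy]; ring
      rw [this, Real.sin_pi_div_two, one_smul]
    · intro k hk
      simp [hy, hk]
  have hV : ∀ x, ψ i x = √6 • (V ψ x y - x) := by
    intro x
    have h6 : √6 * (1 / √6) = 1 := by
      have : √6 ≠ 0 := by positivity
      field_simp
    rw [V, hsin, add_sub_cancel_left, smul_smul, h6, one_smul]
  have := (((hA1 y hyU).2.sub contDiffOn_id).const_smul (√6))
  exact this.congr fun x _ => hV x

lemma V_eq (x : X) (y : ℕ → ℝ) : V ψ x y = x + ∑' i, toCube y i • ((1 / √6) • ψ i x) := by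
  rw [V, ← tsum_const_smul'']
  simp only [smul_comm (1 / √6) _ _, toCube]

lemma J_eq (x : X) (y : ℕ → ℝ) :
    J ψ x y = ContinuousLinearMap.id ℝ X + ∑' i, toCube y i • ((1 / √6) • fderiv ℝ (ψ i) x) := by
  rw [J, ← tsum_const_smul'']
  simp only [smul_comm (1 / √6) _ _, toCube]

lemma norm_cube_smul_le {F : Type*} [NormedAddCommGroup F] [NormedSpace ℝ F] {s : ℕ → ℝ}
    (hs : s ∈ cube) {i : ℕ} {v : F} {c : ℝ} (hv : ‖v‖ ≤ c) : ‖s i • v‖ ≤ c := by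
  rw [norm_smul]
  have : ‖s i‖ ≤ 1 := abs_le.2 (hs i)
  calc ‖s i‖ * ‖v‖ ≤ 1 * ‖v‖ := by gcongr
    _ ≤ c := by simpa using hv

lemma V_mem_holdAll {x : X} (hx : x ∈ D) {y : ℕ → ℝ} (hy : y ∈ U) : V ψ x y ∈ holdAll D ψ := by
  simp only [holdAll, mem_iUnion]
  exact ⟨y, hy, x, hx, rfl⟩

lemma psi_contDiffAt (hO : IsOpen D) (hA1 : AssumptionA1 D ψ) (i : ℕ) {x : X} (hx : x ∈ D) :
    ContDiffAt ℝ 2 (ψ i) x :=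
  ((psi_contDiffOn hA1 i).mono subset_closure).contDiffAt (hO.mem_nhds hx)

lemma psi_continuousOn (hA1 : AssumptionA1 D ψ) (i : ℕ) : ContinuousOn (ψ i) D :=
  (psi_contDiffOn hA1 i).continuousOn.mono subset_closure

lemma fderiv_psi_continuousOn (hO : IsOpen D) (hA1 : AssumptionA1 D ψ) (i : ℕ) :
    ContinuousOn (fderiv ℝ (ψ i)) D :=
  ((psi_contDiffOn hA1 i).mono subset_closure).continuousOn_fderiv_of_isOpen hO (by norm_num)

variable [FiniteDimensional ℝ X] [MeasurableSpace X] [BorelSpace X]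

/-- On an open set a continuous function is bounded pointwise by its essential supremum. -/
lemma norm_le_toReal_eLpNorm_top {F : Type*} [NormedAddCommGroup F] (hO : IsOpen D) {g : X → F}
    (hg : ContinuousOn g D) (hfin : eLpNorm g ∞ (volume.restrict D) < ⊤) {x : X} (hx : x ∈ D) :
    ‖g x‖ ≤ (eLpNorm g ∞ (volume.restrict D)).toReal := by
  by_contra! hlt
  set c := (eLpNorm g ∞ (volume.restrict D)).toReal
  have hopen : IsOpen (D ∩ (fun y => ‖g y‖) ⁻¹' Ioi c) :=
    hg.norm.isOpen_inter_preimage hO isOpen_Ioi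
  have hpos : 0 < volume (D ∩ (fun y => ‖g y‖) ⁻¹' Ioi c) := hopen.measure_pos _ ⟨x, hx, hlt⟩
  have hae : ∀ᵐ y ∂(volume.restrict D), ‖g y‖ ≤ c := by
    have := ae_le_eLpNormEssSup (f := g) (μ := volume.restrict D)
    filter_upwards [this] with y hy
    rw [← eLpNorm_exponent_top] at hy
    rw [← toReal_enorm]
    exact ENNReal.toReal_mono hfin.ne hy
  rw [ae_restrict_iff' hO.measurableSet, ae_iff] at hae
  have heq : {y | ¬(y ∈ D → ‖g y‖ ≤ c)} = D ∩ (fun y => ‖g y‖) ⁻¹' Ioi c := by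
    ext y; simp [not_le]
  rw [heq] at hae
  exact hpos.ne' hae

lemma b_nonneg (i : ℕ) : 0 ≤ b D ψ i := by unfold b; positivity

lemma xi_nonneg : 0 ≤ ξ D ψ := tsum_nonneg b_nonneg

lemma summable_b (hA4 : AssumptionA4 D ψ) : Summable (b D ψ) :=
  (ENNReal.summable_toReal hA4.2.ne).mul_left _

lemma norm_psi_le (hO : IsOpen D) (hA1 : AssumptionA1 D ψ) (hA4 : AssumptionA4 D ψ) (i : ℕ) {x : X}
    (hx : x ∈ D) : ‖(1 / √6) • ψ i x‖ ≤ b D ψ i := by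
  have hfin := hA4.1 i
  have h1 : eLpNorm (ψ i) ∞ (volume.restrict D) ≤ w1InfNorm D (ψ i) := le_max_left _ _
  have := norm_le_toReal_eLpNorm_top hO (psi_continuousOn hA1 i) (h1.trans_lt hfin) hx
  rw [norm_smul, Real.norm_of_nonneg (by positivity), b]
  gcongr
  exact this.trans (ENNReal.toReal_mono hfin.ne h1)

lemma norm_fderiv_psi_le (hO : IsOpen D) (hA1 : AssumptionA1 D ψ) (hA4 : AssumptionA4 D ψ) (i : ℕ)
    {x : X} (hx : x ∈ D) : ‖(1 / √6) • fderiv ℝ (ψ i) x‖ ≤ b D ψ i := by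
  have hfin := hA4.1 i
  have h1 : eLpNorm (fderiv ℝ (ψ i)) ∞ (volume.restrict D) ≤ w1InfNorm D (ψ i) := le_max_right _ _
  have := norm_le_toReal_eLpNorm_top hO (fderiv_psi_continuousOn hO hA1 i) (h1.trans_lt hfin) hx
  rw [norm_smul, Real.norm_of_nonneg (by positivity), b]
  gcongr
  exact this.trans (ENNReal.toReal_mono hfin.ne h1)

lemma summable_smul_psi (hO : IsOpen D) (hA1 : AssumptionA1 D ψ) (hA4 : AssumptionA4 D ψ)
    {s : ℕ → ℝ} (hs : s ∈ cube) {x : X} (hx : x ∈ D) :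
    Summable fun i => s i • ((1 / √6) • ψ i x) :=
  Summable.of_norm_bounded (summable_b hA4) fun i =>
    norm_cube_smul_le hs (norm_psi_le hO hA1 hA4 i hx)

lemma norm_V_sub_le (hO : IsOpen D) (hA1 : AssumptionA1 D ψ) (hA4 : AssumptionA4 D ψ)
    {x : X} (hx : x ∈ D) (y : ℕ → ℝ) : ‖V ψ x y - x‖ ≤ ξ D ψ := by
  rw [V_eq, add_sub_cancel_left]
  exact tsum_of_norm_bounded (summable_b hA4).hasSum fun i =>
    norm_cube_smul_le (toCube_mem y) (norm_psi_le hO hA1 hA4 i hx)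

lemma norm_J_le (hO : IsOpen D) (hA1 : AssumptionA1 D ψ) (hA4 : AssumptionA4 D ψ)
    {x : X} (hx : x ∈ D) (y : ℕ → ℝ) : ‖J ψ x y‖ ≤ 1 + ξ D ψ := by
  rw [J_eq]
  refine (norm_add_le _ _).trans (add_le_add ContinuousLinearMap.norm_id_le ?_)
  exact tsum_of_norm_bounded (summable_b hA4).hasSum fun i =>
    norm_cube_smul_le (toCube_mem y) (norm_fderiv_psi_le hO hA1 hA4 i hx)

lemma hasFDerivAt_V (hO : IsOpen D) (hconn : IsPreconnected D) (hA1 : AssumptionA1 D ψ)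
    (hA4 : AssumptionA4 D ψ) {x : X} (hx : x ∈ D) (y : ℕ → ℝ) :
    HasFDerivAt (fun x => V ψ x y) (J ψ x y) x := by
  have hs := toCube_mem y
  have h := hasFDerivAt_tsum_of_isPreconnected (𝕜 := ℝ) (u := b D ψ)
    (f := fun i x => toCube y i • ((1 / √6) • ψ i x))
    (f' := fun i x => toCube y i • ((1 / √6) • fderiv ℝ (ψ i) x)) (summable_b hA4) hO hconn
    (fun i z hz => (((psi_contDiffAt hO hA1 i hz).differentiableAt
      (by norm_num)).hasFDerivAt.const_smul (1 / √6)).const_smul (toCube y i))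
    (fun i z hz => norm_cube_smul_le hs (norm_fderiv_psi_le hO hA1 hA4 i hz)) hx
    (summable_smul_psi hO hA1 hA4 hs hx) hx
  have h2 := (hasFDerivAt_id (𝕜 := ℝ) x).fun_add h
  rw [J_eq]
  refine h2.congr_of_eventuallyEq (Eventually.of_forall fun z => ?_)
  simp [V_eq]

lemma isOpen_holdAll (hO : IsOpen D) (hconn : IsPreconnected D) (hA1 : AssumptionA1 D ψ)
    (hA4 : AssumptionA4 D ψ) (hdet : ∀ x ∈ D, ∀ y ∈ U, (J ψ x y).det ≠ 0) :
    IsOpen (holdAll D ψ) := by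
  refine isOpen_iUnion fun y => isOpen_iUnion fun hy => ?_
  rw [isOpen_iff_mem_nhds]
  rintro _ ⟨x, hx, rfl⟩
  have hC2 : ContDiffAt ℝ 2 (fun x => V ψ x y) x :=
    ((hA1 y hy).2.mono subset_closure).contDiffAt (hO.mem_nhds hx)
  have hstrict : HasStrictFDerivAt (fun x => V ψ x y) (J ψ x y) x :=
    hC2.hasStrictFDerivAt' (hasFDerivAt_V hO hconn hA1 hA4 hx y) (by norm_num)
  have h2 : HasStrictFDerivAt (fun x => V ψ x y)
      (((J ψ x y).toContinuousLinearEquivOfDetNeZero (hdet x hx y hy) : X ≃L[ℝ] X) : X →L[ℝ] X)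
      x := by
    simpa using hstrict
  have := h2.map_nhds_eq_of_equiv
  rw [domainAt, ← this]
  exact image_mem_map (hO.mem_nhds hx)

lemma isBounded_holdAll (hO : IsOpen D) (hbd : Bornology.IsBounded D) (hA1 : AssumptionA1 D ψ)
    (hA4 : AssumptionA4 D ψ) : Bornology.IsBounded (holdAll D ψ) := by
  obtain ⟨R, hR⟩ := hbd.exists_norm_le
  refine isBounded_iff_forall_norm_le.2 ⟨ξ D ψ + R, fun z hz => ?_⟩
  obtain ⟨y, hy, x, hx, rfl⟩ : ∃ y ∈ U, ∃ x ∈ D, V ψ x y = z := by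
    simpa [holdAll, domainAt] using hz
  calc ‖V ψ x y‖ = ‖(V ψ x y - x) + x‖ := by rw [sub_add_cancel]
    _ ≤ _ := (norm_add_le _ _).trans (add_le_add (norm_V_sub_le hO hA1 hA4 hx y) (hR x hx))

end Transport

/-! ### Singular values and the Jacobian determinant -/

section SingularValues

/-- The smallest singular value bounds a linear map from below. -/
lemma mul_norm_le_of_le_singularValues {X : Type*} [NormedAddCommGroup X] [InnerProductSpace ℝ X]
    [FiniteDimensional ℝ X] (T : X →ₗ[ℝ] X) {σ : ℝ} (hσ : 0 ≤ σ)
    (h : ∀ i < Module.finrank ℝ X, σ ≤ T.singularValues i) (v : X) : σ * ‖v‖ ≤ ‖T v‖ := by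
  set hT := T.isSymmetric_adjoint_comp_self
  set e := hT.eigenvectorBasis rfl
  have h1 : ‖T v‖ ^ 2 = ∑ i, hT.eigenvalues rfl i * ⟪e i, v⟫_ℝ ^ 2 := by
    have : ‖T v‖ ^ 2 = ⟪v, (LinearMap.adjoint T ∘ₗ T) v⟫_ℝ := by
      rw [LinearMap.comp_apply, LinearMap.adjoint_inner_right, real_inner_self_eq_norm_sq]
    rw [this, ← e.sum_inner_mul_inner]
    refine Finset.sum_congr rfl fun i _ => ?_
    have h2 : ⟪e i, (LinearMap.adjoint T ∘ₗ T) v⟫_ℝ = hT.eigenvalues rfl i * ⟪e i, v⟫_ℝ := by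
      rw [← hT, hT.apply_eigenvectorBasis, real_inner_smul_left]
      rfl
    rw [h2, real_inner_comm]
    ring
  have h3 : ‖v‖ ^ 2 = ∑ i, ⟪e i, v⟫_ℝ ^ 2 := by
    rw [← real_inner_self_eq_norm_sq, ← e.sum_inner_mul_inner]
    exact Finset.sum_congr rfl fun i _ => by rw [real_inner_comm]; ring
  refine le_of_sq_le_sq ?_ (norm_nonneg _)
  rw [mul_pow, h1, h3, Finset.mul_sum]
  refine Finset.sum_le_sum fun i _ => ?_
  gcongr
  rw [← T.sq_singularValues_fin rfl i]
  gcongr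
  exact h i i.2

variable {d : ℕ} {D : Set (E d)} {ψ : ℕ → E d → E d} {σmin σmax : ℝ}

lemma mul_norm_le_norm_J (hA3 : AssumptionA3 D ψ σmin σmax) {x : E d} (hx : x ∈ D) {y : ℕ → ℝ}
    (hy : y ∈ U) (v : E d) : σmin * ‖v‖ ≤ ‖J ψ x y v‖ :=
  mul_norm_le_of_le_singularValues (J ψ x y : E d →ₗ[ℝ] E d) hA3.1.le
    (fun i hi => (hA3.2.2.2 x hx y hy i (by simpa using hi)).1) v

lemma pow_le_abs_det_J (hA3 : AssumptionA3 D ψ σmin σmax) {x : E d} (hx : x ∈ D) {y : ℕ → ℝ}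
    (hy : y ∈ U) : σmin ^ d ≤ |(J ψ x y).det| := by
  rw [ContinuousLinearMap.det, ← LinearMap.normDet_eq_abs_det,
    LinearMap.normDet_eq_prod_singularValues, finrank_euclideanSpace_fin]
  calc σmin ^ d = ∏ i ∈ Finset.range d, σmin := by simp
    _ ≤ _ := Finset.prod_le_prod (fun _ _ => hA3.1.le) fun i hi =>
      (hA3.2.2.2 x hx y hy i (Finset.mem_range.1 hi)).1

/-- The determinant of `J` does not vanish and equals `1` at the centre of the cube, so it is
positive. -/
lemma pow_le_det_J (hA3 : AssumptionA3 D ψ σmin σmax) {x : E d} (hx : x ∈ D) {y : ℕ → ℝ}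
    (hy : y ∈ U) : σmin ^ d ≤ (J ψ x y).det := by
  have hpos : 0 < σmin ^ d := pow_pos hA3.1 d
  suffices h : 0 ≤ (J ψ x y).det by
    simpa [abs_of_nonneg h] using pow_le_abs_det_J hA3 hx hy
  by_contra! hneg
  set Q : E d →L[ℝ] E d := ∑' i, toCube y i • ((1 / √6) • fderiv ℝ (ψ i) x) with hQ
  have hJ : ∀ t ∈ Icc (0 : ℝ) 1, J ψ x (toU (t • toCube y)) =
      ContinuousLinearMap.id ℝ (E d) + t • Q := by
    intro t ht
    have hs : t • toCube y ∈ cube := fun i => by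
      have := abs_le.2 (toCube_mem y i)
      refine abs_le.1 ?_
      simp only [Pi.smul_apply, smul_eq_mul, abs_mul, abs_of_nonneg ht.1]
      exact mul_le_one₀ ht.2 (abs_nonneg _) this
    rw [J_eq, toCube_toU hs, hQ, ← tsum_const_smul'']
    simp [smul_smul, mul_assoc]
  have hcont : Continuous fun t : ℝ => (ContinuousLinearMap.id ℝ (E d) + t • Q).det :=
    ContinuousLinearMap.continuous_det.comp (by fun_prop)
  have hy1 : (ContinuousLinearMap.id ℝ (E d) + (1 : ℝ) • Q).det < 0 := by
    rwa [one_smul, hQ, ← J_eq]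
  have hy0 : (ContinuousLinearMap.id ℝ (E d) + (0 : ℝ) • Q).det = 1 := by
    simp [ContinuousLinearMap.det]
  obtain ⟨t, ht, ht0⟩ := intermediate_value_Icc' zero_le_one hcont.continuousOn
    (show (0 : ℝ) ∈ Icc _ _ from ⟨hy1.le, by rw [hy0]; exact zero_le_one⟩)
  have := pow_le_abs_det_J hA3 hx (toU_mem (t • toCube y))
  rw [hJ t ht] at this
  simp only at ht0
  rw [ht0, abs_zero] at this
  linarith

end SingularValues

/-! ### Derivative bounds for analytic functions -/

section Analytic

variable {X : Type*} [NormedAddCommGroup X] [NormedSpace ℝ X]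

/-- Cauchy's estimates, uniformly near a point. -/
lemma exists_iteratedFDeriv_bound_nhds {f : X → ℝ} {x : X} (hf : AnalyticAt ℝ f x) :
    ∃ C a : ℝ, 0 ≤ C ∧ 0 ≤ a ∧ ∀ᶠ q in 𝓝 x, ∀ n : ℕ,
      ‖iteratedFDeriv ℝ n f q‖ ≤ C * a ^ n * n.factorial := by
  obtain ⟨p, r, hp⟩ := hf
  obtain ⟨ε, hε0, hε⟩ := ENNReal.lt_iff_exists_nnreal_btwn.1 hp.r_pos
  have hε0' : 0 < ε := by exact_mod_cast hε0
  set ρ : ℝ≥0 := ε / 2 with hρ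
  have hρ0 : 0 < ρ := by positivity
  have hρρ : (ρ : ℝ≥0∞) + ρ < r := by
    rw [← ENNReal.coe_add, hρ, add_halves]; exact hε
  have hρr : (ρ : ℝ≥0∞) < r := lt_of_le_of_lt le_self_add hρρ
  have hsum := p.changeOriginSeries_summable_aux₁ (hρρ.trans_le hp.r_le)
  obtain ⟨hfib, hsum'⟩ := NNReal.summable_sigma.1 hsum
  set S := ∑' k : ℕ, ∑' s : Σ l : ℕ, { s : Finset (Fin (k + l)) // s.card = l },
    ‖p (k + s.1)‖₊ * ρ ^ s.1 * ρ ^ k with hS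
  have hbound : ∀ y : X, ‖y‖₊ < ρ → ∀ k, ‖p.changeOrigin y k‖₊ * ρ ^ k ≤ S := by
    intro y hy k
    have hyr : (‖y‖₊ : ℝ≥0∞) < p.radius :=
      (ENNReal.coe_lt_coe.2 hy).trans (hρr.trans_le hp.r_le)
    have hfib' : Summable fun s : Σ l : ℕ, { s : Finset (Fin (k + l)) // s.card = l } =>
        ‖p (k + s.1)‖₊ * ρ ^ s.1 := by
      have := (hfib k).mul_right (ρ ^ k)⁻¹
      refine this.congr fun s => ?_
      rw [mul_assoc, mul_inv_cancel₀ (pow_ne_zero _ hρ0.ne'), mul_one]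
    calc ‖p.changeOrigin y k‖₊ * ρ ^ k
        ≤ (∑' s : Σ l : ℕ, { s : Finset (Fin (k + l)) // s.card = l },
            ‖p (k + s.1)‖₊ * ‖y‖₊ ^ s.1) * ρ ^ k := by
          gcongr; exact p.nnnorm_changeOrigin_le k hyr
      _ ≤ (∑' s : Σ l : ℕ, { s : Finset (Fin (k + l)) // s.card = l },
            ‖p (k + s.1)‖₊ * ρ ^ s.1) * ρ ^ k := by
          refine mul_le_mul_of_nonneg_right
            (Summable.tsum_le_tsum (fun s => by gcongr) ?_ hfib') zero_le
          exact NNReal.summable_of_le (fun s => by gcongr) hfib'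
      _ = ∑' s : Σ l : ℕ, { s : Finset (Fin (k + l)) // s.card = l },
            ‖p (k + s.1)‖₊ * ρ ^ s.1 * ρ ^ k := NNReal.tsum_mul_right _ _ |>.symm
      _ ≤ S := hsum'.le_tsum' k
  refine ⟨S, (ρ : ℝ)⁻¹, S.2, by positivity, ?_⟩
  filter_upwards [Metric.ball_mem_nhds x (show (0 : ℝ) < ρ from hρ0)] with q hq n
  have hy : ‖q - x‖₊ < ρ := by
    rw [← NNReal.coe_lt_coe, coe_nnnorm]; simpa [dist_eq_norm] using hq
  have hser := hp.changeOrigin (y := q - x) ((ENNReal.coe_lt_coe.2 hy).trans hρr)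
  rw [add_sub_cancel] at hser
  refine ContinuousMultilinearMap.opNorm_le_bound (by positivity) fun v => ?_
  rw [hser.iteratedFDeriv_eq_sum_of_completeSpace]
  have hb : ‖p.changeOrigin (q - x) n‖ ≤ S * (ρ : ℝ)⁻¹ ^ n := by
    have := hbound _ hy n
    have h2 : ‖p.changeOrigin (q - x) n‖ * (ρ : ℝ) ^ n ≤ S := by exact_mod_cast this
    rw [inv_pow]
    exact (le_mul_inv_iff₀ (by positivity)).2 h2
  calc ‖∑ τ : Equiv.Perm (Fin n), p.changeOrigin (q - x) n fun i => v (τ i)‖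
      ≤ ∑ τ : Equiv.Perm (Fin n), S * (ρ : ℝ)⁻¹ ^ n * ∏ i, ‖v i‖ := by
        refine norm_sum_le_of_le _ fun τ _ => ?_
        refine (ContinuousMultilinearMap.le_opNorm _ _).trans ?_
        rw [Equiv.prod_comp τ fun i => ‖v i‖]
        gcongr
    _ = S * (ρ : ℝ)⁻¹ ^ n * n.factorial * ∏ i, ‖v i‖ := by
        simp [Finset.card_univ, Fintype.card_perm]
        ring

/-- Cauchy's estimates on a compact set. -/
lemma exists_iteratedFDeriv_bound {f : X → ℝ} {K : Set X} (hK : IsCompact K)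
    (hf : AnalyticOnNhd ℝ f K) :
    ∃ C a : ℝ, 0 < C ∧ 1 ≤ a ∧ ∀ q ∈ K, ∀ n : ℕ,
      ‖iteratedFDeriv ℝ n f q‖ ≤ C * a ^ n * n.factorial := by
  refine hK.induction_on (p := fun S => ∃ C a : ℝ, 0 < C ∧ 1 ≤ a ∧ ∀ q ∈ S, ∀ n : ℕ,
      ‖iteratedFDeriv ℝ n f q‖ ≤ C * a ^ n * n.factorial) ⟨1, 1, by simp⟩ ?_ ?_ ?_
  · rintro S T hST ⟨C, a, hC, ha, h⟩
    exact ⟨C, a, hC, ha, fun q hq => h q (hST hq)⟩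
  · rintro S T ⟨C, a, hC, ha, h⟩ ⟨C', a', hC', ha', h'⟩
    refine ⟨max C C', max a a', lt_max_of_lt_left hC, le_max_of_le_left ha, ?_⟩
    rintro q (hq | hq) n
    · refine (h q hq n).trans ?_
      gcongr
      exacts [le_max_left _ _, le_max_left _ _]
    · refine (h' q hq n).trans ?_
      gcongr
      exacts [le_max_right _ _, le_max_right _ _]
  · intro x hx
    obtain ⟨C, a, hC, ha, h⟩ := exists_iteratedFDeriv_bound_nhds (hf x hx)
    refine ⟨_, mem_nhdsWithin_of_mem_nhds h, C + 1, a + 1, by linarith, by linarith, ?_⟩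
    intro q hq n
    refine (hq n).trans ?_
    gcongr <;> linarith

/-- The iterated directional derivative of `f` along a list of vectors. -/
def dirDeriv (f : X → ℝ) : List X → X → ℝ
  | [] => f
  | v :: l => fun z => fderiv ℝ (dirDeriv f l) z v

lemma dirDeriv_eq_iteratedFDeriv {f : X → ℝ} {O : Set X} (hO : IsOpen O)
    (hf : AnalyticOnNhd ℝ f O) (l : List X) {z : X} (hz : z ∈ O) :
    dirDeriv f l z = iteratedFDeriv ℝ l.length f z l.get := by
  induction l generalizing z with
  | nil => simp [dirDeriv]
  | cons v l ih =>
    have hev : dirDeriv f l =ᶠ[𝓝 z] fun z => iteratedFDeriv ℝ l.length f z l.get := by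
      filter_upwards [hO.mem_nhds hz] with w hw using ih hw
    have hdiff : DifferentiableAt ℝ (iteratedFDeriv ℝ l.length f) z :=
      (hf.iteratedFDeriv l.length z hz).differentiableAt
    have h := iteratedFDeriv_succ_apply_left (𝕜 := ℝ) (f := f) (x := z) (v :: l).get
    change fderiv ℝ (dirDeriv f l) z v = _
    rw [hev.fderiv_eq]
    refine Eq.trans ?_ h.symm
    have h2 := ((ContinuousMultilinearMap.apply ℝ (fun _ : Fin l.length => X) ℝ
      l.get).hasFDerivAt.comp z hdiff.hasFDerivAt).fderiv
    have h3 : (fun z => iteratedFDeriv ℝ l.length f z l.get) =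
      (ContinuousMultilinearMap.apply ℝ (fun _ : Fin l.length => X) ℝ l.get) ∘
        iteratedFDeriv ℝ l.length f := rfl
    rw [h3, h2]
    rfl

lemma analyticOnNhd_dirDeriv {f : X → ℝ} {O : Set X} (hf : AnalyticOnNhd ℝ f O) (l : List X) :
    AnalyticOnNhd ℝ (dirDeriv f l) O := by
  induction l with
  | nil => exact hf
  | cons v l ih =>
    exact fun z hz =>
      ((ContinuousLinearMap.apply ℝ ℝ v).analyticAt _).comp ((ih.fderiv) z hz)

/-- Directional derivatives of an analytic function commute. -/
lemma dirDeriv_perm {f : X → ℝ} {O : Set X} (hO : IsOpen O) (hf : AnalyticOnNhd ℝ f O)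
    {l l' : List X} (h : l.Perm l') : ∀ z ∈ O, dirDeriv f l z = dirDeriv f l' z := by
  induction h with
  | nil => intro z _; rfl
  | cons v _ ih =>
    intro z hz
    have hev := (hO.eventually_mem hz).mono ih
    simp only [dirDeriv]
    rw [Filter.EventuallyEq.fderiv_eq hev]
  | swap v w l =>
    intro z hz
    have han := analyticOnNhd_dirDeriv hf l
    have hsymm : IsSymmSndFDerivAt ℝ (dirDeriv f l) z :=
      (han z hz).contDiffAt.isSymmSndFDerivAt (n := ω) (by simp)
    have hd : DifferentiableAt ℝ (fderiv ℝ (dirDeriv f l)) z := (han.fderiv z hz).differentiableAt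
    have key : ∀ v w : X, dirDeriv f (w :: v :: l) z =
        fderiv ℝ (fderiv ℝ (dirDeriv f l)) z w v := by
      intro v w
      have := ((ContinuousLinearMap.apply ℝ ℝ v).hasFDerivAt.comp z hd.hasFDerivAt).fderiv
      change fderiv ℝ ((ContinuousLinearMap.apply ℝ ℝ v) ∘ fderiv ℝ (dirDeriv f l)) z w = _
      rw [this]
      rfl
    rw [key, key, hsymm.eq]
  | trans _ _ ih ih' => intro z hz; rw [ih z hz, ih' z hz]

end Analytic

section PartialDerivatives

variable {d : ℕ}

lemma factorial_le_pow_mul_prod {n : ℕ} (i : Fin n → Fin d) :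
    (n.factorial : ℝ) ≤ (d : ℝ) ^ n *
      ∏ j : Fin d, ((Finset.univ.filter fun k => i k = j).card.factorial : ℝ) := by
  set c : Fin d → ℕ := fun j => (Finset.univ.filter fun k => i k = j).card with hc
  have hsum : ∑ j, c j = n := by
    have := Finset.card_eq_sum_card_fiberwise (f := i) (s := Finset.univ) (t := Finset.univ)
      (fun _ _ => Finset.mem_coe.2 (Finset.mem_univ _))
    simpa using this.symm
  have hle : Nat.multinomial Finset.univ c ≤ d ^ n := by
    have := Finset.sum_pow_eq_sum_piAntidiag (Finset.univ : Finset (Fin d)) (fun _ => (1 : ℕ)) n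
    simp only [Finset.sum_const, Finset.card_univ, Fintype.card_fin, smul_eq_mul, mul_one, one_pow,
      Finset.prod_const_one, Nat.cast_id] at this
    rw [this]
    exact Finset.single_le_sum (f := fun k => Nat.multinomial Finset.univ k)
      (fun _ _ => Nat.zero_le _) (by simp [Finset.mem_piAntidiag, hsum])
  have h := Nat.multinomial_spec Finset.univ c
  rw [hsum] at h
  have h2 : n.factorial ≤ d ^ n * ∏ j, (c j).factorial := by
    rw [← h, mul_comm]
    gcongr
  exact_mod_cast h2

lemma prod_factorial_fiber_le {n : ℕ} (i : Fin n → Fin d) :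
    ∏ j : Fin d, ((Finset.univ.filter fun k => i k = j).card.factorial : ℝ) ≤ n.factorial := by
  set c : Fin d → ℕ := fun j => (Finset.univ.filter fun k => i k = j).card with hc
  have hsum : ∑ j, c j = n := by
    have := Finset.card_eq_sum_card_fiberwise (f := i) (s := Finset.univ) (t := Finset.univ)
      (fun _ _ => Finset.mem_coe.2 (Finset.mem_univ _))
    simpa using this.symm
  have := Nat.le_of_dvd (Nat.factorial_pos _) (Nat.prod_factorial_dvd_factorial_sum Finset.univ c)
  rw [hsum] at this
  exact_mod_cast this

lemma partialWithin_eq_of_isOpen {S : Set (E d)} (hS : IsOpen S) (f : E d → ℝ) {n : ℕ}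
    (i : Fin n → Fin d) {x : E d} (hx : x ∈ S) :
    partialWithin S f i x =
      iteratedFDeriv ℝ n f x (fun k => EuclideanSpace.single (i k) (1 : ℝ)) := by
  rw [partialWithin, iteratedFDerivWithin_of_isOpen n hS hx]

lemma exists_hasAnalyticBounds {S : Set (E d)} (hS : IsOpen S) (hbd : Bornology.IsBounded S)
    (hd : 0 < d) {f : E d → ℝ} (hf : AnalyticOnNhd ℝ f (closure S)) :
    ∃ C ρ : ℝ, 0 < C ∧ 1 ≤ ρ ∧ HasAnalyticBounds S f C ρ := by
  obtain ⟨C, a, hC, ha, h⟩ := exists_iteratedFDeriv_bound hbd.isCompact_closure hf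
  have hd1 : (1 : ℝ) ≤ d := by exact_mod_cast hd
  refine ⟨C, d * a, hC, by nlinarith, fun n i x hx => ?_⟩
  rw [partialWithin_eq_of_isOpen hS f i hx, ← Real.norm_eq_abs]
  refine (ContinuousMultilinearMap.le_opNorm _ _).trans ?_
  have h1 := h x (subset_closure hx) n
  have h2 := factorial_le_pow_mul_prod i
  simp only [PiLp.norm_single, norm_one, Finset.prod_const_one, mul_one]
  calc ‖iteratedFDeriv ℝ n f x‖ ≤ C * a ^ n * n.factorial := h1
    _ ≤ C * a ^ n * ((d : ℝ) ^ n *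
      ∏ j : Fin d, ((Finset.univ.filter fun k => i k = j).card.factorial : ℝ)) := by gcongr
    _ = _ := by rw [mul_pow]; ring

/-- Bounds for the partial derivatives give bounds for the directional derivatives; expanding in
coordinates costs a factor `d` per direction. -/
lemma abs_dirDeriv_le {S : Set (E d)} (hS : IsOpen S) {f : E d → ℝ} (hf : AnalyticOnNhd ℝ f S)
    {C ρ : ℝ} (hC : 0 ≤ C) (hρ : 0 ≤ ρ) (h : HasAnalyticBounds S f C ρ) (l : List (E d)) {z : E d}
    (hz : z ∈ S) :
    |dirDeriv f l z| ≤ C * (d * ρ) ^ l.length * l.length.factorial * (l.map (‖·‖)).prod := by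
  rw [dirDeriv_eq_iteratedFDeriv hS hf l hz]
  set n := l.length with hn
  have hexp : (l.get : Fin n → E d) =
      fun k => ∑ j : Fin d, (l.get k) j • EuclideanSpace.single j (1 : ℝ) := by
    funext k
    have := (EuclideanSpace.basisFun (Fin d) ℝ).sum_repr (l.get k)
    simpa using this.symm
  have hprod : (l.map (‖·‖)).prod = ∏ k, ‖l.get k‖ := by
    rw [← List.prod_ofFn]
    congr 1
    rw [List.ofFn_congr rfl]
    conv_lhs => rw [← List.ofFn_get l, List.map_ofFn]
    rfl
  have hcalc : iteratedFDeriv ℝ n f z l.get = ∑ r : Fin n → Fin d,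
      (∏ k, (l.get k) (r k)) * partialWithin S f r z := by
    conv_lhs => rw [hexp]
    rw [ContinuousMultilinearMap.map_sum]
    refine Finset.sum_congr rfl fun r _ => ?_
    rw [ContinuousMultilinearMap.map_smul_univ, partialWithin_eq_of_isOpen hS f r hz, smul_eq_mul]
  rw [hcalc, hprod]
  calc |∑ r : Fin n → Fin d, (∏ k, (l.get k) (r k)) * partialWithin S f r z|
      ≤ ∑ r : Fin n → Fin d, (∏ k, ‖l.get k‖) * (C * n.factorial * ρ ^ n) := by
        refine (Finset.abs_sum_le_sum_abs _ _).trans (Finset.sum_le_sum fun r _ => ?_)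
        rw [abs_mul, Finset.abs_prod]
        refine mul_le_mul ?_ ((h n r z hz).trans ?_) (abs_nonneg _) (by positivity)
        · refine Finset.prod_le_prod (fun _ _ => abs_nonneg _) fun k _ => ?_
          exact PiLp.norm_apply_le (l.get k) (r k)
        · gcongr
          exact prod_factorial_fiber_le r
    _ = _ := by
        simp only [Finset.sum_const, Finset.card_univ, Fintype.card_fun, Fintype.card_fin,
          nsmul_eq_mul]
        push_cast
        rw [mul_pow]
        ring

end PartialDerivatives

/-! ### Majorants of geometric type -/

section GeometricMajorants

variable {Y : Type*} [NormedAddCommGroup Y] [NormedSpace ℝ Y]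

lemma hasMajorant_const {b : ℕ → ℝ} (v : Y) {C : ℝ} (hC : ‖v‖ ≤ C) :
    HasMajorant b (fun _ => v) (fun k => C * 0 ^ k) := by
  refine ⟨fun M _ => if M = 0 then v else 0, fun _ _ => rfl, fun M j s _ => ?_, fun M s _ => ?_⟩
  · simpa using hasDerivWithinAt_const _ _ _
  · by_cases h : M = 0
    · simpa [h] using hC
    · simp [h]

lemma HasMajorant.prod {R : Type*} [NormedCommRing R] [NormedAlgebra ℝ R] (h1 : ‖(1 : R)‖ ≤ 1)
    {b : ℕ → ℝ} (hb : ∀ i, 0 ≤ b i) {ι : Type*} (S : Finset ι) {w : ι → (ℕ → ℝ) → R} {C r : ℝ}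
    (hr : 0 ≤ r) (h : ∀ i ∈ S, HasMajorant b (w i) (fun k => C * r ^ k)) :
    HasMajorant b (fun s => ∏ i ∈ S, w i s) (fun k => C ^ S.card * (S.card * r) ^ k) := by
  classical
  induction S using Finset.induction_on with
  | empty => simpa using hasMajorant_const (b := b) (1 : R) h1
  | insert i S hi ih =>
    simp only [Finset.prod_insert hi]
    have := (h i (by simp)).bilin_geometric hb hr (by positivity)
      (ih fun k hk => h k (by simp [hk])) (ContinuousLinearMap.mul ℝ R) fun y z => norm_mul_le y z
    refine this.mono hb fun k => le_of_eq ?_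
    rw [Finset.card_insert_of_notMem hi]
    push_cast
    ring

lemma HasMajorant.clm_le {Z : Type*} [NormedAddCommGroup Z] [NormedSpace ℝ Z] {b : ℕ → ℝ}
    (hb : ∀ i, 0 ≤ b i) {w : (ℕ → ℝ) → Y} {a : ℕ → ℝ} (h : HasMajorant b w a) (L : Y →L[ℝ] Z)
    (hL : ∀ v, ‖L v‖ ≤ ‖v‖) : HasMajorant b (fun s => L (w s)) a :=
  (h.clm L zero_le_one fun v => by rw [one_mul]; exact hL v).mono hb fun k => (one_mul _).le

lemma HasMajorant.mul_geometric {R : Type*} [NormedRing R] [NormedAlgebra ℝ R] {b : ℕ → ℝ}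
    (hb : ∀ i, 0 ≤ b i) {w₁ w₂ : (ℕ → ℝ) → R} {C₁ C₂ r₁ r₂ : ℝ} (hr₁ : 0 ≤ r₁) (hr₂ : 0 ≤ r₂)
    (h₁ : HasMajorant b w₁ (fun k => C₁ * r₁ ^ k)) (h₂ : HasMajorant b w₂ (fun k => C₂ * r₂ ^ k)) :
    HasMajorant b (fun s => w₁ s * w₂ s) (fun k => C₁ * C₂ * (r₁ + r₂) ^ k) :=
  h₁.bilin_geometric hb hr₁ hr₂ h₂ (ContinuousLinearMap.mul ℝ R) fun y z => norm_mul_le y z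

/-- The inverse of an affine function solves a linear equation whose operator depends affinely on
`s`; the Neumann series gives its majorant. -/
lemma HasMajorant.inverse {R : Type*} [NormedRing R] [NormedAlgebra ℝ R] [CompleteSpace R]
    (hone : ‖(1 : R)‖ ≤ 1) {b : ℕ → ℝ} (hb : ∀ i, 0 ≤ b i) {w w' : (ℕ → ℝ) → R} {C κ : ℝ}
    (hκ : 0 ≤ κ) (h : HasMajorant b w (fun k => if k = 0 then C else if k = 1 then 1 else 0))
    (hw : ∀ s ∈ cube, w s * w' s = 1 ∧ w' s * w s = 1 ∧ ‖w' s‖ ≤ κ) :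
    HasMajorant b w' (fun k => κ * κ ^ k) := by
  have hT := h.clm_le hb (ContinuousLinearMap.mul ℝ R)
    fun v => ContinuousLinearMap.opNorm_mul_apply_le ℝ R v
  refine hT.solve hb (κ := κ) hκ (hasMajorant_const (1 : R) hone)
    (fun s hs => ?_) (fun s hs => (hw s hs).1) fun k => ?_
  · obtain ⟨h1, h2, h3⟩ := hw s hs
    set u : (R →L[ℝ] R)ˣ := ⟨ContinuousLinearMap.mul ℝ R (w s), ContinuousLinearMap.mul ℝ R (w' s),
      by ext v; simp [← mul_assoc, h1], by ext v; simp [← mul_assoc, h2]⟩ with hu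
    have hval : ContinuousLinearMap.mul ℝ R (w s) = u := rfl
    rw [hval, Ring.inverse_unit]
    exact ⟨u.isUnit, (ContinuousLinearMap.opNorm_mul_apply_le ℝ R _).trans h3⟩
  · cases k with
    | zero => simp
    | succ k =>
      have hsum : ∑ q ∈ Finset.HasAntidiagonal.antidiagonal (k + 1), (if q.1 = 0 then (0 : ℝ) else
          (if q.1 = 0 then C else if q.1 = 1 then 1 else 0)) * (κ * κ ^ q.2) = κ * κ ^ k := by
        rw [Finset.sum_eq_single (1, k)]
        · simp
        · rintro ⟨i, j⟩ hq hne
          have hq' := Finset.HasAntidiagonal.mem_antidiagonal.1 hq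
          have : i ≠ 1 := by
            rintro rfl
            apply hne
            simp only at hq'
            ext
            · rfl
            · simp only; omega
          by_cases h0 : i = 0 <;> simp [h0, this]
        · intro hn
          exact absurd (Finset.HasAntidiagonal.mem_antidiagonal.2 (by simp; omega)) hn
      rw [hsum]
      simp [pow_succ]
      apply le_of_eq
      ring

end GeometricMajorants

/-! ### Matrices and matrix fields -/

section MatrixAlgebra

variable {X : Type*} [NormedAddCommGroup X] [InnerProductSpace ℝ X]

/-- The Banach algebra of linear endomorphisms of `X`. It is a synonym of `X →L[ℝ] X` that carries
only the structure of a normed algebra, so that fields with values in it have one topology. -/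
def MatrixAlg (X : Type*) [NormedAddCommGroup X] [InnerProductSpace ℝ X] : Type _ := X →L[ℝ] X

instance : NormedRing (MatrixAlg X) := inferInstanceAs (NormedRing (X →L[ℝ] X))

instance : NormedAlgebra ℝ (MatrixAlg X) := inferInstanceAs (NormedAlgebra ℝ (X →L[ℝ] X))

instance [FiniteDimensional ℝ X] : CompleteSpace (MatrixAlg X) :=
  inferInstanceAs (CompleteSpace (X →L[ℝ] X))

variable (X) in
/-- The identity map from endomorphisms to the algebra `MatrixAlg X`. -/
def opEquiv : (X →L[ℝ] X) ≃L[ℝ] MatrixAlg X := ContinuousLinearEquiv.refl ℝ (X →L[ℝ] X)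

lemma norm_opEquiv (T : X →L[ℝ] X) : ‖opEquiv X T‖ = ‖T‖ := rfl

lemma opEquiv_mul (S T : X →L[ℝ] X) : opEquiv X (S * T) = opEquiv X S * opEquiv X T := rfl

lemma isUnit_opEquiv {T : X →L[ℝ] X} (h : IsUnit T) : IsUnit (opEquiv X T) := h

lemma inverse_opEquiv (T : X →L[ℝ] X) : Ring.inverse (opEquiv X T) = opEquiv X (Ring.inverse T) :=
  rfl

lemma norm_one_matrixAlg_le : ‖(1 : MatrixAlg X)‖ ≤ 1 :=
  (ContinuousLinearMap.norm_id_le : ‖ContinuousLinearMap.id ℝ X‖ ≤ 1)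

variable (X) in
/-- Scalars as multiples of the identity matrix. -/
def scalarL : ℝ →L[ℝ] MatrixAlg X := (ContinuousLinearMap.id ℝ ℝ).smulRight (1 : MatrixAlg X)

lemma scalarL_apply (c : ℝ) : scalarL X c = c • (1 : MatrixAlg X) := rfl

lemma norm_scalarL_le (c : ℝ) : ‖scalarL X c‖ ≤ ‖c‖ := by
  rw [scalarL_apply, norm_smul]
  nlinarith [norm_nonneg c, norm_one_matrixAlg_le (X := X)]

variable [FiniteDimensional ℝ X]

/-- The entries of a matrix in an orthonormal basis. -/
def entryL (k l : Fin (Module.finrank ℝ X)) : MatrixAlg X →L[ℝ] ℝ :=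
  ((innerSL ℝ (stdOrthonormalBasis ℝ X k)).comp
    (ContinuousLinearMap.apply ℝ X (stdOrthonormalBasis ℝ X l))).comp
      ((opEquiv X).symm : MatrixAlg X →L[ℝ] (X →L[ℝ] X))

lemma entryL_opEquiv (k l : Fin (Module.finrank ℝ X)) (T : X →L[ℝ] X) : entryL k l (opEquiv X T) =
    ⟪stdOrthonormalBasis ℝ X k, T (stdOrthonormalBasis ℝ X l)⟫_ℝ := rfl

lemma norm_entryL_le (k l : Fin (Module.finrank ℝ X)) (T : MatrixAlg X) : ‖entryL k l T‖ ≤ ‖T‖ := by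
  obtain ⟨T, rfl⟩ := (opEquiv X).surjective T
  rw [entryL_opEquiv, norm_opEquiv]
  refine (norm_inner_le_norm _ _).trans ?_
  rw [OrthonormalBasis.norm_eq_one, one_mul]
  refine (T.le_opNorm _).trans ?_
  rw [OrthonormalBasis.norm_eq_one, mul_one]

lemma det_eq_sum_entryL (T : X →L[ℝ] X) : T.det = ∑ τ : Equiv.Perm (Fin (Module.finrank ℝ X)),
    ((Equiv.Perm.sign τ : ℤ) : ℝ) * ∏ i, entryL (τ i) i (opEquiv X T) := by
  rw [ContinuousLinearMap.det, ← LinearMap.det_toMatrix (stdOrthonormalBasis ℝ X).toBasis,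
    Matrix.det_apply']
  refine Finset.sum_congr rfl fun τ _ => ?_
  congr 1
  refine Finset.prod_congr rfl fun i _ => ?_
  rw [LinearMap.toMatrix_apply, entryL_opEquiv]
  simp [OrthonormalBasis.repr_apply_apply]

variable (X) in
/-- Transposition of matrices. -/
def adjointL : MatrixAlg X →L[ℝ] MatrixAlg X :=
  ((opEquiv X).symm.trans ((starL' ℝ).trans (opEquiv X)) : MatrixAlg X ≃L[ℝ] MatrixAlg X)

lemma adjointL_opEquiv (T : X →L[ℝ] X) : adjointL X (opEquiv X T) = opEquiv X (star T) := rfl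

lemma norm_adjointL_le (T : MatrixAlg X) : ‖adjointL X T‖ ≤ ‖T‖ := by
  obtain ⟨T, rfl⟩ := (opEquiv X).surjective T
  rw [adjointL_opEquiv, norm_opEquiv, norm_opEquiv, ContinuousLinearMap.star_eq_adjoint]
  exact (LinearIsometryEquiv.norm_map ContinuousLinearMap.adjoint T).le

end MatrixAlgebra

section BoundedCoefficients

open BoundedContinuousFunction

section BoundedFields

variable {α : Type*} [TopologicalSpace α]

lemma norm_one_field_le {R : Type*} [NormedRing R] (h : ‖(1 : R)‖ ≤ 1) :
    ‖(1 : BoundedContinuousFunction α R)‖ ≤ 1 := (norm_le zero_le_one).2 fun _ => h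

lemma tsum_field_apply {F : Type*} [NormedAddCommGroup F] [NormedSpace ℝ F]
    {P : ℕ → BoundedContinuousFunction α F} (h : Summable P) (x : α) :
    (∑' i, P i) x = ∑' i, P i x := by
  have := (h.hasSum.mapL (evalCLM ℝ x)).tsum_eq
  simpa using this.symm

/-- Composition with a linear contraction, as a map of bounded continuous functions. -/
lemma norm_compLeft_le {F G : Type*} [NormedAddCommGroup F] [NormedSpace ℝ F]
    [NormedAddCommGroup G] [NormedSpace ℝ G] (L : F →L[ℝ] G) (hL : ∀ v, ‖L v‖ ≤ ‖v‖)
    (a : BoundedContinuousFunction α F) :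
    ‖ContinuousLinearMap.compLeftContinuousBounded α L a‖ ≤ ‖a‖ :=
  (norm_le (norm_nonneg _)).2 fun x => (hL (a x)).trans (a.norm_coe_le_norm x)

lemma prod_field_apply {ι : Type*} (S : Finset ι) (g : ι → BoundedContinuousFunction α ℝ) (x : α) :
    (∏ i ∈ S, g i) x = ∏ i ∈ S, g i x := by
  classical
  induction S using Finset.induction_on with
  | empty => simp
  | insert i S hi ih => rw [Finset.prod_insert hi, Finset.prod_insert hi, mul_apply, ih]

end BoundedFields

/-- A linear map on a finite-dimensional space that is bounded below is invertible. -/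
lemma isUnit_of_lower_bound {X : Type*} [NormedAddCommGroup X] [NormedSpace ℝ X]
    [FiniteDimensional ℝ X] (T : X →L[ℝ] X) {σ : ℝ} (hσ : 0 < σ) (h : ∀ v, σ * ‖v‖ ≤ ‖T v‖) :
    IsUnit T ∧ ‖Ring.inverse T‖ ≤ σ⁻¹ := by
  have hinj : Function.Injective (T : X →ₗ[ℝ] X) := by
    rw [← LinearMap.ker_eq_bot, LinearMap.ker_eq_bot']
    intro v hv
    have := h v
    rw [show T v = 0 from hv, norm_zero] at this
    exact norm_eq_zero.1 (le_antisymm (nonpos_of_mul_nonpos_right this hσ) (norm_nonneg _))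
  have hu : IsUnit T := by
    set e := LinearEquiv.ofInjectiveEndo (T : X →ₗ[ℝ] X) hinj
    refine ⟨⟨T, e.symm.toLinearMap.toContinuousLinearMap, ?_, ?_⟩, rfl⟩
    · ext v; exact e.apply_symm_apply v
    · ext v; exact e.symm_apply_apply v
  refine ⟨hu, ContinuousLinearMap.opNorm_le_bound _ (inv_nonneg.2 hσ.le) fun v => ?_⟩
  have h2 : T (Ring.inverse T v) = v := by
    rw [← mul_apply_eq_comp, Ring.mul_inverse_cancel _ hu]; rfl
  have := h (Ring.inverse T v)
  rw [h2] at this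
  rw [inv_mul_eq_div, le_div_iff₀ hσ]
  linarith

/-! ### The transported coefficients as functions on the cube -/

/-- The standing assumptions on the reference domain and the fluctuations, with the bounds for the
singular values in the form in which they are used. -/
structure IsAdmissible {X : Type*} [NormedAddCommGroup X] [InnerProductSpace ℝ X]
    [FiniteDimensional ℝ X] [MeasurableSpace X] [BorelSpace X] (D : Set X) (ψ : ℕ → X → X)
    (σ : ℝ) : Prop where
  isOpen : IsOpen D
  isPreconnected : IsPreconnected D
  isBounded : Bornology.IsBounded D
  a1 : AssumptionA1 D ψ
  a4 : AssumptionA4 D ψ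
  pos : 0 < σ
  mul_norm_le : ∀ x ∈ D, ∀ y ∈ U, ∀ v, σ * ‖v‖ ≤ ‖J ψ x y v‖
  pow_le_det : ∀ x ∈ D, ∀ y ∈ U, σ ^ Module.finrank ℝ X ≤ (J ψ x y).det

section Coefficients

variable {X : Type*} [NormedAddCommGroup X] [InnerProductSpace ℝ X] [FiniteDimensional ℝ X]
  [MeasurableSpace X] [BorelSpace X] {D : Set X} {ψ : ℕ → X → X} {σ : ℝ}

lemma IsAdmissible.isOpen_holdAll (H : IsAdmissible D ψ σ) : IsOpen (holdAll D ψ) :=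
  DomainUQ.isOpen_holdAll H.isOpen H.isPreconnected H.a1 H.a4 fun x hx y hy =>
    ((pow_pos H.pos _).trans_le (H.pow_le_det x hx y hy)).ne'

/-- The Jacobian `6^{-1/2} ψ_i'` as an element of the Banach algebra of bounded continuous
matrix fields on `D`. -/
def jacPsi (H : IsAdmissible D ψ σ) (i : ℕ) :
    BoundedContinuousFunction D (MatrixAlg X) :=
  ofNormedAddCommGroup (fun x : D => opEquiv X ((1 / √6) • fderiv ℝ (ψ i) x))
    ((opEquiv X).continuous.comp (Continuous.fun_const_smul
      (continuousOn_iff_continuous_domRestrict.1 (fderiv_psi_continuousOn H.isOpen H.a1 i)) _))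
    (b D ψ i) fun x => norm_fderiv_psi_le H.isOpen H.a1 H.a4 i x.2

lemma norm_jacPsi_le (H : IsAdmissible D ψ σ) (i : ℕ) : ‖jacPsi H i‖ ≤ b D ψ i :=
  (norm_le (b_nonneg i)).2 fun x => norm_fderiv_psi_le H.isOpen H.a1 H.a4 i x.2

/-- The matrix field `J(·, s)`. -/
def jacField (H : IsAdmissible D ψ σ) (s : ℕ → ℝ) :
    BoundedContinuousFunction D (MatrixAlg X) := 1 + ∑' i, s i • jacPsi H i

lemma jacField_apply (H : IsAdmissible D ψ σ) {s : ℕ → ℝ} (hs : s ∈ cube) (x : D) :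
    jacField H s x = opEquiv X (J ψ x (toU s)) := by
  have hsum : Summable fun i => s i • jacPsi H i :=
    Summable.of_norm_bounded (summable_b H.a4) fun i => norm_cube_smul_le hs (norm_jacPsi_le H i)
  rw [J_eq, toCube_toU hs, jacField, BoundedContinuousFunction.add_apply, tsum_field_apply hsum,
    map_add, ContinuousLinearEquiv.map_tsum]
  rfl

lemma hasMajorant_jacField (H : IsAdmissible D ψ σ) :
    HasMajorant (b D ψ) (jacField H)
      (fun k => if k = 0 then 1 + ξ D ψ else if k = 1 then 1 else 0) := by
  refine (hasMajorant_affine (summable_b H.a4) 1 (jacPsi H) (norm_jacPsi_le H)).mono b_nonneg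
    fun k => ?_
  have : ‖(1 : BoundedContinuousFunction D (MatrixAlg X))‖ ≤ 1 :=
    norm_one_field_le norm_one_matrixAlg_le
  split_ifs
  · rw [ξ]; linarith
  · rfl
  · rfl

lemma isUnit_J (H : IsAdmissible D ψ σ) {x : X} (hx : x ∈ D) {y : ℕ → ℝ} (hy : y ∈ U) :
    IsUnit (J ψ x y) ∧ ‖Ring.inverse (J ψ x y)‖ ≤ σ⁻¹ :=
  isUnit_of_lower_bound _ H.pos (H.mul_norm_le x hx y hy)

open scoped Classical in
/-- The matrix field `J(·, s)⁻¹`. -/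
def jacInvField (H : IsAdmissible D ψ σ) (s : ℕ → ℝ) :
    BoundedContinuousFunction D (MatrixAlg X) :=
  if hs : s ∈ cube then
    ofNormedAddCommGroup (fun x : D => Ring.inverse (jacField H s x))
      (continuous_iff_continuousAt.2 fun x => by
        obtain ⟨u, hu⟩ : IsUnit (jacField H s x) := by
          rw [jacField_apply H hs]; exact isUnit_opEquiv (isUnit_J H x.2 (toU_mem s)).1
        have h := NormedRing.inverse_continuousAt u
        rw [hu] at h
        exact ContinuousAt.comp h (jacField H s).continuous.continuousAt)
      σ⁻¹ fun x => by
        rw [jacField_apply H hs]; exact (isUnit_J H x.2 (toU_mem s)).2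
  else 0

lemma jacInvField_apply (H : IsAdmissible D ψ σ) {s : ℕ → ℝ} (hs : s ∈ cube) (x : D) :
    jacInvField H s x = opEquiv X (Ring.inverse (J ψ x (toU s))) := by
  rw [jacInvField, dif_pos hs, ← inverse_opEquiv, ← jacField_apply H hs]
  rfl

lemma norm_jacInvField_le (H : IsAdmissible D ψ σ) {s : ℕ → ℝ} (hs : s ∈ cube) :
    ‖jacInvField H s‖ ≤ σ⁻¹ := by
  refine (norm_le (inv_nonneg.2 H.pos.le)).2 fun x => ?_
  rw [jacInvField_apply H hs]
  exact (isUnit_J H x.2 (toU_mem s)).2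

lemma jacField_mul_jacInvField (H : IsAdmissible D ψ σ) {s : ℕ → ℝ} (hs : s ∈ cube) :
    jacField H s * jacInvField H s = 1 ∧ jacInvField H s * jacField H s = 1 := by
  have hu := fun x : D => (isUnit_J H x.2 (toU_mem s)).1
  constructor
  · ext1 x
    rw [BoundedContinuousFunction.mul_apply, jacField_apply H hs, jacInvField_apply H hs,
      ← opEquiv_mul, Ring.mul_inverse_cancel _ (hu x)]
    rfl
  · ext1 x
    rw [BoundedContinuousFunction.mul_apply, jacField_apply H hs, jacInvField_apply H hs,
      ← opEquiv_mul, Ring.inverse_mul_cancel _ (hu x)]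
    rfl

lemma hasMajorant_jacInvField (H : IsAdmissible D ψ σ) :
    HasMajorant (b D ψ) (jacInvField H) (fun k => σ⁻¹ * σ⁻¹ ^ k) :=
  HasMajorant.inverse (norm_one_field_le norm_one_matrixAlg_le) b_nonneg
    (inv_nonneg.2 H.pos.le) (hasMajorant_jacField H) fun _ hs =>
      ⟨(jacField_mul_jacInvField H hs).1, (jacField_mul_jacInvField H hs).2,
        norm_jacInvField_le H hs⟩

/-- The function `det J(·, s)`, through the Leibniz formula. -/
def detField (H : IsAdmissible D ψ σ) (s : ℕ → ℝ) : BoundedContinuousFunction D ℝ :=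
  ∑ τ : Equiv.Perm (Fin (Module.finrank ℝ X)), ((Equiv.Perm.sign τ : ℤ) : ℝ) •
    ∏ i, ContinuousLinearMap.compLeftContinuousBounded D (entryL (τ i) i) (jacField H s)

lemma detField_apply (H : IsAdmissible D ψ σ) {s : ℕ → ℝ} (hs : s ∈ cube) (x : D) :
    detField H s x = (J ψ x (toU s)).det := by
  rw [det_eq_sum_entryL, detField, coe_sum, Finset.sum_apply]
  refine Finset.sum_congr rfl fun τ _ => ?_
  rw [BoundedContinuousFunction.smul_apply, prod_field_apply, smul_eq_mul, ← jacField_apply H hs]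
  rfl

lemma hasMajorant_detField (H : IsAdmissible D ψ σ) :
    HasMajorant (b D ψ) (detField H)
      (fun k => (Module.finrank ℝ X).factorial * (1 + ξ D ψ) ^ Module.finrank ℝ X *
        (Module.finrank ℝ X : ℝ) ^ k) := by
  have hξ : 0 ≤ ξ D ψ := xi_nonneg
  have hJ : HasMajorant (b D ψ) (jacField H) (fun k => (1 + ξ D ψ) * 1 ^ k) := by
    refine (hasMajorant_jacField H).mono b_nonneg fun k => ?_
    split_ifs <;> simp [hξ]
    linarith
  have hent : ∀ k l, HasMajorant (b D ψ) (fun s =>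
      ContinuousLinearMap.compLeftContinuousBounded D (entryL k l) (jacField H s))
      (fun k => (1 + ξ D ψ) * 1 ^ k) := fun k l =>
    hJ.clm_le b_nonneg _ (norm_compLeft_le _ (norm_entryL_le k l))
  have hprod : ∀ τ : Equiv.Perm (Fin (Module.finrank ℝ X)), HasMajorant (b D ψ)
      (fun s => ((Equiv.Perm.sign τ : ℤ) : ℝ) •
        ∏ i, ContinuousLinearMap.compLeftContinuousBounded D (entryL (τ i) i) (jacField H s))
      (fun k => (1 + ξ D ψ) ^ Module.finrank ℝ X * (Module.finrank ℝ X : ℝ) ^ k) := by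
    intro τ
    have h := HasMajorant.prod (norm_one_field_le (α := D) (norm_one (α := ℝ)).le) b_nonneg
      Finset.univ zero_le_one fun i _ => hent (τ i) i
    have h2 := h.clm_le b_nonneg (((Equiv.Perm.sign τ : ℤ) : ℝ) •
      ContinuousLinearMap.id ℝ (BoundedContinuousFunction D ℝ)) fun v => by
        have hs : ‖((Equiv.Perm.sign τ : ℤ) : ℝ)‖ = 1 := by
          rcases Int.units_eq_one_or (Equiv.Perm.sign τ) with h | h <;> simp [h]
        refine (norm_smul_le ((Equiv.Perm.sign τ : ℤ) : ℝ) v).trans ?_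
        rw [hs, one_mul]
    refine h2.mono b_nonneg fun k => ?_
    simp
  refine (HasMajorant.sum Finset.univ fun τ _ => hprod τ).mono b_nonneg fun k => ?_
  simp [Finset.card_univ, Fintype.card_perm, mul_assoc]

/-- The diffusion matrix field `A(·, s) = det J J⁻¹ J⁻ᵀ`. -/
def diffusionField (H : IsAdmissible D ψ σ) (s : ℕ → ℝ) :
    BoundedContinuousFunction D (MatrixAlg X) :=
  ContinuousLinearMap.compLeftContinuousBounded D (scalarL X) (detField H s) *
    (jacInvField H s *
      ContinuousLinearMap.compLeftContinuousBounded D (adjointL X) (jacInvField H s))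

lemma diffusion_eq (H : IsAdmissible D ψ σ) {x : X} (hx : x ∈ D) {y : ℕ → ℝ}
    (hy : y ∈ U) : A ψ x y = (J ψ x y).det •
      (Ring.inverse (J ψ x y) * star (Ring.inverse (J ψ x y))) := by
  obtain ⟨u, hu⟩ := (isUnit_J H hx hy).1
  have hB : B ψ x y = ((star u * u : (X →L[ℝ] X)ˣ) : X →L[ℝ] X) := by
    rw [B, ← hu]
    rfl
  rw [A, hB, ← ContinuousLinearMap.ringInverse_eq_inverse, Ring.inverse_unit, ← hu,
    Ring.inverse_unit]
  simp [mul_inv_rev]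

lemma diffusionField_apply (H : IsAdmissible D ψ σ) {s : ℕ → ℝ} (hs : s ∈ cube) (x : D) :
    diffusionField H s x = opEquiv X (A ψ x (toU s)) := by
  have h1 : diffusionField H s x = (detField H s x • (1 : MatrixAlg X)) *
    (jacInvField H s x * adjointL X (jacInvField H s x)) := rfl
  rw [diffusion_eq H x.2 (toU_mem s), h1, jacInvField_apply H hs, detField_apply H hs,
    smul_mul_assoc, one_mul]
  rfl

lemma hasMajorant_diffusionField (H : IsAdmissible D ψ σ) :
    HasMajorant (b D ψ) (diffusionField H)
      (fun k => (Module.finrank ℝ X).factorial * (1 + ξ D ψ) ^ Module.finrank ℝ X * (σ⁻¹ * σ⁻¹) *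
        (Module.finrank ℝ X + (σ⁻¹ + σ⁻¹)) ^ k) := by
  have hσ : 0 ≤ σ⁻¹ := inv_nonneg.2 H.pos.le
  have hdet := (hasMajorant_detField H).clm_le b_nonneg _
    (norm_compLeft_le (α := D) (scalarL X) norm_scalarL_le)
  have hadj := (hasMajorant_jacInvField H).clm_le b_nonneg _
    (norm_compLeft_le (α := D) (adjointL X) norm_adjointL_le)
  exact hdet.mul_geometric b_nonneg (Nat.cast_nonneg _) (by positivity)
    ((hasMajorant_jacInvField H).mul_geometric b_nonneg hσ hσ hadj)

end Coefficients

section RightHandSide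

variable {X : Type*} [NormedAddCommGroup X] [InnerProductSpace ℝ X] {D : Set X} {ψ : ℕ → X → X}

lemma continuousOn_V (hA1 : AssumptionA1 D ψ) {y : ℕ → ℝ} (hy : y ∈ U) :
    ContinuousOn (fun x => V ψ x y) D := (hA1 y hy).2.continuousOn.mono subset_closure

variable [FiniteDimensional ℝ X] [MeasurableSpace X] [BorelSpace X] {σ : ℝ} {f : X → ℝ} {Cf r : ℝ}

/-- `|∂_{v_1} ⋯ ∂_{v_n} f| ≤ C n! r^n |v_1| ⋯ |v_n|` on `S` for all vectors `v_1, …, v_n`. -/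
def HasDirBounds {X : Type*} [NormedAddCommGroup X] [NormedSpace ℝ X] (S : Set X) (f : X → ℝ)
    (C r : ℝ) : Prop :=
  ∀ l : List X, ∀ z ∈ S, |dirDeriv f l z| ≤ C * r ^ l.length * l.length.factorial *
    (l.map (‖·‖)).prod

/-- The function `f ∘ V(·, s)`. -/
def pullbackField (H : IsAdmissible D ψ σ) (hf : AnalyticOnNhd ℝ f (holdAll D ψ))
    (hb : HasDirBounds (holdAll D ψ) f Cf r) (s : ℕ → ℝ) : BoundedContinuousFunction D ℝ :=
  ofNormedAddCommGroup (fun x : D => f (V ψ x (toU s)))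
    (continuousOn_iff_continuous_domRestrict.1 (hf.continuousOn.comp
      (continuousOn_V H.a1 (toU_mem s)) fun _ hx => V_mem_holdAll hx (toU_mem s))) Cf fun x => by
        simpa [dirDeriv] using hb [] _ (V_mem_holdAll x.2 (toU_mem s))

lemma continuousOn_dirDeriv_V (H : IsAdmissible D ψ σ)
    (hf : AnalyticOnNhd ℝ f (holdAll D ψ)) (l : List ℕ) (s : ℕ → ℝ) :
    Continuous fun x : D =>
      dirDeriv f (l.map fun i => (1 / √6) • ψ i x) (V ψ x (toU s)) := by
  have hO := H.isOpen_holdAll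
  have hV : Continuous fun x : D => V ψ (x : X) (toU s) :=
    continuousOn_iff_continuous_domRestrict.1 (continuousOn_V H.a1 (toU_mem s))
  have hmem : ∀ x : D, V ψ (x : X) (toU s) ∈ holdAll D ψ := fun x => V_mem_holdAll x.2 (toU_mem s)
  have hψ : ∀ i, Continuous fun x : D => ψ i x := fun i =>
    continuousOn_iff_continuous_domRestrict.1 (psi_continuousOn H.a1 i)
  have heq : (fun x : D => dirDeriv f (l.map fun i => (1 / √6) • ψ i x) (V ψ x (toU s))) =
      fun x : D => iteratedFDeriv ℝ l.length f (V ψ x (toU s))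
        (fun k => (1 / √6) • ψ (l.get k) x) := by
    funext x
    rw [dirDeriv_eq_iteratedFDeriv hO hf _ (hmem x)]
    have : ∀ (l' : List X) (n : ℕ) (hn : n = l'.length) (v : Fin n → X)
        (_ : ∀ k, v k = l'.get (Fin.cast hn k)),
        iteratedFDeriv ℝ l'.length f (V ψ x (toU s)) l'.get =
          iteratedFDeriv ℝ n f (V ψ x (toU s)) v := by
      rintro l' n rfl v hv
      congr 1
      funext k
      exact (hv k).symm
    refine this _ _ (by simp) _ fun k => ?_
    simp
  rw [heq]
  have h1 : Continuous fun x : D => iteratedFDeriv ℝ l.length f (V ψ x (toU s)) :=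
    ContinuousOn.comp_continuous (hf.iteratedFDeriv l.length).continuousOn hV hmem
  have h2 : Continuous fun (x : D) (k : Fin l.length) => (1 / √6) • ψ (l.get k) x :=
    continuous_pi fun k => (hψ _).fun_const_smul _
  exact h1.eval h2

/-- Along each coordinate `s_j`, the point `V(x, s)` moves on a line with direction
`6^{-1/2} ψ_j(x)`, so that partial derivatives in `s` are directional derivatives of `f`. -/
lemma hasMajorant_pullbackField (H : IsAdmissible D ψ σ)
    (hf : AnalyticOnNhd ℝ f (holdAll D ψ)) (hb : HasDirBounds (holdAll D ψ) f Cf r)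
    (hCf : 0 ≤ Cf) (hr : 0 ≤ r) :
    HasMajorant (b D ψ) (pullbackField H hf hb) (fun k => Cf * r ^ k) := by
  have hO := H.isOpen_holdAll
  refine hasMajorant_of_pointwise b_nonneg (fun k => by positivity) _
    (fun M s x => dirDeriv f (M.toList.map fun i => (1 / √6) • ψ i x) (V ψ x (toU s)))
    (fun s _ x => by simp [dirDeriv]; rfl)
    (fun M s _ => continuousOn_dirDeriv_V H hf M.toList s) (fun x M j s hs => ?_)
    (fun M s _ x => ?_)
  · set p : ℕ → X := fun i => (1 / √6) • ψ i (x : X) with hp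
    set l := M.toList.map p with hl
    have hmem : V ψ (x : X) (toU s) ∈ holdAll D ψ := V_mem_holdAll x.2 (toU_mem s)
    have hline : ∀ t ∈ Icc (-1 : ℝ) 1, V ψ (x : X) (toU (Function.update s j t)) =
        V ψ (x : X) (toU s) + (t - s j) • p j := by
      intro t ht
      have hsum := fun {s : ℕ → ℝ} (hs : s ∈ cube) => summable_smul_psi H.isOpen H.a1 H.a4 hs x.2
      rw [V_eq, V_eq, toCube_toU hs, toCube_toU (update_mem_cube hs j ht), add_assoc, add_right_inj,
        (hsum (update_mem_cube hs j ht)).tsum_eq_add_tsum_ite j, (hsum hs).tsum_eq_add_tsum_ite j]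
      have : ∀ i, (if i = j then 0 else (Function.update s j t) i • (1 / √6) • ψ i (x : X)) =
          if i = j then 0 else s i • (1 / √6) • ψ i (x : X) := by
        intro i; by_cases hi : i = j <;> simp [hi]
      simp only [this, Function.update_self, sub_smul, hp]
      abel
    have hd : HasFDerivAt (dirDeriv f l) (fderiv ℝ (dirDeriv f l) (V ψ (x : X) (toU s)))
        (V ψ (x : X) (toU s) + (s j - s j) • p j) := by
      rw [sub_self, zero_smul, add_zero]
      exact (analyticOnNhd_dirDeriv hf l _ hmem).differentiableAt.hasFDerivAt
    have hg : HasDerivWithinAt (fun t : ℝ => V ψ (x : X) (toU s) + (t - s j) • p j) (p j)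
        (Icc (-1) 1) (s j) := by
      have h1 : HasDerivWithinAt (fun t : ℝ => t - s j) 1 (Icc (-1) 1) (s j) :=
        (hasDerivWithinAt_id _ _).sub_const _
      simpa using (h1.smul_const (p j)).const_add (V ψ (x : X) (toU s))
    have hcomp := hd.comp_hasDerivWithinAt (s j) hg
    have hval : fderiv ℝ (dirDeriv f l) (V ψ (x : X) (toU s)) (p j) =
        dirDeriv f ((j ::ₘ M).toList.map p) (V ψ (x : X) (toU s)) := by
      have hperm : (j :: M.toList).Perm (j ::ₘ M).toList := by
        rw [← Multiset.coe_eq_coe, ← Multiset.cons_coe, Multiset.coe_toList, Multiset.coe_toList]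
      exact dirDeriv_perm hO hf (hperm.map p) _ hmem
    rw [hval] at hcomp
    exact hcomp.congr (fun t ht => by simp [hline t ht, hl]) (by simp [hl])
  · have h := hb (M.toList.map fun i => (1 / √6) • ψ i (x : X)) _
      (V_mem_holdAll x.2 (toU_mem s))
    rw [Real.norm_eq_abs]
    refine h.trans ?_
    simp only [List.length_map, Multiset.length_toList, List.map_map]
    have hle : (M.toList.map ((fun v : X => ‖v‖) ∘ fun i => (1 / √6) • ψ i (x : X))).prod ≤
        (M.map (b D ψ)).prod := by
      rw [← Multiset.prod_coe, ← Multiset.map_coe, Multiset.coe_toList]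
      exact Multiset.prod_map_le_prod_map₀ _ _ (fun i _ => norm_nonneg _) fun i _ =>
        norm_psi_le H.isOpen H.a1 H.a4 i x.2
    gcongr

/-- The right-hand side `f_ref(·, s)`. -/
def rhsField (H : IsAdmissible D ψ σ) (hf : AnalyticOnNhd ℝ f (holdAll D ψ))
    (hb : HasDirBounds (holdAll D ψ) f Cf r) (s : ℕ → ℝ) : BoundedContinuousFunction D ℝ :=
  pullbackField H hf hb s * detField H s

lemma rhsField_apply (H : IsAdmissible D ψ σ) (hf : AnalyticOnNhd ℝ f (holdAll D ψ))
    (hb : HasDirBounds (holdAll D ψ) f Cf r) {s : ℕ → ℝ} (hs : s ∈ cube) (x : D) :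
    rhsField H hf hb s x = fRef ψ f x (toU s) := by
  rw [rhsField, mul_apply, detField_apply H hs, fRef]
  rfl

lemma hasMajorant_rhsField (H : IsAdmissible D ψ σ)
    (hf : AnalyticOnNhd ℝ f (holdAll D ψ)) (hb : HasDirBounds (holdAll D ψ) f Cf r)
    (hCf : 0 ≤ Cf) (hr : 0 ≤ r) :
    HasMajorant (b D ψ) (rhsField H hf hb)
      (fun k => Cf * ((Module.finrank ℝ X).factorial * (1 + ξ D ψ) ^ Module.finrank ℝ X) *
        (r + Module.finrank ℝ X) ^ k) :=
  (hasMajorant_pullbackField H hf hb hCf hr).mul_geometric b_nonneg hr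
    (Nat.cast_nonneg _) (hasMajorant_detField H)

end RightHandSide

end BoundedCoefficients

/-! ### The Poincaré inequality -/

section Poincare

variable {X : Type*} [NormedAddCommGroup X] [InnerProductSpace ℝ X] [FiniteDimensional ℝ X]

lemma enorm_gradient (φ : X → ℝ) (x : X) : ‖gradient φ x‖ₑ = ‖fderiv ℝ φ x‖ₑ := by
  rw [gradient, LinearIsometryEquiv.enorm_map]

variable [MeasurableSpace X] [BorelSpace X] {D : Set X}

/-- In dimension `n ≥ 2` the Gagliardo–Nirenberg–Sobolev inequality with the exponent
`p = 2n / (n + 2) ≤ 2`, whose Sobolev conjugate is `2`, and Hölder's inequality on `D`. -/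
lemma exists_eLpNorm_le_eLpNorm_gradient (hn : 2 ≤ Module.finrank ℝ X)
    (hbd : Bornology.IsBounded D) :
    ∃ C : ℝ≥0, ∀ φ : X → ℝ, ContDiff ℝ 1 φ → tsupport φ ⊆ D →
      eLpNorm φ 2 (volume.restrict D) ≤ C * eLpNorm (gradient φ) 2 (volume.restrict D) := by
  set n : ℕ := Module.finrank ℝ X with hn_def
  have hn0 : (0 : ℝ≥0) < n := by exact_mod_cast (by omega : 0 < n)
  have hn2 : (2 : ℝ≥0) ≤ n := by exact_mod_cast hn
  set p : ℝ≥0 := 2 * n / (n + 2) with hp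
  have hp1 : 1 ≤ p := by
    rw [hp, le_div_iff₀ (by positivity), one_mul]
    calc (n : ℝ≥0) + 2 ≤ n + n := by gcongr
      _ = 2 * n := (two_mul _).symm
  have hp2 : p ≤ 2 := by
    rw [hp, div_le_iff₀ (by positivity)]
    gcongr
    exact le_self_add
  have hpn : p < n := by
    rw [hp, div_lt_iff₀ (by positivity), mul_comm (2 : ℝ≥0)]
    gcongr
    exact lt_add_of_pos_left _ hn0
  have hpq : (p : ℝ)⁻¹ - (n : ℝ)⁻¹ ≤ ((2 : ℝ≥0) : ℝ)⁻¹ := by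
    have : (0 : ℝ) < n := by exact_mod_cast hn0
    rw [hp]
    push_cast
    field_simp
    linarith
  have hvol : volume.restrict D univ < ⊤ := by
    rw [Measure.restrict_apply_univ]
    exact hbd.measure_lt_top
  refine ⟨eLpNormLESNormFDerivOfLeConst ℝ (volume : Measure X) D p 2 *
    ((volume.restrict D univ) ^ (1 / (p : ℝ≥0∞).toReal - 1 / (2 : ℝ≥0∞).toReal)).toNNReal,
      fun φ hφ hsupp => ?_⟩
  have h1 := eLpNorm_le_eLpNorm_fderiv_of_le (volume : Measure X) hφ
    ((subset_tsupport φ).trans hsupp) hp1 hpn hpq hbd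
  have hgrad : eLpNorm (fderiv ℝ φ) p volume = eLpNorm (gradient φ) p volume :=
    eLpNorm_congr_enorm_ae (Eventually.of_forall fun x => (enorm_gradient φ x).symm)
  have hsupp' : Function.support (gradient φ) ⊆ D := by
    refine Subset.trans (fun x hx => support_fderiv_subset ℝ (fun h => hx ?_)) hsupp
    rw [gradient, h, map_zero]
  have hmeas : AEStronglyMeasurable (gradient φ) (volume.restrict D) :=
    ((InnerProductSpace.toDual ℝ X).symm.continuous.comp
      (hφ.continuous_fderiv one_ne_zero)).aestronglyMeasurable
  rw [hgrad, ← eLpNorm_restrict_eq_of_support_subset hsupp'] at h1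
  have h2 := eLpNorm_le_eLpNorm_mul_rpow_measure_univ (p := (p : ℝ≥0∞)) (q := 2)
    (by exact_mod_cast hp2) hmeas
  have hexp : 0 ≤ 1 / (p : ℝ≥0∞).toReal - 1 / (2 : ℝ≥0∞).toReal := by
    have : (0 : ℝ) < p := by exact_mod_cast zero_lt_one.trans_le hp1
    have h2' : (p : ℝ) ≤ 2 := by exact_mod_cast hp2
    simp only [ENNReal.coe_toReal, ENNReal.toReal_ofNat, sub_nonneg]
    gcongr
  have hfin : (volume.restrict D univ) ^ (1 / (p : ℝ≥0∞).toReal - 1 / (2 : ℝ≥0∞).toReal) ≠ ⊤ :=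
    (ENNReal.rpow_lt_top_of_nonneg hexp hvol.ne).ne
  rw [ENNReal.coe_mul, ENNReal.coe_toNNReal hfin, mul_assoc, mul_comm (_ ^ _)]
  calc eLpNorm φ 2 (volume.restrict D)
      ≤ eLpNorm φ 2 volume := eLpNorm_mono_measure _ Measure.restrict_le_self
    _ ≤ _ := h1
    _ ≤ _ := by gcongr

/-- The smooth generators of `H01 D` form a subspace, so that no linear combinations have to be
taken. -/
lemma exists_smooth_of_mem_span {w : L2Pair D}
    (hw : w ∈ Submodule.span ℝ {w : L2Pair D | ∃ φ : X → ℝ,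
      ContDiff ℝ ∞ φ ∧ HasCompactSupport φ ∧ tsupport φ ⊆ D ∧
        w.fst =ᵐ[volume.restrict D] φ ∧ w.snd =ᵐ[volume.restrict D] gradient φ}) :
    ∃ φ : X → ℝ, ContDiff ℝ ∞ φ ∧ tsupport φ ⊆ D ∧
      w.fst =ᵐ[volume.restrict D] φ ∧ w.snd =ᵐ[volume.restrict D] gradient φ := by
  induction hw using Submodule.span_induction with
  | mem w hw =>
    obtain ⟨φ, h1, -, h2, h3, h4⟩ := hw
    exact ⟨φ, h1, h2, h3, h4⟩
  | zero =>
    refine ⟨0, contDiff_const, by simp, Lp.coeFn_zero _ _ _, ?_⟩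
    refine (Lp.coeFn_zero _ _ _).trans (Eventually.of_forall fun x => ?_)
    simp [gradient]
  | add w w' _ _ h h' =>
    obtain ⟨φ, h1, h2, h3, h4⟩ := h
    obtain ⟨φ', h1', h2', h3', h4'⟩ := h'
    refine ⟨φ + φ', h1.add h1', (tsupport_add φ φ').trans (union_subset h2 h2'), ?_, ?_⟩
    · filter_upwards [Lp.coeFn_add w.fst w'.fst, h3, h3'] with x e1 e2 e3
      rw [WithLp.add_fst, e1, Pi.add_apply, e2, e3, Pi.add_apply]
    · filter_upwards [Lp.coeFn_add w.snd w'.snd, h4, h4'] with x e1 e2 e3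
      rw [WithLp.add_snd, e1, Pi.add_apply, e2, e3, gradient, gradient, gradient,
        fderiv_add (h1.differentiable (by simp) x) (h1'.differentiable (by simp) x), map_add]
  | smul c w _ h =>
    obtain ⟨φ, h1, h2, h3, h4⟩ := h
    refine ⟨c • φ, contDiff_const.smul h1, (closure_mono
      (Function.support_const_smul_subset c φ)).trans h2, ?_, ?_⟩
    · filter_upwards [Lp.coeFn_smul c w.fst, h3] with x e1 e2
      rw [WithLp.smul_fst, e1, Pi.smul_apply, e2, Pi.smul_apply]
    · filter_upwards [Lp.coeFn_smul c w.snd, h4] with x e1 e2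
      rw [WithLp.smul_snd, e1, Pi.smul_apply, e2, gradient, gradient,
        fderiv_const_smul (h1.differentiable (by simp) x), map_smul]

lemma exists_norm_fn_le (hn : 2 ≤ Module.finrank ℝ X) (hbd : Bornology.IsBounded D) :
    ∃ C : ℝ, 0 ≤ C ∧ ∀ v : H01 D, ‖fn v‖ ≤ C * h01Norm v := by
  obtain ⟨C, hC⟩ := exists_eLpNorm_le_eLpNorm_gradient hn hbd
  refine ⟨C, C.2, fun v => ?_⟩
  have hclosed : IsClosed {w : L2Pair D | ‖w.fst‖ ≤ C * ‖w.snd‖} :=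
    isClosed_le (WithLp.fstL 2 ℝ _ _).continuous.norm
      (continuous_const.mul (WithLp.sndL 2 ℝ _ _).continuous.norm)
  refine closure_minimal (fun w hw => ?_) hclosed v.2
  obtain ⟨φ, h1, h2, h3, h4⟩ := exists_smooth_of_mem_span hw
  have := hC φ (h1.of_le (by simp)) h2
  rw [← eLpNorm_congr_ae h3, ← eLpNorm_congr_ae h4] at this
  simp only [mem_ofPred_eq, Lp.norm_def]
  rw [← ENNReal.coe_toReal, ← ENNReal.toReal_mul]
  exact ENNReal.toReal_mono (ENNReal.mul_ne_top ENNReal.coe_ne_top (Lp.eLpNorm_ne_top _)) this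

lemma poincareConst_nonneg (D : Set X) : 0 ≤ poincareConst D := Real.sInf_nonneg fun _ h => h.1

/-- The infimum that defines the Poincaré constant is attained. -/
lemma norm_fn_le (hn : 2 ≤ Module.finrank ℝ X) (hbd : Bornology.IsBounded D) (v : H01 D) :
    ‖fn v‖ ≤ poincareConst D * h01Norm v := by
  obtain ⟨C, hC, h⟩ := exists_norm_fn_le hn hbd
  rcases (norm_nonneg (grad v)).eq_or_lt with h0 | h0
  · have := h v
    rwa [h01Norm, ← h0, mul_zero] at this ⊢
  · rw [h01Norm, ← div_le_iff₀ h0]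
    refine le_csInf ⟨C, hC, h⟩ fun C' hC' => ?_
    rw [div_le_iff₀ h0]
    exact hC'.2 v

end Poincare

/-! ### The space of gradients -/

section GradientSpace

variable {X : Type*} [NormedAddCommGroup X] [InnerProductSpace ℝ X] [FiniteDimensional ℝ X]
  [MeasurableSpace X] [BorelSpace X] {D : Set X}

/-- The function part of an element of `H01 D`, as a linear map. -/
def fnL (D : Set X) : H01 D →L[ℝ] Lp ℝ 2 (volume.restrict D) :=
  (WithLp.fstL 2 ℝ _ _).comp (H01 D).subtypeL

/-- The weak gradient, as a linear map. -/
def gradL (D : Set X) : H01 D →L[ℝ] Lp X 2 (volume.restrict D) :=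
  (WithLp.sndL 2 ℝ _ _).comp (H01 D).subtypeL

/-- The space of weak gradients of functions in `H_0^1(D)`, with the norm of `L²(D)`: by
Poincaré's inequality this is `H_0^1(D)` with the norm `h01Norm`. It is a synonym of the range of
`gradL D`, so that spaces of operators on it have one structure. -/
def GradSpace (D : Set X) : Type _ := (gradL D).range

instance : NormedAddCommGroup (GradSpace D) :=
  inferInstanceAs (NormedAddCommGroup (gradL D).range)

instance : InnerProductSpace ℝ (GradSpace D) :=
  inferInstanceAs (InnerProductSpace ℝ (gradL D).range)

/-- The inclusion of the gradients into the square integrable vector fields. -/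
def gradField (D : Set X) : GradSpace D →ₗᵢ[ℝ] Lp X 2 (volume.restrict D) :=
  (gradL D).range.subtypeₗᵢ

/-- The gradient as an element of the space of gradients. -/
def toGrad (v : H01 D) : GradSpace D := (⟨grad v, v, rfl⟩ : (gradL D).range)

lemma gradField_toGrad (v : H01 D) : gradField D (toGrad v) = grad v := rfl

lemma toGrad_surjective : Function.Surjective (toGrad (D := D)) := by
  rintro ⟨_, v, rfl⟩
  exact ⟨v, rfl⟩

instance : CompleteSpace (H01 D) := by
  rw [H01]
  infer_instance

lemma antilipschitz_gradL (hn : 2 ≤ Module.finrank ℝ X) (hbd : Bornology.IsBounded D) :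
    ∃ K : ℝ≥0, AntilipschitzWith K (gradL D) := by
  refine ⟨⟨poincareConst D + 1, by linarith [poincareConst_nonneg D]⟩,
    (gradL D).antilipschitz_of_bound fun v => ?_⟩
  have h1 : ‖v‖ ^ 2 = ‖fn v‖ ^ 2 + ‖grad v‖ ^ 2 := WithLp.prod_norm_sq_eq_of_L2 v.1
  have h2 := norm_fn_le hn hbd v
  have h3 := poincareConst_nonneg D
  rw [h01Norm] at h2
  have h4 : 0 ≤ poincareConst D * ‖grad v‖ := mul_nonneg h3 (norm_nonneg _)
  have h5 : ‖v‖ ≤ ‖fn v‖ + ‖grad v‖ := by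
    refine le_of_sq_le_sq ?_ (by positivity)
    nlinarith [norm_nonneg (fn v), norm_nonneg (grad v)]
  calc ‖v‖ ≤ ‖fn v‖ + ‖grad v‖ := h5
    _ ≤ (poincareConst D + 1) * ‖grad v‖ := by linarith

lemma isClosed_range_gradL (hn : 2 ≤ Module.finrank ℝ X) (hbd : Bornology.IsBounded D) :
    IsClosed (range (gradL D)) := by
  obtain ⟨K, hK⟩ := antilipschitz_gradL hn hbd
  exact hK.isClosed_range (gradL D).uniformContinuous

lemma completeSpace_gradSpace (hn : 2 ≤ Module.finrank ℝ X) (hbd : Bornology.IsBounded D) :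
    CompleteSpace (GradSpace D) :=
  (isClosed_range_gradL hn hbd).completeSpace_coe

/-- The element of `H01 D` with a given gradient. -/
def ofGrad (hn : 2 ≤ Module.finrank ℝ X) (hbd : Bornology.IsBounded D) :
    GradSpace D ≃L[ℝ] H01 D :=
  ((gradL D).equivRange (antilipschitz_gradL hn hbd).choose_spec.injective
    (isClosed_range_gradL hn hbd)).symm

lemma toGrad_ofGrad (hn : 2 ≤ Module.finrank ℝ X) (hbd : Bornology.IsBounded D)
    (g : GradSpace D) : toGrad (ofGrad hn hbd g) = g :=
  ((gradL D).equivRange (antilipschitz_gradL hn hbd).choose_spec.injective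
    (isClosed_range_gradL hn hbd)).apply_symm_apply g

lemma ofGrad_toGrad (hn : 2 ≤ Module.finrank ℝ X) (hbd : Bornology.IsBounded D) (v : H01 D) :
    ofGrad hn hbd (toGrad v) = v :=
  ((gradL D).equivRange (antilipschitz_gradL hn hbd).choose_spec.injective
    (isClosed_range_gradL hn hbd)).symm_apply_apply v

lemma h01Norm_ofGrad (hn : 2 ≤ Module.finrank ℝ X) (hbd : Bornology.IsBounded D)
    (g : GradSpace D) : h01Norm (ofGrad hn hbd g) = ‖g‖ := by
  conv_rhs => rw [← toGrad_ofGrad hn hbd g]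
  rfl

end GradientSpace

/-! ### Bounded continuous fields as elements of Lebesgue spaces -/

section Extension

variable {X : Type*} [MeasurableSpace X] [TopologicalSpace X] [BorelSpace X] {D : Set X}
  {F : Type*} [NormedAddCommGroup F]

lemma memLp_extend [SecondCountableTopology F] (hD : MeasurableSet D) {μ : Measure X}
    (hμ : μ D ≠ ⊤) (p : ℝ≥0∞) (a : BoundedContinuousFunction D F) :
    MemLp (Function.extend Subtype.val a 0) p (μ.restrict D) := by
  have : IsFiniteMeasure (μ.restrict D) := ⟨by rw [Measure.restrict_apply_univ]; exact hμ.lt_top⟩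
  have hc : ContinuousOn (Function.extend Subtype.val a 0) D := by
    rw [continuousOn_iff_continuous_domRestrict]
    convert a.continuous using 1
    funext x
    exact Subtype.val_injective.extend_apply _ _ x
  refine MemLp.of_bound (hc.aestronglyMeasurable hD) ‖a‖ ?_
  filter_upwards [ae_restrict_mem hD] with x hx
  rw [Subtype.val_injective.extend_apply a 0 ⟨x, hx⟩]
  exact a.norm_coe_le_norm _

variable [NormedSpace ℝ F] [SecondCountableTopology F] {μ : Measure X}

/-- Extension by zero of a bounded continuous function on `D`, as an element of `L^p(D)`. -/
def extendLp (hD : MeasurableSet D) (hμ : μ D ≠ ⊤) (p : ℝ≥0∞) [Fact (1 ≤ p)] :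
    BoundedContinuousFunction D F →L[ℝ] Lp F p (μ.restrict D) :=
  LinearMap.mkContinuous
    { toFun := fun a => (memLp_extend hD hμ p a).toLp _
      map_add' := fun a a' => by
        rw [← MemLp.toLp_add]
        refine MemLp.toLp_congr _ _ ?_
        filter_upwards [ae_restrict_mem hD] with x hx
        rw [Pi.add_apply]
        have h := fun a : D → F => Subtype.val_injective.extend_apply a 0 (⟨x, hx⟩ : D)
        simp only at h
        rw [h, h, h, BoundedContinuousFunction.add_apply]
      map_smul' := fun c a => by
        rw [RingHom.id_apply, ← MemLp.toLp_const_smul]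
        refine MemLp.toLp_congr _ _ ?_
        filter_upwards [ae_restrict_mem hD] with x hx
        have h := fun a : D → F => Subtype.val_injective.extend_apply a 0 (⟨x, hx⟩ : D)
        simp only at h
        rw [Pi.smul_apply, h, h]
        rfl }
    (μ.real D ^ p.toReal⁻¹) fun a => by
      have h := eLpNorm_le_of_ae_bound (p := p) (μ := μ.restrict D) (C := ‖a‖)
        (f := Function.extend Subtype.val a 0) (by
          filter_upwards [ae_restrict_mem hD] with x hx
          rw [Subtype.val_injective.extend_apply a 0 ⟨x, hx⟩]
          exact a.norm_coe_le_norm _)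
      rw [Measure.restrict_apply_univ] at h
      have h' := ENNReal.toReal_mono (ENNReal.mul_ne_top
        (ENNReal.rpow_ne_top_of_nonneg (inv_nonneg.2 ENNReal.toReal_nonneg) hμ)
          ENNReal.ofReal_ne_top) h
      rw [ENNReal.toReal_mul, ENNReal.toReal_ofReal (norm_nonneg _), ← ENNReal.toReal_rpow] at h'
      rw [LinearMap.coe_mk, AddHom.coe_mk, Lp.norm_toLp]
      exact h'

lemma coeFn_extendLp (hD : MeasurableSet D) (hμ : μ D ≠ ⊤) (p : ℝ≥0∞) [Fact (1 ≤ p)]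
    (a : BoundedContinuousFunction D F) :
    ∀ᵐ x ∂μ.restrict D, ∀ hx : x ∈ D, extendLp hD hμ p a x = a ⟨x, hx⟩ := by
  filter_upwards [(memLp_extend hD hμ p a).coeFn_toLp] with x hx hxD
  exact hx.trans (Subtype.val_injective.extend_apply a 0 (⟨x, hxD⟩ : D))

lemma norm_extendLp_le (hD : MeasurableSet D) (hμ : μ D ≠ ⊤) (p : ℝ≥0∞) [Fact (1 ≤ p)]
    (a : BoundedContinuousFunction D F) :
    ‖extendLp hD hμ p a‖ ≤ μ.real D ^ p.toReal⁻¹ * ‖a‖ :=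
  ContinuousLinearMap.le_of_opNorm_le _ (LinearMap.mkContinuous_norm_le _ (by positivity) _) a

end Extension

section Multiplication

variable {X : Type*} [NormedAddCommGroup X] [InnerProductSpace ℝ X]

variable (X) in
/-- Application of a matrix to a vector. -/
def applyL : MatrixAlg X →L[ℝ] X →L[ℝ] X := ((opEquiv X).symm : MatrixAlg X →L[ℝ] (X →L[ℝ] X))

lemma norm_applyL_le : ‖applyL X‖ ≤ 1 :=
  ContinuousLinearMap.opNorm_le_bound _ zero_le_one fun T => (one_mul ‖T‖).ge

variable [FiniteDimensional ℝ X]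

instance : SecondCountableTopology (MatrixAlg X) :=
  have : ProperSpace (X →L[ℝ] X) := FiniteDimensional.proper ℝ _
  inferInstanceAs (SecondCountableTopology (X →L[ℝ] X))

variable [MeasurableSpace X] [BorelSpace X] {D : Set X}

/-- Multiplication of square integrable vector fields by a bounded matrix field. -/
def mulFieldL (hD : MeasurableSet D) (hvol : volume D ≠ ⊤) :
    BoundedContinuousFunction D (MatrixAlg X) →L[ℝ]
      Lp X 2 (volume.restrict D) →L[ℝ] Lp X 2 (volume.restrict D) :=
  LinearMap.mkContinuous₂ (LinearMap.mk₂ ℝ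
      (fun a g => (applyL X).holder 2 (extendLp hD hvol ∞ a) g)
      (fun a a' g => by rw [map_add, ContinuousLinearMap.holder_add_left])
      (fun c a g => by rw [map_smul, ContinuousLinearMap.holder_smul_left])
      (fun a g g' => by rw [ContinuousLinearMap.holder_add_right])
      (fun c a g => by rw [ContinuousLinearMap.holder_smul_right])) 1 fun a g => by
    have h1 := norm_extendLp_le hD hvol ∞ a
    rw [ENNReal.toReal_top, inv_zero, Real.rpow_zero, one_mul] at h1
    refine ((applyL X).norm_holder_apply_apply_le (r := 2) (extendLp hD hvol ∞ a) g).trans ?_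
    gcongr
    exact norm_applyL_le

lemma norm_mulFieldL_le (hD : MeasurableSet D) (hvol : volume D ≠ ⊤)
    (a : BoundedContinuousFunction D (MatrixAlg X)) : ‖mulFieldL hD hvol a‖ ≤ ‖a‖ :=
  (ContinuousLinearMap.le_of_opNorm_le _
    (LinearMap.mkContinuous₂_norm_le _ zero_le_one _) a).trans_eq (one_mul _)

lemma coeFn_mulFieldL (hD : MeasurableSet D) (hvol : volume D ≠ ⊤)
    (a : BoundedContinuousFunction D (MatrixAlg X)) (g : Lp X 2 (volume.restrict D)) :
    ∀ᵐ x ∂volume.restrict D, ∀ hx : x ∈ D,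
      mulFieldL hD hvol a g x = applyL X (a ⟨x, hx⟩) (g x) := by
  filter_upwards [(applyL X).coeFn_holder (r := 2) (extendLp hD hvol ∞ a) g,
    coeFn_extendLp hD hvol ∞ a] with x h1 h2 hx
  rw [← h2 hx]
  exact h1

end Multiplication

/-! ### The variational problem as an operator equation -/

section Compression

variable {G H : Type*} [NormedAddCommGroup G] [InnerProductSpace ℝ G] [CompleteSpace G]
  [NormedAddCommGroup H] [InnerProductSpace ℝ H] [CompleteSpace H] (i : G →ₗᵢ[ℝ] H)

/-- The compression of an operator to an isometrically embedded Hilbert space. -/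
def compressL : (H →L[ℝ] H) →L[ℝ] (G →L[ℝ] G) :=
  LinearMap.mkContinuous
    { toFun := fun T : H →L[ℝ] H =>
        (ContinuousLinearMap.adjoint i.toContinuousLinearMap).comp (T.comp i.toContinuousLinearMap)
      map_add' := fun S T => by ext g; simp
      map_smul' := fun c T => by ext g; simp } 1 fun T => by
    rw [one_mul]
    refine ContinuousLinearMap.opNorm_le_bound _ (norm_nonneg _) fun g => ?_
    have h1 : ‖ContinuousLinearMap.adjoint i.toContinuousLinearMap‖ ≤ 1 := by
      rw [LinearIsometryEquiv.norm_map]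
      exact i.norm_toContinuousLinearMap_le
    calc _ ≤ ‖ContinuousLinearMap.adjoint i.toContinuousLinearMap‖ * ‖T (i g)‖ :=
          ContinuousLinearMap.le_opNorm _ _
      _ ≤ 1 * (‖T‖ * ‖i g‖) := by
          gcongr
          exact T.le_opNorm _
      _ = ‖T‖ * ‖g‖ := by rw [one_mul, i.norm_map]

lemma norm_compressL_le (T : H →L[ℝ] H) : ‖compressL i T‖ ≤ ‖T‖ :=
  ((compressL i).le_of_opNorm_le
    (LinearMap.mkContinuous_norm_le _ zero_le_one _) T).trans_eq (one_mul _)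

lemma compressL_apply (T : H →L[ℝ] H) (g : G) :
    compressL i T g = ContinuousLinearMap.adjoint i.toContinuousLinearMap (T (i g)) := rfl

lemma inner_compressL (T : H →L[ℝ] H) (g g' : G) : ⟪compressL i T g, g'⟫_ℝ = ⟪T (i g), i g'⟫_ℝ := by
  rw [compressL_apply, ContinuousLinearMap.adjoint_inner_left]
  rfl

end Compression

/-- A quantitative form of the Lax–Milgram theorem. -/
lemma isUnit_of_coercive {G : Type*} [NormedAddCommGroup G] [InnerProductSpace ℝ G]
    [CompleteSpace G] (T : G →L[ℝ] G) {α : ℝ} (hα : 0 < α)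
    (h : ∀ g, α * ‖g‖ ^ 2 ≤ ⟪T g, g⟫_ℝ) : IsUnit T ∧ ‖Ring.inverse T‖ ≤ α⁻¹ := by
  have hco : IsCoercive ((innerSL ℝ).comp T : G →L[ℝ] G →L[ℝ] ℝ) :=
    ⟨α, hα, fun g => by simpa [pow_two, mul_assoc] using h g⟩
  set e := hco.continuousLinearEquivOfBilin
  have he : ∀ g, e g = T g := fun g =>
    (hco.unique_continuousLinearEquivOfBilin fun w => by simp).symm
  have hu : IsUnit T := by
    refine ⟨⟨T, e.symm, ?_, ?_⟩, rfl⟩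
    · ext1 g; simp [← he]
    · ext1 g; simp [← he]
  refine ⟨hu, ContinuousLinearMap.opNorm_le_bound _ (inv_nonneg.2 hα.le) fun g => ?_⟩
  have h2 : T (Ring.inverse T g) = g := by
    rw [← mul_apply_eq_comp, Ring.mul_inverse_cancel _ hu]; rfl
  have h3 := h (Ring.inverse T g)
  rw [h2] at h3
  have h4 := real_inner_le_norm g (Ring.inverse T g)
  rw [inv_mul_eq_div, le_div_iff₀ hα]
  by_contra! hlt
  have h5 : 0 < ‖Ring.inverse T g‖ := by
    by_contra h0
    have : ‖Ring.inverse T g‖ = 0 := le_antisymm (not_lt.1 h0) (norm_nonneg _)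
    rw [this, zero_mul] at hlt
    exact absurd hlt (not_lt.2 (norm_nonneg g))
  nlinarith

lemma A_congr {X : Type*} [NormedAddCommGroup X] [InnerProductSpace ℝ X] [FiniteDimensional ℝ X]
    {ψ : ℕ → X → X} {x : X} {y : ℕ → ℝ} : A ψ x (toU (toCube y)) = A ψ x y := by
  rw [A, A, B, B, J_congr (toCube_toU (toCube_mem y))]

section Variational

variable {X : Type*} [NormedAddCommGroup X] [InnerProductSpace ℝ X] [FiniteDimensional ℝ X]
  [MeasurableSpace X] [BorelSpace X] {D : Set X} {ψ : ℕ → X → X} {σ : ℝ} {f : X → ℝ} {Cf r : ℝ}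

lemma IsAdmissible.volume_ne_top (H : IsAdmissible D ψ σ) : volume D ≠ ⊤ :=
  H.isBounded.measure_lt_top.ne

/-- As `A = det J · J⁻¹ J⁻ᵀ`, the quadratic form of `A` at `v` is `det J |J⁻ᵀ v|²`. -/
lemma le_inner_A (H : IsAdmissible D ψ σ) {x : X} (hx : x ∈ D) {y : ℕ → ℝ} (hy : y ∈ U) (v : X) :
    σ ^ Module.finrank ℝ X / (1 + ξ D ψ) ^ 2 * ‖v‖ ^ 2 ≤ ⟪A ψ x y v, v⟫_ℝ := by
  have hξ : 0 ≤ ξ D ψ := xi_nonneg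
  set T := J ψ x y with hT
  have hu : IsUnit T := (isUnit_J H hx hy).1
  set w : X := star (Ring.inverse T) v with hw
  have hA : ⟪A ψ x y v, v⟫_ℝ = T.det * ‖w‖ ^ 2 := by
    rw [diffusion_eq H hx hy, smul_apply, inner_smul_left,
      mul_apply_eq_comp, ← hT, ← hw, ← real_inner_self_eq_norm_sq]
    congr 1
    rw [hw, ContinuousLinearMap.star_eq_adjoint, ← ContinuousLinearMap.adjoint_inner_right]
  have hv : star T w = v := by
    rw [hw, ← mul_apply_eq_comp, ← star_mul, Ring.inverse_mul_cancel _ hu, star_one]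
    rfl
  have hnorm : ‖v‖ ≤ (1 + ξ D ψ) * ‖w‖ := by
    rw [← hv]
    refine ((star T).le_opNorm w).trans ?_
    gcongr
    rw [ContinuousLinearMap.star_eq_adjoint, LinearIsometryEquiv.norm_map]
    exact norm_J_le H.isOpen H.a1 H.a4 hx y
  have hdet := H.pow_le_det x hx y hy
  have hsq : ‖v‖ ^ 2 ≤ (1 + ξ D ψ) ^ 2 * ‖w‖ ^ 2 := by
    rw [← mul_pow]
    gcongr
  rw [hA, div_mul_eq_mul_div, div_le_iff₀ (by positivity)]
  have h0 : 0 ≤ σ ^ Module.finrank ℝ X := pow_nonneg H.pos.le _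
  have h1 : 0 ≤ T.det := h0.trans hdet
  calc σ ^ Module.finrank ℝ X * ‖v‖ ^ 2
      ≤ T.det * ((1 + ξ D ψ) ^ 2 * ‖w‖ ^ 2) := by gcongr
    _ = _ := by ring

variable [CompleteSpace (GradSpace D)]

/-- The operator of the variational problem on the space of gradients. -/
def stiffness (H : IsAdmissible D ψ σ) (s : ℕ → ℝ) : GradSpace D →L[ℝ] GradSpace D :=
  compressL (gradField D) (mulFieldL H.isOpen.measurableSet H.volume_ne_top (diffusionField H s))

lemma inner_stiffness (H : IsAdmissible D ψ σ) {s : ℕ → ℝ} (hs : s ∈ cube) (g g' : GradSpace D) :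
    ⟪stiffness H s g, g'⟫_ℝ = ∫ x in D, ⟪A ψ x (toU s) (gradField D g x),
      gradField D g' x⟫_ℝ := by
  rw [stiffness, inner_compressL, L2.inner_def]
  refine integral_congr_ae ?_
  filter_upwards [coeFn_mulFieldL H.isOpen.measurableSet H.volume_ne_top (diffusionField H s)
    (gradField D g), ae_restrict_mem H.isOpen.measurableSet] with x h1 hx
  rw [h1 hx, diffusionField_apply H hs]
  rfl

/-- The pairing of `h` with the functions in `H_0^1(D)`, as an element of the space of
gradients. -/
def loadL (hn : 2 ≤ Module.finrank ℝ X) (H : IsAdmissible D ψ σ) :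
    BoundedContinuousFunction D ℝ →L[ℝ] GradSpace D :=
  (ContinuousLinearMap.adjoint
    ((fnL D).comp (ofGrad hn H.isBounded : GradSpace D →L[ℝ] H01 D))).comp
    (extendLp H.isOpen.measurableSet H.volume_ne_top 2)

lemma inner_loadL (hn : 2 ≤ Module.finrank ℝ X) (H : IsAdmissible D ψ σ)
    (h : BoundedContinuousFunction D ℝ) (v : H01 D) :
    ⟪loadL hn H h, toGrad v⟫_ℝ =
      ⟪extendLp (μ := volume) H.isOpen.measurableSet H.volume_ne_top 2 h, fn v⟫_ℝ := by
  rw [loadL, ContinuousLinearMap.comp_apply, ContinuousLinearMap.adjoint_inner_left,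
    ContinuousLinearMap.comp_apply, ContinuousLinearEquiv.coe_coe, ofGrad_toGrad]
  rfl

lemma norm_loadL_le (hn : 2 ≤ Module.finrank ℝ X) (H : IsAdmissible D ψ σ)
    (h : BoundedContinuousFunction D ℝ) :
    ‖loadL hn H h‖ ≤ poincareConst D * √(volume.real D) * ‖h‖ := by
  have hext := norm_extendLp_le (μ := volume) H.isOpen.measurableSet H.volume_ne_top 2 h
  have hsqrt : volume.real D ^ ((2 : ℝ≥0∞).toReal)⁻¹ = √(volume.real D) := by
    rw [Real.sqrt_eq_rpow, ENNReal.toReal_ofNat, one_div]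
  rw [hsqrt] at hext
  have hop : ‖(fnL D).comp (ofGrad hn H.isBounded : GradSpace D →L[ℝ] H01 D)‖ ≤
      poincareConst D := by
    refine ContinuousLinearMap.opNorm_le_bound _ (poincareConst_nonneg D) fun g => ?_
    have := norm_fn_le hn H.isBounded (ofGrad hn H.isBounded g)
    rwa [h01Norm_ofGrad] at this
  rw [loadL, ContinuousLinearMap.comp_apply, mul_assoc]
  refine (ContinuousLinearMap.le_opNorm _ _).trans ?_
  rw [LinearIsometryEquiv.norm_map]
  exact mul_le_mul hop hext (norm_nonneg _) (poincareConst_nonneg D)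

/-- The weak form of the transported problem as an operator equation in the space of gradients. -/
lemma isTransportedSolution_iff (hn : 2 ≤ Module.finrank ℝ X) (H : IsAdmissible D ψ σ)
    (hf : AnalyticOnNhd ℝ f (holdAll D ψ)) (hb : HasDirBounds (holdAll D ψ) f Cf r)
    {y : ℕ → ℝ} (u : H01 D) :
    IsTransportedSolution D ψ f y u ↔
      stiffness H (toCube y) (toGrad u) = loadL hn H (rhsField H hf hb (toCube y)) := by
  have hs : toCube y ∈ cube := toCube_mem y
  have hl : ∀ v : H01 D, ⟪stiffness H (toCube y) (toGrad u), toGrad v⟫_ℝ =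
      ∫ x in D, ⟪A ψ x y (grad u x), grad v x⟫_ℝ := by
    intro v
    rw [inner_stiffness H hs, gradField_toGrad, gradField_toGrad]
    simp only [A_congr]
  have hr : ∀ v : H01 D, ⟪loadL hn H (rhsField H hf hb (toCube y)), toGrad v⟫_ℝ =
      ∫ x in D, fRef ψ f x y * fn v x := by
    intro v
    rw [inner_loadL, L2.inner_def]
    refine integral_congr_ae ?_
    filter_upwards [coeFn_extendLp (μ := volume) H.isOpen.measurableSet H.volume_ne_top 2
      (rhsField H hf hb (toCube y)), ae_restrict_mem H.isOpen.measurableSet] with x h1 hx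
    rw [h1 hx, rhsField_apply H hf hb hs, fRef, fRef, V_congr (toCube_toU hs),
      J_congr (toCube_toU hs)]
    simp [mul_comm]
  constructor
  · intro h
    refine ext_inner_right ℝ fun g => ?_
    obtain ⟨v, rfl⟩ := toGrad_surjective g
    exact (hl v).trans ((h v).trans (hr v).symm)
  · intro h v
    rw [← hl, ← hr, h]

lemma isUnit_stiffness (H : IsAdmissible D ψ σ) {s : ℕ → ℝ} (hs : s ∈ cube) :
    IsUnit (stiffness H s) ∧
      ‖Ring.inverse (stiffness H s)‖ ≤ (1 + ξ D ψ) ^ 2 / σ ^ Module.finrank ℝ X := by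
  have hξ : 0 ≤ ξ D ψ := xi_nonneg
  have hσ := H.pos
  rw [← inv_div]
  refine isUnit_of_coercive _ (by positivity) fun g => ?_
  set α := σ ^ Module.finrank ℝ X / (1 + ξ D ψ) ^ 2
  have h1 : ‖g‖ ^ 2 = ⟪gradField D g, gradField D g⟫_ℝ :=
    by
    rw [real_inner_self_eq_norm_sq, LinearIsometry.norm_map]
  have hT : ⟪stiffness H s g, g⟫_ℝ = ⟪mulFieldL H.isOpen.measurableSet H.volume_ne_top
      (diffusionField H s) (gradField D g), gradField D g⟫_ℝ :=
    inner_compressL _ _ _ _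
  have hα : α * ⟪gradField D g, gradField D g⟫_ℝ =
      ⟪α • gradField D g, gradField D g⟫_ℝ :=
    (real_inner_smul_left _ _ _).symm
  rw [hT, h1, hα, L2.inner_def, L2.inner_def]
  refine integral_mono_ae (L2.integrable_inner _ _) (L2.integrable_inner _ _) ?_
  filter_upwards [coeFn_mulFieldL H.isOpen.measurableSet H.volume_ne_top (diffusionField H s)
    (gradField D g), ae_restrict_mem H.isOpen.measurableSet,
    Lp.coeFn_smul α (gradField D g)] with x h1 hx h2
  rw [h1 hx, diffusionField_apply H hs, h2, Pi.smul_apply, real_inner_smul_left,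
    real_inner_self_eq_norm_sq]
  exact le_inner_A H hx (toU_mem s) _

end Variational

/-! ### Derivatives of the solution with respect to the cube variables -/

/-- The recursive inequality behind the majorant of the solution: for a geometric ansatz the
convolution is summed by one step of induction. -/
lemma geometric_recursion {κ a F q p R : ℝ} (hκ : 0 ≤ κ) (ha : 0 ≤ a) (hF : 0 ≤ F) (hq : 0 ≤ q)
    (hp : 0 ≤ p) (hpR : p ≤ R) (hqR : q * (1 + 2 * (κ * a)) ≤ R) (k : ℕ) :
    κ * (F * p ^ k + ∑ l ∈ Finset.HasAntidiagonal.antidiagonal k,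
      (if l.1 = 0 then 0 else a * q ^ l.1) * (2 * (κ * F) * R ^ l.2)) ≤ 2 * (κ * F) * R ^ k := by
  have hR : 0 ≤ R := hp.trans hpR
  have key : ∀ k : ℕ, 2 * (κ * a) * ∑ l ∈ Finset.HasAntidiagonal.antidiagonal k,
      (if l.1 = 0 then 0 else q ^ l.1) * R ^ l.2 ≤ R ^ k := by
    intro k
    induction k with
    | zero => simp
    | succ k ih =>
      have hsum : ∑ l ∈ Finset.HasAntidiagonal.antidiagonal (k + 1),
          (if l.1 = 0 then 0 else q ^ l.1) * R ^ l.2 = q * (R ^ k +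
            ∑ l ∈ Finset.HasAntidiagonal.antidiagonal k,
              (if l.1 = 0 then 0 else q ^ l.1) * R ^ l.2) := by
        rw [Finset.Nat.sum_antidiagonal_succ]
        cases k with
        | zero => simp
        | succ k =>
          simp only [Finset.Nat.sum_antidiagonal_succ (n := k)]
          simp only [if_true, zero_mul, zero_add, Nat.add_eq_zero_iff, one_ne_zero, and_false,
            if_false, mul_add, Finset.mul_sum]
          congr 1
          · simp
          · exact Finset.sum_congr rfl fun l _ => by ring
      rw [hsum]
      have hκa : 0 ≤ κ * a := mul_nonneg hκ ha
      calc _ = q * (2 * (κ * a) * R ^ k + 2 * (κ * a) *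
            ∑ l ∈ Finset.HasAntidiagonal.antidiagonal k,
              (if l.1 = 0 then 0 else q ^ l.1) * R ^ l.2) := by ring
        _ ≤ q * (2 * (κ * a) * R ^ k + R ^ k) := by gcongr
        _ = q * (1 + 2 * (κ * a)) * R ^ k := by ring
        _ ≤ R * R ^ k := by gcongr
        _ = R ^ (k + 1) := (pow_succ' R k).symm
  have hsum : ∑ l ∈ Finset.HasAntidiagonal.antidiagonal k,
      (if l.1 = 0 then 0 else a * q ^ l.1) * (2 * (κ * F) * R ^ l.2) =
        (κ * F) * (2 * a * ∑ l ∈ Finset.HasAntidiagonal.antidiagonal k,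
          (if l.1 = 0 then 0 else q ^ l.1) * R ^ l.2) := by
    rw [Finset.mul_sum, Finset.mul_sum]
    refine Finset.sum_congr rfl fun l _ => ?_
    split_ifs <;> ring
  have hpk : p ^ k ≤ R ^ k := by gcongr
  have hκF : 0 ≤ κ * F := mul_nonneg hκ hF
  rw [hsum]
  nlinarith [mul_le_mul_of_nonneg_left (key k) hκF, mul_le_mul_of_nonneg_left hpk hκF]

section Solution

variable {X : Type*} [NormedAddCommGroup X] [InnerProductSpace ℝ X] [FiniteDimensional ℝ X]
  [MeasurableSpace X] [BorelSpace X] {D : Set X} {ψ : ℕ → X → X} {σ : ℝ} {f : X → ℝ} {Cf r : ℝ}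

lemma isTransportedSolution_congr {y y' : ℕ → ℝ} (h : toCube y = toCube y') (u : H01 D) :
    IsTransportedSolution D ψ f y u ↔ IsTransportedSolution D ψ f y' u := by
  simp only [IsTransportedSolution, A, B, fRef, J_congr h, V_congr h]

lemma existsUnique_isTransportedSolution (hn : 2 ≤ Module.finrank ℝ X) (H : IsAdmissible D ψ σ)
    (hf : AnalyticOnNhd ℝ f (holdAll D ψ)) (hb : HasDirBounds (holdAll D ψ) f Cf r)
    (y : ℕ → ℝ) : ∃! u : H01 D, IsTransportedSolution D ψ f y u := by
  have := completeSpace_gradSpace hn H.isBounded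
  have hT := (isUnit_stiffness H (toCube_mem y)).1
  set T := stiffness H (toCube y) with hT_def
  set F := loadL hn H (rhsField H hf hb (toCube y)) with hF
  refine ⟨ofGrad hn H.isBounded (Ring.inverse T F), ?_, fun v hv => ?_⟩
  · refine (isTransportedSolution_iff hn H hf hb _).2 ?_
    rw [← hT_def, ← hF]
    rw [toGrad_ofGrad, ← mul_apply_eq_comp, Ring.mul_inverse_cancel _ hT]
    rfl
  · have hv' := (isTransportedSolution_iff hn H hf hb v).1 hv
    rw [← hT_def, ← hF] at hv'
    rw [← hv', ← mul_apply_eq_comp, Ring.inverse_mul_cancel _ hT]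
    exact (ofGrad_toGrad _ _ v).symm

/-- The gradient of the solution as a function on the cube. -/
lemma hasMajorant_grad_solution (hn : 2 ≤ Module.finrank ℝ X) (H : IsAdmissible D ψ σ)
    (hf : AnalyticOnNhd ℝ f (holdAll D ψ)) (hb : HasDirBounds (holdAll D ψ) f Cf r)
    (hCf : 0 ≤ Cf) (hr : 0 ≤ r) {u : (ℕ → ℝ) → H01 D}
    (hu : ∀ y ∈ U, IsTransportedSolution D ψ f y (u y)) {κ a F R : ℝ}
    (hκ : κ = (1 + ξ D ψ) ^ 2 / σ ^ Module.finrank ℝ X)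
    (ha : a = (Module.finrank ℝ X).factorial * (1 + ξ D ψ) ^ Module.finrank ℝ X * (σ⁻¹ * σ⁻¹))
    (hF : F = poincareConst D * √(volume.real D) *
      (Cf * ((Module.finrank ℝ X).factorial * (1 + ξ D ψ) ^ Module.finrank ℝ X)))
    (hR₁ : r + Module.finrank ℝ X ≤ R)
    (hR₂ : (Module.finrank ℝ X + (σ⁻¹ + σ⁻¹)) * (1 + 2 * (κ * a)) ≤ R) :
    HasMajorant (b D ψ) (fun s => toGrad (u (toU s)))
      (fun k => 2 * (κ * F) * R ^ k) := by
  have := completeSpace_gradSpace hn H.isBounded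
  have hξ : 0 ≤ ξ D ψ := xi_nonneg
  have hσ := H.pos
  have hP : 0 ≤ poincareConst D * √(volume.real D) :=
    mul_nonneg (poincareConst_nonneg D) (Real.sqrt_nonneg _)
  have hT : HasMajorant (b D ψ) (stiffness H)
      (fun k => a * (Module.finrank ℝ X + (σ⁻¹ + σ⁻¹)) ^ k) := by
    have h := ((hasMajorant_diffusionField H).clm_le b_nonneg
      (mulFieldL H.isOpen.measurableSet H.volume_ne_top)
        (norm_mulFieldL_le _ _)).clm_le b_nonneg (compressL (gradField D)) (norm_compressL_le _)
    rw [ha]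
    exact h
  have hload : HasMajorant (b D ψ) (fun s => loadL hn H (rhsField H hf hb s))
      (fun k => F * (r + Module.finrank ℝ X) ^ k) := by
    refine ((hasMajorant_rhsField H hf hb hCf hr).clm (loadL hn H) hP
      (norm_loadL_le hn H)).mono b_nonneg fun k => le_of_eq ?_
    rw [hF]
    ring
  have hκ0 : 0 ≤ κ := by rw [hκ]; positivity
  refine hT.solve b_nonneg hκ0 hload (fun s hs => ?_) (fun s hs => ?_) fun k => ?_
  · rw [hκ]
    exact isUnit_stiffness H hs
  · have h := (isTransportedSolution_iff hn H hf hb (u (toU s))).1 (hu _ (toU_mem s))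
    rwa [toCube_toU hs] at h
  · refine geometric_recursion hκ0 (by rw [ha]; positivity) ?_ (by positivity) (by positivity)
      hR₁ hR₂ k
    rw [hF]
    positivity

end Solution

/-! ### Composition with the sine function -/

/-- The coefficients `P_{n,m}` of Faà di Bruno's formula
`(d/dt)^n g(sin 2πt) = ∑_m P_{n,m}(t) g^{(m)}(sin 2πt)`. -/
def sineCoeff : ℕ → ℕ → ℝ → ℝ
  | 0, 0 => fun _ => 1
  | 0, _ + 1 => fun _ => 0
  | _ + 1, 0 => fun _ => 0
  | n + 1, m + 1 => fun t => deriv (sineCoeff n (m + 1)) t +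
      sineCoeff n m t * (2 * Real.pi * Real.cos (2 * Real.pi * t))

lemma contDiff_sineCoeff (n m : ℕ) : ContDiff ℝ ∞ (sineCoeff n m) := by
  induction n generalizing m with
  | zero => cases m <;> exact contDiff_const
  | succ n ih =>
    cases m with
    | zero => exact contDiff_const
    | succ m =>
      have h1 : ContDiff ℝ ∞ (deriv (sineCoeff n (m + 1))) :=
        (contDiff_infty_iff_deriv.1 (ih (m + 1))).2
      exact h1.add ((ih m).mul (by fun_prop))

lemma sineCoeff_eq_zero_of_lt {n m : ℕ} (h : n < m) : sineCoeff n m = fun _ => 0 := by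
  induction n generalizing m with
  | zero =>
    cases m with
    | zero => omega
    | succ m => rfl
  | succ n ih =>
    cases m with
    | zero => omega
    | succ m =>
      funext t
      rw [sineCoeff, ih (by omega), ih (m := m) (by omega)]
      simp

lemma deriv_sineCoeff_zero (n : ℕ) (t : ℝ) : deriv (sineCoeff n 0) t = 0 := by
  cases n <;> simp [sineCoeff]

lemma abs_iteratedDeriv_cos_le (k : ℕ) (t : ℝ) :
    |iteratedDeriv k (fun t => 2 * Real.pi * Real.cos (2 * Real.pi * t)) t| ≤
      (2 * Real.pi) ^ (k + 1) := by
  have hpi := Real.pi_pos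
  have h2 : 0 < 2 * Real.pi := by positivity
  rw [iteratedDeriv_const_mul_field, iteratedDeriv_comp_const_mul Real.contDiff_cos, abs_mul,
    abs_mul (_ ^ k), abs_of_pos h2, abs_of_pos (pow_pos h2 k), pow_succ']
  have := Real.abs_iteratedDeriv_cos_le_one k (2 * Real.pi * t)
  gcongr
  exact mul_le_of_le_one_right (by positivity) this

/-- The recursion for `P_{n,m}` turns into that for the Stirling numbers, because one derivative
costs a factor `2π m` when `m` factors are present. -/
lemma abs_iteratedDeriv_sineCoeff_le (n m k : ℕ) (t : ℝ) :
    |iteratedDeriv k (sineCoeff n m) t| ≤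
      (2 * Real.pi) ^ (n + k) * (m : ℝ) ^ k * Nat.stirlingSecond n m := by
  have hpi := Real.pi_pos
  have hzero : ∀ k, iteratedDeriv k (fun _ : ℝ => (0 : ℝ)) t = 0 := fun k => by
    simp
  induction n generalizing m k with
  | zero =>
    cases m with
    | zero =>
      cases k with
      | zero => simp [sineCoeff]
      | succ k => simp [sineCoeff, iteratedDeriv_const]
    | succ m => simp [sineCoeff, hzero]
  | succ n ih =>
    cases m with
    | zero => simp [sineCoeff, hzero]
    | succ m =>
      have h1 : ContDiff ℝ ∞ (deriv (sineCoeff n (m + 1))) :=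
        (contDiff_infty_iff_deriv.1 (contDiff_sineCoeff n (m + 1))).2
      have h2 : ContDiff ℝ ∞ fun t : ℝ => 2 * Real.pi * Real.cos (2 * Real.pi * t) := by fun_prop
      have hk : (k : WithTop ℕ∞) ≤ ((⊤ : ℕ∞) : WithTop ℕ∞) := by exact_mod_cast le_top
      have h3 := (contDiff_sineCoeff n m).of_le hk
      have hadd : iteratedDeriv k (sineCoeff (n + 1) (m + 1)) t =
          iteratedDeriv (k + 1) (sineCoeff n (m + 1)) t +
            ∑ i ∈ Finset.range (k + 1), (k.choose i : ℝ) * iteratedDeriv i (sineCoeff n m) t *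
              iteratedDeriv (k - i)
                (fun t => 2 * Real.pi * Real.cos (2 * Real.pi * t)) t := by
        rw [iteratedDeriv_succ', ← iteratedDeriv_fun_mul h3.contDiffAt (h2.of_le hk).contDiffAt]
        exact iteratedDeriv_fun_add (h1.of_le hk).contDiffAt (h3.mul (h2.of_le hk)).contDiffAt
      have hprod : |∑ i ∈ Finset.range (k + 1), (k.choose i : ℝ) *
          iteratedDeriv i (sineCoeff n m) t *
            iteratedDeriv (k - i) (fun t => 2 * Real.pi * Real.cos (2 * Real.pi * t)) t| ≤
          (2 * Real.pi) ^ (n + k + 1) * ((m : ℝ) + 1) ^ k * Nat.stirlingSecond n m := by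
        refine (Finset.abs_sum_le_sum_abs _ _).trans ?_
        rw [add_pow, Finset.mul_sum, Finset.sum_mul]
        refine Finset.sum_le_sum fun i hi => ?_
        have hik : i ≤ k := Nat.lt_succ_iff.1 (Finset.mem_range.1 hi)
        rw [abs_mul, abs_mul, Nat.abs_cast]
        calc (k.choose i : ℝ) * |iteratedDeriv i (sineCoeff n m) t| *
              |iteratedDeriv (k - i) (fun t => 2 * Real.pi * Real.cos (2 * Real.pi * t)) t|
            ≤ (k.choose i : ℝ) * ((2 * Real.pi) ^ (n + i) * (m : ℝ) ^ i *
                Nat.stirlingSecond n m) * (2 * Real.pi) ^ (k - i + 1) := by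
              gcongr
              · exact ih m i
              · exact abs_iteratedDeriv_cos_le _ _
          _ = (2 * Real.pi) ^ (n + k + 1) * ((m : ℝ) ^ i * 1 ^ (k - i) * (k.choose i : ℝ)) *
                Nat.stirlingSecond n m := by
              have : n + k + 1 = (n + i) + (k - i + 1) := by omega
              rw [this, pow_add, one_pow]
              ring
      rw [hadd, Nat.stirlingSecond_succ_succ]
      refine (abs_add_le _ _).trans ((add_le_add (ih (m + 1) (k + 1)) hprod).trans (le_of_eq ?_))
      push_cast
      ring

section Composition

variable {Y : Type*} [NormedAddCommGroup Y] [NormedSpace ℝ Y]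

/-- The factor of `∂^m w` in the derivative of order `ν` of `y ↦ w (sin 2πy)`. -/
def sineWeight (ν m : ℕ →₀ ℕ) (y : ℕ → ℝ) : ℝ := ∏ i ∈ ν.support, sineCoeff (ν i) (m i) (y i)

/-- The derivative of order `ν` of `y ↦ w (sin 2πy)`, for the family `W` of the derivatives of
`w`. -/
def sineFamily (W : Multiset ℕ → (ℕ → ℝ) → Y) (ν : ℕ →₀ ℕ) (y : ℕ → ℝ) : Y :=
  ∑ m ∈ Finset.Icc 0 ν, sineWeight ν m y • W (Finsupp.toMultiset m) (toCube y)

/-- The variable `y_j` split off. -/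
lemma sineWeight_eq {ν m : ℕ →₀ ℕ} (hm : m ≤ ν) (j : ℕ) (y : ℕ → ℝ) :
    sineWeight ν m y = sineCoeff (ν j) (m j) (y j) *
      ∏ i ∈ ν.support.erase j, sineCoeff (ν i) (m i) (y i) := by
  by_cases hj : j ∈ ν.support
  · exact (Finset.mul_prod_erase _ _ hj).symm
  · have h0 : ν j = 0 := Finsupp.notMem_support_iff.1 hj
    have h1 : m j = 0 := Nat.le_zero.1 (h0 ▸ hm j)
    rw [Finset.erase_eq_of_notMem hj, h0, h1, sineWeight, sineCoeff, one_mul]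

lemma toCube_update (y : ℕ → ℝ) (j : ℕ) (t : ℝ) :
    toCube (Function.update y j t) =
      Function.update (toCube y) j (Real.sin (2 * Real.pi * t)) := by
  funext i
  by_cases h : i = j
  · subst h; simp [toCube]
  · simp [toCube, h]

lemma hasDerivWithinAt_toCube {W : Multiset ℕ → (ℕ → ℝ) → Y} (hW : IsPartialFamily W)
    (M : Multiset ℕ) (j : ℕ) (y : ℕ → ℝ) :
    HasDerivWithinAt (fun t => W M (toCube (Function.update y j t)))
      ((2 * Real.pi * Real.cos (2 * Real.pi * y j)) • W (j ::ₘ M) (toCube y)) (Icc 0 1) (y j) := by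
  have hsin : HasDerivWithinAt (fun t => Real.sin (2 * Real.pi * t))
      (2 * Real.pi * Real.cos (2 * Real.pi * y j)) (Icc 0 1) (y j) := by
    have h1 : HasDerivAt (fun t : ℝ => 2 * Real.pi * t) (2 * Real.pi) (y j) := by
      simpa using (hasDerivAt_id (y j)).const_mul (2 * Real.pi)
    exact (h1.sin.congr_deriv (mul_comm _ _)).hasDerivWithinAt
  have hmaps : MapsTo (fun t => Real.sin (2 * Real.pi * t)) (Icc 0 1) (Icc (-1) 1) :=
    fun t _ => ⟨Real.neg_one_le_sin _, Real.sin_le_one _⟩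
  have h := HasDerivWithinAt.scomp (y j) (hW M j (toCube y) (toCube_mem y)) hsin hmaps
  simp only [toCube_update]
  exact h

lemma hasDerivWithinAt_sineFamily {W : Multiset ℕ → (ℕ → ℝ) → Y} (hW : IsPartialFamily W)
    (ν : ℕ →₀ ℕ) (j : ℕ) (y : ℕ → ℝ) :
    HasDerivWithinAt (fun t => sineFamily W ν (Function.update y j t))
      (sineFamily W (ν + Finsupp.single j 1) y) (Icc 0 1) (y j) := by
  set ν' := ν + Finsupp.single j 1 with hν'
  set rest : (ℕ →₀ ℕ) → ℝ :=
    fun m => ∏ i ∈ ν.support.erase j, sineCoeff (ν i) (m i) (y i) with hrest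
  set φ : ℝ := 2 * Real.pi * Real.cos (2 * Real.pi * y j) with hφ
  set w : (ℕ →₀ ℕ) → Y := fun m => W (Finsupp.toMultiset m) (toCube y) with hw
  -- the two parts of the product rule
  set F : (ℕ →₀ ℕ) → Y := fun m => (deriv (sineCoeff (ν j) (m j)) (y j) * rest m) • w m with hF
  set G : (ℕ →₀ ℕ) → Y := fun m =>
    if m j = 0 then 0 else (sineCoeff (ν j) (m j - 1) (y j) * rest m * φ) • w m with hG
  have hj' : ν' j = ν j + 1 := by simp [hν']
  have hi' : ∀ i, i ≠ j → ν' i = ν i := fun i hi => by simp [hν', hi]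
  have hle : ν ≤ ν' := le_self_add
  have hrest_add : ∀ m, rest (m + Finsupp.single j 1) = rest m := fun m =>
    Finset.prod_congr rfl fun i hi => by simp [(Finset.mem_erase.1 hi).1]
  have hterm : ∀ m ∈ Finset.Icc 0 ν, HasDerivWithinAt
      (fun t => sineWeight ν m (Function.update y j t) •
        W (Finsupp.toMultiset m) (toCube (Function.update y j t)))
      (F m + G (m + Finsupp.single j 1)) (Icc 0 1) (y j) := by
    intro m hm
    have hmν := (Finset.mem_Icc.1 hm).2
    have h1 : HasDerivWithinAt (fun t => sineWeight ν m (Function.update y j t))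
        (deriv (sineCoeff (ν j) (m j)) (y j) * rest m) (Icc 0 1) (y j) := by
      have heq : (fun t => sineWeight ν m (Function.update y j t)) =
          fun t => sineCoeff (ν j) (m j) t * rest m := by
        funext t
        rw [sineWeight_eq hmν j, Function.update_self]
        congr 1
        exact Finset.prod_congr rfl fun i hi => by
          rw [Function.update_of_ne (Finset.mem_erase.1 hi).1]
      rw [heq]
      exact (((contDiff_sineCoeff _ _).differentiable (by simp)
        (y j)).hasDerivAt.mul_const _).hasDerivWithinAt
    have h2 := h1.fun_smul (hasDerivWithinAt_toCube hW (Finsupp.toMultiset m) j y)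
    refine h2.congr_deriv ?_
    have hms : Finsupp.toMultiset (m + Finsupp.single j 1) = j ::ₘ Finsupp.toMultiset m := by
      rw [Finsupp.toMultiset_add, Finsupp.toMultiset_single, one_smul, add_comm,
        Multiset.singleton_add]
    have hGm : G (m + Finsupp.single j 1) =
        (sineCoeff (ν j) (m j) (y j) * rest m * φ) • W (j ::ₘ Finsupp.toMultiset m) (toCube y) := by
      simp only [hG, hw, hms, hrest_add]
      simp
    rw [hGm, Function.update_eq_self, sineWeight_eq hmν j, smul_smul, add_comm]
  have hsum := HasDerivWithinAt.fun_sum hterm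
  refine hsum.congr_deriv ?_
  rw [Finset.sum_add_distrib]
  have hFsum : ∑ m ∈ Finset.Icc 0 ν, F m = ∑ m ∈ Finset.Icc 0 ν', F m := by
    refine Finset.sum_subset (Finset.Icc_subset_Icc_right hle) fun m hm hm' => ?_
    have hlt : ν j < m j := by
      by_contra! h
      refine hm' (Finset.mem_Icc.2 ⟨zero_le, fun i => ?_⟩)
      by_cases hi : i = j
      · rwa [hi]
      · rw [← hi' i hi]
        exact (Finset.mem_Icc.1 hm).2 i
    simp [hF, sineCoeff_eq_zero_of_lt hlt]
  have hGsum : ∑ m ∈ Finset.Icc 0 ν, G (m + Finsupp.single j 1) = ∑ m ∈ Finset.Icc 0 ν', G m := by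
    rw [← Finset.sum_image (f := G) (g := fun m => m + Finsupp.single j 1)
      fun _ _ _ _ h => add_right_cancel h]
    refine Finset.sum_subset (fun m hm => ?_) fun m hm hm' => ?_
    · obtain ⟨m, hm', rfl⟩ := Finset.mem_image.1 hm
      exact Finset.mem_Icc.2 ⟨zero_le, add_le_add_left (Finset.mem_Icc.1 hm').2 _⟩
    · by_cases h0 : m j = 0
      · simp [hG, h0]
      · exfalso
        have hsingle : Finsupp.single j 1 ≤ m :=
          Finsupp.single_le_iff.2 (Nat.one_le_iff_ne_zero.2 h0)
        refine hm' (Finset.mem_image.2 ⟨m - Finsupp.single j 1, Finset.mem_Icc.2 ⟨zero_le, ?_⟩,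
          tsub_add_cancel_of_le hsingle⟩)
        exact tsub_le_iff_right.2 (Finset.mem_Icc.1 hm).2
  rw [hFsum, hGsum, ← Finset.sum_add_distrib, sineFamily]
  refine Finset.sum_congr rfl fun m hm => ?_
  have hmν := (Finset.mem_Icc.1 hm).2
  have herase : ν'.support.erase j = ν.support.erase j := by
    ext i
    simp only [Finset.mem_erase, Finsupp.mem_support_iff]
    exact and_congr_right fun hi => by rw [hi' i hi]
  have hprod : ∏ i ∈ ν'.support.erase j, sineCoeff (ν' i) (m i) (y i) = rest m := by
    rw [herase]
    exact Finset.prod_congr rfl fun i hi => by rw [hi' i (Finset.mem_erase.1 hi).1]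
  rw [sineWeight_eq hmν j, hprod, hj']
  simp only [hF, hG]
  cases hmj : m j with
  | zero => simp [sineCoeff, deriv_sineCoeff_zero]
  | succ k =>
    rw [if_neg (Nat.succ_ne_zero k), ← add_smul, Nat.add_sub_cancel, sineCoeff, add_mul]
    congr 2
    ring

lemma norm_sineFamily_le {W : Multiset ℕ → (ℕ → ℝ) → Y} {b : ℕ → ℝ} {c : ℕ → ℝ}
    (hW : ∀ M, ∀ s ∈ cube, ‖W M s‖ ≤
      c (Multiset.card M) * ((Multiset.card M).factorial : ℝ) * (M.map b).prod)
    (ν : ℕ →₀ ℕ) (y : ℕ → ℝ) :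
    ‖sineFamily W ν y‖ ≤ (2 * Real.pi) ^ ν.degree * ∑ m ∈ Finset.Icc 0 ν,
      (∏ i ∈ ν.support, (Nat.stirlingSecond (ν i) (m i) : ℝ)) *
        (c m.degree * (m.degree.factorial : ℝ) * ∏ i ∈ m.support, b i ^ m i) := by
  have hpi := Real.pi_pos
  refine (norm_sum_le _ _).trans ?_
  rw [Finset.mul_sum]
  refine Finset.sum_le_sum fun m _ => ?_
  have h1 : |sineWeight ν m y| ≤
      (2 * Real.pi) ^ ν.degree * ∏ i ∈ ν.support, (Nat.stirlingSecond (ν i) (m i) : ℝ) := by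
    rw [sineWeight, Finset.abs_prod, Finsupp.degree_apply, ← Finset.prod_pow_eq_pow_sum,
      ← Finset.prod_mul_distrib]
    refine Finset.prod_le_prod (fun _ _ => abs_nonneg _) fun i _ => ?_
    simpa using abs_iteratedDeriv_sineCoeff_le (ν i) (m i) 0 (y i)
  have h2 := hW (Finsupp.toMultiset m) _ (toCube_mem y)
  have hcard : Multiset.card (Finsupp.toMultiset m) = m.degree := by
    rw [Finsupp.card_toMultiset]
    rfl
  have hprod : ((Finsupp.toMultiset m).map b).prod = ∏ i ∈ m.support, b i ^ m i := by
    rw [Finsupp.toMultiset_apply, Finsupp.sum, ← Multiset.coe_mapAddMonoidHom, map_sum,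
      Multiset.prod_sum]
    exact Finset.prod_congr rfl fun i _ => by
      rw [Multiset.coe_mapAddMonoidHom, Multiset.map_nsmul, Multiset.map_singleton,
        Multiset.prod_nsmul, Multiset.prod_singleton]
  rw [hcard, hprod] at h2
  rw [norm_smul, Real.norm_eq_abs, ← mul_assoc]
  exact mul_le_mul h1 h2 (norm_nonneg _) ((abs_nonneg _).trans h1)

end Composition

/-! ### The constants -/

/-- The growth rate obtained for the derivatives in the cube variables dominates those of the
data. -/
lemma rate_bounds {d : ℕ} (hd3 : d ≤ 3) {ξ σ ρ N : ℝ} (hξ : 0 ≤ ξ) (hσ : 0 < σ)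
    (hσ1 : σ ≤ 1) (hρ : 1 ≤ ρ) (hN : 1 ≤ N) :
    1 ≤ 2 * N * (2 + ξ) ^ d * (1 + ξ) ^ 3 / σ ^ (d + 4) ∧
    d * ρ + d ≤ 2 * N * (2 + ξ) ^ d * (1 + ξ) ^ 3 / σ ^ (d + 4) *
      ((2 + √2) * max (1 + √3) ρ) ∧
    (d + (σ⁻¹ + σ⁻¹)) * (1 + 2 * ((1 + ξ) ^ 2 / σ ^ d * (N * (1 + ξ) ^ d * (σ⁻¹ * σ⁻¹)))) ≤
      2 * N * (2 + ξ) ^ d * (1 + ξ) ^ 3 / σ ^ (d + 4) * ((2 + √2) * max (1 + √3) ρ) := by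
  have hs1 : 1 ≤ σ⁻¹ := (one_le_inv₀ hσ).2 hσ1
  have hσs : ∀ k : ℕ, (σ ^ k)⁻¹ = σ⁻¹ ^ k := fun k => (inv_pow σ k).symm
  simp only [div_eq_mul_inv, hσs]
  set s := σ⁻¹ with hs
  have hs0 : 0 ≤ s := by linarith
  have hx1 : 1 ≤ 1 + ξ := by linarith
  have hz1 : 1 ≤ 2 + ξ := by linarith
  have hd3' : (d : ℝ) ≤ 3 := by exact_mod_cast hd3
  have hd0 : (0 : ℝ) ≤ d := Nat.cast_nonneg d
  have h2 : 1 ≤ √2 := Real.one_le_sqrt.2 (by norm_num)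
  have h3 : 3 / 2 ≤ √3 := Real.le_sqrt_of_sq_le (by norm_num)
  -- `L` is the common factor of the two sides of the last inequality
  set L : ℝ := N * (2 + ξ) ^ d * (1 + ξ) ^ 2 * s ^ (d + 2) with hL
  have hL1 : 1 ≤ L := by
    rw [hL]
    exact one_le_mul_of_one_le_of_one_le (one_le_mul_of_one_le_of_one_le
      (one_le_mul_of_one_le_of_one_le hN (one_le_pow₀ hz1)) (one_le_pow₀ hx1)) (one_le_pow₀ hs1)
  have hK : 2 * N * (2 + ξ) ^ d * (1 + ξ) ^ 3 * s ^ (d + 4) = 2 * (L * ((1 + ξ) * s) * s) := by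
    rw [hL]; ring
  have hKL : L * s ≤ L * ((1 + ξ) * s) * s := by
    have : 1 ≤ (1 + ξ) * s := one_le_mul_of_one_le_of_one_le hx1 hs1
    have hL0 : 0 ≤ L := by linarith
    calc L * s = L * 1 * s := by ring
      _ ≤ _ := by gcongr
  have hLs : 1 ≤ L * s := one_le_mul_of_one_le_of_one_le hL1 hs1
  have hτρ : 3 * ρ ≤ (2 + √2) * max (1 + √3) ρ := by
    have := le_max_right (1 + √3) ρ
    nlinarith
  have hτ : 15 / 2 ≤ (2 + √2) * max (1 + √3) ρ := by
    have := le_max_left (1 + √3) ρ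
    nlinarith
  set τ := (2 + √2) * max (1 + √3) ρ with hτ_def
  rw [hK]
  refine ⟨by linarith, ?_, ?_⟩
  · have h4 : d * ρ + d ≤ 2 * (3 * ρ) := by nlinarith
    have h5 : 2 * 1 * (3 * ρ) ≤ 2 * (L * ((1 + ξ) * s) * s) * τ := by
      gcongr
      exact hLs.trans hKL
    linarith
  · have h6 : (1 + ξ) ^ 2 * s ^ d * (N * (1 + ξ) ^ d * (s * s)) ≤ L := by
      have : (1 + ξ) ^ d ≤ (2 + ξ) ^ d := by gcongr; norm_num
      calc (1 + ξ) ^ 2 * s ^ d * (N * (1 + ξ) ^ d * (s * s))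
          = N * (1 + ξ) ^ d * (1 + ξ) ^ 2 * s ^ (d + 2) := by ring
        _ ≤ L := by rw [hL]; gcongr
    have h0 : 0 ≤ (1 + ξ) ^ 2 * s ^ d * (N * (1 + ξ) ^ d * (s * s)) := by positivity
    calc (d + (s + s)) * (1 + 2 * ((1 + ξ) ^ 2 * s ^ d * (N * (1 + ξ) ^ d * (s * s))))
        ≤ (5 * s) * (3 * L) := by
          gcongr
          · linarith
          · linarith
      _ = 2 * (L * s) * (15 / 2) := by ring
      _ ≤ 2 * (L * ((1 + ξ) * s) * s) * τ := by gcongr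

/-- Each term of the sum produced by the composition with the sine is at most the corresponding
term of `spodSum`; the term `m = 0` vanishes because `S(n, 0) = 0` for `n ≥ 1`. -/
lemma sine_sum_le_spodSum {d : ℕ} (hd : 1 ≤ d) {b : ℕ → ℝ} (hb : ∀ i, 0 ≤ b i) {C K τ : ℝ}
    (hC : 0 ≤ C) (hK : 1 ≤ K) (hτ : 0 ≤ τ) {ν : ℕ →₀ ℕ} (hν : ν ≠ 0) :
    (2 * Real.pi) ^ ν.degree * ∑ m ∈ Finset.Icc 0 ν,
      (∏ i ∈ ν.support, (Nat.stirlingSecond (ν i) (m i) : ℝ)) *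
        (C * (K * τ) ^ m.degree * (m.degree.factorial : ℝ) * ∏ i ∈ m.support, b i ^ m i) ≤
      C * (2 * Real.pi * K) ^ ν.degree * spodSum d (fun i => τ * b i) ν := by
  have hpi := Real.pi_pos
  have hsub : ∑ m ∈ Finset.Icc 0 ν,
      (∏ i ∈ ν.support, (Nat.stirlingSecond (ν i) (m i) : ℝ)) *
        (C * (K * τ) ^ m.degree * (m.degree.factorial : ℝ) * ∏ i ∈ m.support, b i ^ m i) =
      ∑ m ∈ Finset.Ioc 0 ν, (∏ i ∈ ν.support, (Nat.stirlingSecond (ν i) (m i) : ℝ)) *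
        (C * (K * τ) ^ m.degree * (m.degree.factorial : ℝ) * ∏ i ∈ m.support, b i ^ m i) := by
    refine (Finset.sum_subset Finset.Ioc_subset_Icc_self fun m hm hm' => ?_).symm
    have hm0 : m = 0 := by
      by_contra h
      exact hm' (Finset.mem_Ioc.2 ⟨pos_iff_ne_zero.2 h, (Finset.mem_Icc.1 hm).2⟩)
    obtain ⟨i, hi⟩ := Finsupp.support_nonempty_iff.2 hν
    have hprod : ∏ i ∈ ν.support, (Nat.stirlingSecond (ν i) (m i) : ℝ) = 0 := by
      refine Finset.prod_eq_zero hi ?_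
      obtain ⟨k, hk⟩ := Nat.exists_eq_succ_of_ne_zero (Finsupp.mem_support_iff.1 hi)
      rw [hm0, hk, Finsupp.coe_zero, Pi.zero_apply, Nat.stirlingSecond_succ_zero, Nat.cast_zero]
    rw [hprod, zero_mul]
  rw [hsub, spodSum, Finset.mul_sum, Finset.mul_sum]
  refine Finset.sum_le_sum fun m hm => ?_
  have hmν : m.degree ≤ ν.degree := Finsupp.degree_mono (Finset.mem_Ioc.1 hm).2
  have hKpow : K ^ m.degree ≤ K ^ ν.degree := pow_le_pow_right₀ hK hmν
  have hfac : (m.degree.factorial : ℝ) ≤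
      ((m.degree + d - 1).factorial : ℝ) / ((d - 1).factorial : ℝ) := by
    rw [le_div_iff₀ (by positivity), Nat.add_sub_assoc hd]
    exact_mod_cast Nat.le_of_dvd (Nat.factorial_pos _)
      (Nat.factorial_mul_factorial_dvd_factorial_add _ _)
  have hmfac : (1 : ℝ) ≤ ∏ i ∈ m.support, ((m i).factorial : ℝ) := by
    exact_mod_cast Finset.one_le_prod' fun i _ => Nat.one_le_iff_ne_zero.2 (Nat.factorial_ne_zero _)
  have hβ : ∏ i ∈ m.support, (τ * b i) ^ m i = τ ^ m.degree * ∏ i ∈ m.support, b i ^ m i := by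
    simp only [mul_pow]
    rw [Finset.prod_mul_distrib, Finset.prod_pow_eq_pow_sum, Finsupp.degree_apply]
  have hbprod : 0 ≤ ∏ i ∈ m.support, b i ^ m i := Finset.prod_nonneg fun i _ => pow_nonneg (hb i) _
  rw [hβ]
  set S : ℝ := ∏ i ∈ ν.support, (Nat.stirlingSecond (ν i) (m i) : ℝ) with hS
  have hS0 : 0 ≤ S := Finset.prod_nonneg fun _ _ => Nat.cast_nonneg _
  set P := ∏ i ∈ m.support, b i ^ m i
  calc (2 * Real.pi) ^ ν.degree *
        (S * (C * (K * τ) ^ m.degree * (m.degree.factorial : ℝ) * P))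
      = C * ((2 * Real.pi) ^ ν.degree * K ^ m.degree) *
          ((m.degree.factorial : ℝ) * 1 * (τ ^ m.degree * P) * S) := by
        rw [mul_pow K]; ring
    _ ≤ _ := by
        rw [mul_pow (2 * Real.pi)]
        gcongr

section Euclidean

variable {d : ℕ} {D : Set (E d)} {ψ : ℕ → E d → E d} {σmin σmax : ℝ} {f : E d → ℝ} {Cf ρ : ℝ}

lemma isAdmissible (hD : IsBoundedLipschitzDomain D) (hA1 : AssumptionA1 D ψ)
    (hA3 : AssumptionA3 D ψ σmin σmax) (hA4 : AssumptionA4 D ψ) : IsAdmissible D ψ σmin where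
  isOpen := hD.isOpen
  isPreconnected := hD.isConnected.isPreconnected
  isBounded := hD.isBounded
  a1 := hA1
  a4 := hA4
  pos := hA3.1
  mul_norm_le := fun _ hx _ hy v => mul_norm_le_norm_J hA3 hx hy v
  pow_le_det := fun _ hx _ hy => by
    rw [finrank_euclideanSpace_fin]
    exact pow_le_det_J hA3 hx hy

lemma hasDirBounds (hS : IsOpen (holdAll D ψ)) (hf : AnalyticOnNhd ℝ f (holdAll D ψ))
    (hC : 0 ≤ Cf) (hρ : 0 ≤ ρ) (h : HasAnalyticBounds (holdAll D ψ) f Cf ρ) :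
    HasDirBounds (holdAll D ψ) f Cf (d * ρ) :=
  fun l _ hz => abs_dirDeriv_le hS hf hC hρ h l hz

lemma hasMajorant_toGrad_solution (hd2 : 2 ≤ d) (hd3 : d ≤ 3) (H : IsAdmissible D ψ σmin)
    (hσ1 : σmin ≤ 1) (hf : AnalyticOnNhd ℝ f (holdAll D ψ)) (hCf : 0 ≤ Cf) (hρ : 1 ≤ ρ)
    (hb : HasAnalyticBounds (holdAll D ψ) f Cf ρ) {u : (ℕ → ℝ) → H01 D}
    (hu : ∀ y ∈ U, IsTransportedSolution D ψ f y (u y)) :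
    HasMajorant (b D ψ) (fun s => toGrad (u (toU s))) (fun k => 2 * Cinit D ψ σmin Cf *
      (2 * d.factorial * (2 + ξ D ψ) ^ d * (1 + ξ D ψ) ^ 3 / σmin ^ (d + 4) *
        ((2 + √2) * max (1 + √3) ρ)) ^ k) := by
  have hξ : 0 ≤ ξ D ψ := xi_nonneg
  have hσ := H.pos
  have hfin : Module.finrank ℝ (E d) = d := finrank_euclideanSpace_fin
  obtain ⟨hK, h1, h2⟩ := rate_bounds (N := d.factorial) hd3 hξ hσ hσ1 hρ
    (by exact_mod_cast Nat.factorial_pos d)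
  have hdir := hasDirBounds H.isOpen_holdAll hf hCf (by linarith) hb
  set R := 2 * d.factorial * (2 + ξ D ψ) ^ d * (1 + ξ D ψ) ^ 3 / σmin ^ (d + 4) *
    ((2 + √2) * max (1 + √3) ρ) with hR_def
  have h := hasMajorant_grad_solution (R := R) (by rw [hfin]; exact hd2) H hf hdir hCf
    (by positivity) hu rfl rfl rfl (by rw [hfin]; exact h1) (by rw [hfin]; exact h2)
  rw [hfin] at h
  refine h.mono b_nonneg fun k => ?_
  have hP := poincareConst_nonneg D
  have hx : (1 + ξ D ψ) ^ d ≤ (2 + ξ D ψ) ^ d := by gcongr; norm_num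
  have hR : 0 ≤ R := le_trans (by positivity) h1
  refine mul_le_mul_of_nonneg_right ?_ (pow_nonneg hR k)
  rw [Cinit]
  calc 2 * ((1 + ξ D ψ) ^ 2 / σmin ^ d * (poincareConst D * √(volume.real D) *
        (Cf * (d.factorial * (1 + ξ D ψ) ^ d))))
      ≤ 2 * ((1 + ξ D ψ) ^ 2 / σmin ^ d * (poincareConst D * √(volume.real D) *
        (Cf * (d.factorial * (2 + ξ D ψ) ^ d)))) := by gcongr
    _ = _ := by ring

end Euclidean

end DomainUQ

end

theorem theorem3p5 (d : ℕ) (hd : d = 2 ∨ d = 3)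
    (D : Set (DomainUQ.E d)) (hD : DomainUQ.IsBoundedLipschitzDomain D)
    (ψ : ℕ → DomainUQ.E d → DomainUQ.E d) (σmin σmax : ℝ)
    (hA1 : DomainUQ.AssumptionA1 D ψ) (hA2 : DomainUQ.AssumptionA2 D ψ)
    (hA3 : DomainUQ.AssumptionA3 D ψ σmin σmax) (hA4 : DomainUQ.AssumptionA4 D ψ)
    (f : DomainUQ.E d → ℝ) (hf : AnalyticOnNhd ℝ f (DomainUQ.holdAll D ψ)) :
    (AnalyticOnNhd ℝ f (closure (DomainUQ.holdAll D ψ)) →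
      ∃ Cf ρ : ℝ, 0 < Cf ∧ 1 ≤ ρ ∧
        DomainUQ.HasAnalyticBounds (DomainUQ.holdAll D ψ) f Cf ρ) ∧
    ∀ Cf ρ : ℝ, 0 < Cf → 1 ≤ ρ →
      DomainUQ.HasAnalyticBounds (DomainUQ.holdAll D ψ) f Cf ρ →
      (∀ y ∈ DomainUQ.U, ∃! u : DomainUQ.H01 D, DomainUQ.IsTransportedSolution D ψ f y u) ∧
      ∀ u : (ℕ → ℝ) → DomainUQ.H01 D,
        (∀ y ∈ DomainUQ.U, DomainUQ.IsTransportedSolution D ψ f y (u y)) →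
        ∃ W : (ℕ →₀ ℕ) → (ℕ → ℝ) → DomainUQ.H01 D,
          DomainUQ.IsParametricDerivative u W ∧
          ∀ y ∈ DomainUQ.U, ∀ ν : ℕ →₀ ℕ, ν ≠ 0 →
            DomainUQ.h01Norm (W ν y) ≤
              2 * DomainUQ.Cinit D ψ σmin Cf *
                (4 * Real.pi * d.factorial * (2 + DomainUQ.ξ D ψ) ^ d *
                  (1 + DomainUQ.ξ D ψ) ^ 3 / σmin ^ (d + 4)) ^ ν.degree *
                DomainUQ.spodSum d (DomainUQ.β D ψ ρ) ν := by
  have hd2 : 2 ≤ d := by omega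
  have hd3 : d ≤ 3 := by omega
  have hn : 2 ≤ Module.finrank ℝ (DomainUQ.E d) := by rwa [finrank_euclideanSpace_fin]
  have H := DomainUQ.isAdmissible hD hA1 hA3 hA4
  refine ⟨fun hfc => DomainUQ.exists_hasAnalyticBounds H.isOpen_holdAll
    (DomainUQ.isBounded_holdAll hD.isOpen hD.isBounded hA1 hA4) (by omega) hfc,
    fun Cf ρ hCf hρ hb => ?_⟩
  have hdir := DomainUQ.hasDirBounds H.isOpen_holdAll hf hCf.le (by linarith) hb
  have hex := fun y => DomainUQ.existsUnique_isTransportedSolution hn H hf hdir y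
  refine ⟨fun y _ => hex y, fun u hu => ?_⟩
  obtain ⟨W, hW0, hW, hWbd⟩ :=
    DomainUQ.hasMajorant_toGrad_solution hd2 hd3 H hA3.2.1 hf hCf.le hρ hb hu
  have hξ : 0 ≤ DomainUQ.ξ D ψ := DomainUQ.xi_nonneg
  have hσ := hA3.1
  set ι := DomainUQ.ofGrad hn H.isBounded
  refine ⟨fun ν y => ι (DomainUQ.sineFamily W ν y), ⟨fun y hy => ?_, fun ν j y _ => ?_⟩,
    fun y _ ν hν => ?_⟩
  · have hs := DomainUQ.toCube_mem y
    have hsol : u (DomainUQ.toU (DomainUQ.toCube y)) = u y := by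
      refine (hex y).unique ?_ (hu y hy)
      exact (DomainUQ.isTransportedSolution_congr (DomainUQ.toCube_toU hs) _).1
        (hu _ (DomainUQ.toU_mem _))
    have h0 : DomainUQ.sineFamily W 0 y = DomainUQ.toGrad (u y) := by
      simp [DomainUQ.sineFamily, DomainUQ.sineWeight, hW0 _ hs, hsol]
    simp only [h0]
    exact DomainUQ.ofGrad_toGrad _ _ _
  · exact ι.hasFDerivAt.comp_hasDerivWithinAt (y j)
      (DomainUQ.hasDerivWithinAt_sineFamily hW ν j y)
  · have hC : 0 ≤ DomainUQ.Cinit D ψ σmin Cf := by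
      have := DomainUQ.poincareConst_nonneg D
      rw [DomainUQ.Cinit]
      positivity
    obtain ⟨hK, -, -⟩ := DomainUQ.rate_bounds (N := d.factorial) hd3 hξ hσ
      hA3.2.1 hρ (by exact_mod_cast Nat.factorial_pos d)
    have h := DomainUQ.norm_sineFamily_le (c := fun k => 2 * DomainUQ.Cinit D ψ σmin Cf *
      (2 * d.factorial * (2 + DomainUQ.ξ D ψ) ^ d * (1 + DomainUQ.ξ D ψ) ^ 3 / σmin ^ (d + 4) *
        ((2 + √2) * max (1 + √3) ρ)) ^ k) hWbd ν y
    have h' := DomainUQ.sine_sum_le_spodSum (d := d) (τ := (2 + √2) * max (1 + √3) ρ)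
      (by omega) (DomainUQ.b_nonneg (D := D) (ψ := ψ)) (mul_nonneg zero_le_two hC) hK
      (by positivity) hν
    rw [DomainUQ.h01Norm_ofGrad]
    refine (h.trans h').trans (le_of_eq ?_)
    congr 3
    ring
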